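/- **Setting.** A crystalline anisotropy is a convex, positively one-homogeneous function $\varphi:\mathbb R^2\to[0,\infty)$ with $c|x|\le\varphi(x)\le C|x|$ for some $0<c\le C$, whose Wulff shape $W^\varphi=\{\varphi\le1\}$ is a polygon; $\varphi^o(x)=\max_{y\in W^\varphi}\langle x,y\rangle$. The edges of $W^\varphi$ are called facets, with outer unit normals. Fix $\alpha>0$. A polygonal curve $\Gamma=\bigcup_{i=1}^nS_i$ is an oriented, possibly self-intersecting, union of consecutive nondegenerate segments; it is either closed, with indices read cyclically, or unbounded, and then $n\ge2$ and exactly $S_1$ and $S_n$ are half-lines. The unit normal $\nu_{S_i}$ is the unit tangent turned counterclockwise by $90^\circ$. The angle $\theta_i\in(0,2\pi)$ between $S_{i-1}$ and $S_i$ is the one on the side to which the normals point. $\Gamma$ is admissible if the normals of any two consecutive pieces $S_{i-1},S_i$ are normals of two distinct facets of $W^\varphi$ with a common vertex; $F_i$ denotes the facet with normal $\nu_{S_i}$. The transition number $c_i$ is $+1$ if $S_i$ is a segment with $\theta_i,\theta_{i+1}>\pi$, $-1$ if $S_i$ is a segment with $\theta_i,\theta_{i+1}<\pi$, and $0$ otherwise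 (in particular for half-lines). The $\varphi$-curvature of $S_i$ is $c_i\mathcal H^1(F_i)/\mathcal H^1(S_i)$. Two polygonal curves are parallel if they have the same number of pieces, corresponding pieces are both segments or both half-lines and have equal normals, and corresponding half-lines have bounded symmetric difference. The signed height from $S_i$ to a parallel piece $\bar S_i$ is the number $h$ such that the line through $\bar S_i$ is the line through $S_i$ translated by $h\,\nu_{S_i}$. Let $\Gamma^0=\bigcup_{i=1}^nS_i^0$ be an admissible polygonal curve and $T\in(0,\infty]$. A crystalline elastic flow on $[0,T)$ starting from $\Gamma^0$ is a family $\Gamma(t)=\bigcup_{i=1}^nS_i(t)$, $t\in[0,T)$, of polygonal curves parallel to $\Gamma^0$, with $\Gamma(0)=\Gamma^0$, such that the signed heights $h_i(t)$ from $S_i^0$ to $S_i(t)$ belong to $C^0([0,T))\cap C^1(0,T)$ and, for every $i$ for which $S_i$ is a segment, $$\frac{h_i'}{\varphi^o(\nu_{S_i})}=-\frac{c_i\mathcal H^1(F_i)}{\mathcal H^1(S_i)}-\frac{\alpha}{\mathcal H^1(S_i)}\Big(\frac{c_{i-1}^2\delta_{i-1}}{\mathcal H^1(S_{i-1})^2\sin\theta_i}+\frac{c_i^2\delta_i[\cot\theta_i+\cot\theta_{i+1}]}{\mathcal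 H^1(S_i)^2}+\frac{c_{i+1}^2\delta_{i+1}}{\mathcal H^1(S_{i+1})^2\sin\theta_{i+1}}\Big)\quad\text{in }(0,T),$$ where $\delta_j=\mathcal H^1(F_j)^2\varphi^o(\nu_{S_j})$, $S_j=S_j(t)$, and terms with $c_j=0$ vanish. **Theorem.** Let $\varphi$ be a crystalline anisotropy, $\alpha>0$, and $\Gamma^0=\bigcup_{i=1}^nS_i^0$ an admissible (closed or unbounded) polygonal curve. Then: (a) There are a maximal time $T^\dagger\in(0,\infty]$ and a unique crystalline elastic flow $\{\Gamma(t)\}_{t\in[0,T^\dagger)}$ starting from $\Gamma^0$: every crystalline elastic flow on some $[0,T)$ starting from $\Gamma^0$ satisfies $T\le T^\dagger$ and agrees with $\Gamma(\cdot)$ on $[0,T)$. (b) The flow has the semigroup property: for every $s\in[0,T^\dagger)$ the maximal flow starting from $\Gamma(s)$ exists exactly on $[0,T^\dagger-s)$, and $\Gamma(t+s;\Gamma^0)=\Gamma(t;\Gamma(s;\Gamma^0))$ for all $t\ge0$ with $t+s<T^\dagger$, where $\Gamma(\cdot;\Sigma)$ is the maximal flow starting from $\Sigma$. (c) Suppose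 that $\Gamma^0$ is bounded and $T^\dagger<\infty$. Then there is an admissible polygonal curve $\Gamma(T^\dagger)$ (not necessarily with $n$ segments) such that $t\mapsto\Gamma(t)$ is Kuratowski continuous on $[0,T^\dagger]$ and $\bigcup_{t\in[0,T^\dagger]}\Gamma(t)$ is bounded. There is an index $i$ with $c_i=0$, that is, a segment of zero $\varphi$-curvature, such that $\lim_{t\nearrow T^\dagger}\mathcal H^1(S_i(t))=0$. Moreover, for every $i$ such that $S_i$ has nonzero $\varphi$-curvature there is $\varepsilon>0$ with $\mathcal H^1(S_i(t))\ge\varepsilon$ for all $t\in[0,T^\dagger)$. -/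

import Mathlib

open Set Filter Topology

noncomputable section

namespace Crystalline

/-- The Euclidean plane. -/
abbrev Plane := EuclideanSpace ℝ (Fin 2)

/-- Counterclockwise rotation by 90 degrees. -/
def rot (v : Plane) : Plane := !₂[-v 1, v 0]

/-! ### Anisotropies and their Wulff shapes -/

/-- A (not necessarily even) anisotropy: a convex, positively one-homogeneous function that is
comparable to the Euclidean norm. -/
structure IsAnisotropy (φ : Plane → ℝ) : Prop where
  convex : ConvexOn ℝ univ φ
  homogeneous : ∀ (r : ℝ) (x : Plane), 0 ≤ r → φ (r • x) = r * φ x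
  bounds : ∃ c C : ℝ, 0 < c ∧ ∀ x, c * ‖x‖ ≤ φ x ∧ φ x ≤ C * ‖x‖

/-- The Wulff shape (unit ball) of `φ`. -/
def wulff (φ : Plane → ℝ) : Set Plane := {x | φ x ≤ 1}

/-- The dual anisotropy `φᵒ(x) = max {⟨x, y⟩ : y ∈ wulff φ}`. -/
def dual (φ : Plane → ℝ) (x : Plane) : ℝ := sSup ((fun y => inner ℝ x y) '' wulff φ)

/-- A crystalline anisotropy: the Wulff shape is a polygon, i.e. the convex hull of finitely many
points (it automatically has the origin in its interior). -/
def IsCrystalline (φ : Plane → ℝ) : Prop :=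
  IsAnisotropy φ ∧ ∃ s : Finset Plane, wulff φ = convexHull ℝ (s : Set Plane)

/-- The face of the Wulff shape in direction `ν`. It is a vertex or, if it has more than one point,
the facet with outer unit normal `ν`. -/
def face (φ : Plane → ℝ) (ν : Plane) : Set Plane :=
  {x | x ∈ wulff φ ∧ inner ℝ ν x = dual φ ν}

/-- `ν` is the outer unit normal of a facet of the Wulff shape. -/
def IsFacetNormal (φ : Plane → ℝ) (ν : Plane) : Prop := ‖ν‖ = 1 ∧ (face φ ν).Nontrivial

/-- `ν₁` and `ν₂` are the normals of two distinct facets of the Wulff shape with a common vertex. -/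
def AdjacentFacets (φ : Plane → ℝ) (ν₁ ν₂ : Plane) : Prop :=
  IsFacetNormal φ ν₁ ∧ IsFacetNormal φ ν₂ ∧ ν₁ ≠ ν₂ ∧ (face φ ν₁ ∩ face φ ν₂).Nonempty

/-- The length (one-dimensional Hausdorff measure) of the facet with normal `ν`. -/
def facetLength (φ : Plane → ℝ) (ν : Plane) : ℝ :=
  (MeasureTheory.Measure.hausdorffMeasure 1 (face φ ν)).toReal

/-! ### Oriented segments and half-lines -/

/-- An oriented segment or half-line: the segment run from `p` to `q`; the half-line
`{q - s τ : s ≥ 0}` run in direction `τ` from infinity to its endpoint `q`; the half-line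
`{p + s τ : s ≥ 0}` run in direction `τ` from its endpoint `p` to infinity. -/
inductive Piece where
  | segment (p q : Plane) : Piece
  | incoming (q τ : Plane) : Piece
  | outgoing (p τ : Plane) : Piece

namespace Piece

/-- Segments have two different endpoints; directions of half-lines are unit vectors. -/
def Nondegenerate : Piece → Prop
  | segment p q => p ≠ q
  | incoming _ τ => ‖τ‖ = 1
  | outgoing _ τ => ‖τ‖ = 1

def IsHalfLine : Piece → Prop
  | segment _ _ => False
  | incoming _ _ => True
  | outgoing _ _ => True

/-- The initial endpoint; `none` stands for infinity. -/
def start : Piece → Option Plane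
  | segment p _ => some p
  | incoming _ _ => none
  | outgoing p _ => some p

/-- The final endpoint; `none` stands for infinity. -/
def finish : Piece → Option Plane
  | segment _ q => some q
  | incoming q _ => some q
  | outgoing _ _ => none

/-- The underlying point set. -/
def carrier : Piece → Set Plane
  | segment p q => _root_.segment ℝ p q
  | incoming q τ => {x | ∃ s : ℝ, 0 ≤ s ∧ x = q - s • τ}
  | outgoing p τ => {x | ∃ s : ℝ, 0 ≤ s ∧ x = p + s • τ}

/-- The unit tangent, in the direction of the orientation. -/
def tangent : Piece → Plane
  | segment p q => ‖q - p‖⁻¹ • (q - p)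
  | incoming _ τ => τ
  | outgoing _ τ => τ

/-- The unit normal: the tangent turned counterclockwise by 90 degrees. -/
def normal (S : Piece) : Plane := rot S.tangent

/-- The length of a segment (half-lines get the value `0`, which is never used: below, the length of
a half-line only occurs multiplied by its transition number, which is zero). -/
def length : Piece → ℝ
  | segment p q => dist p q
  | incoming _ _ => 0
  | outgoing _ _ => 0

/-- One of the endpoints. -/
def point : Piece → Plane
  | segment p _ => p
  | incoming q _ => q
  | outgoing p _ => p

/-- The signed height from `S` to a parallel piece `T`: the number `h` such that the straight line
through `T` is the straight line through `S` translated by `h ν_S`. -/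
def signedHeight (S T : Piece) : ℝ := inner ℝ (T.point - S.point) S.normal

/-- The angle `θ ∈ (0, 2π)` between consecutive pieces `S` and `T`, measured on the side to which
the normals point: at their common vertex the pieces leave in directions `-τ_S` and `τ_T`. The
convex cone that these span contains the normals exactly if the curve turns left, and then `θ` is
the angle of this cone; otherwise `θ` is the complementary angle. -/
def angle (S T : Piece) : ℝ :=
  if 0 < inner ℝ S.normal T.tangent then InnerProductGeometry.angle (-S.tangent) T.tangent
  else 2 * Real.pi - InnerProductGeometry.angle (-S.tangent) T.tangent

end Piece

/-! ### Polygonal curves -/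

/-- An oriented polygonal curve, possibly with self-intersections, that consists of `n` consecutive
nondegenerate segments/half-lines, indexed cyclically by `Fin n`. It is either closed (all pieces are
segments) or unbounded, and then exactly its first piece is an incoming and its last piece an
outgoing half-line: in the latter case `consecutive` also says that the end of the last piece and
the start of the first one are both at infinity. -/
@[ext]
structure PolygonalCurve (n : ℕ) [NeZero n] where
  piece : Fin n → Piece
  nondegenerate : ∀ i, (piece i).Nondegenerate
  consecutive : ∀ i, (piece i).finish = (piece (i + 1)).start
  unbounded_only_at_ends : ∀ i, (piece i).start = none → i = 0

namespace PolygonalCurve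

variable {n : ℕ} [NeZero n]

/-- The curve as a set of points. -/
def carrier (Γ : PolygonalCurve n) : Set Plane := ⋃ i, (Γ.piece i).carrier

/-- Admissibility: consecutive pieces have normals of facets of the Wulff shape with a common
vertex. -/
def Admissible (φ : Plane → ℝ) (Γ : PolygonalCurve n) : Prop :=
  ∀ i, (Γ.piece i).finish ≠ none → AdjacentFacets φ (Γ.piece i).normal (Γ.piece (i + 1)).normal

/-- The angle `θ i` between the pieces `i - 1` and `i`. -/
def θ (Γ : PolygonalCurve n) (i : Fin n) : ℝ := (Γ.piece (i - 1)).angle (Γ.piece i)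

open Classical in
/-- The transition number: `1` if the curve is convex around the segment `i` (it turns right at both
ends, so the normal points outwards), `-1` if it is concave (it turns left at both ends), `0` if it
is neither or if the piece is a half-line. -/
def transition (Γ : PolygonalCurve n) (i : Fin n) : ℝ :=
  if (Γ.piece i).IsHalfLine then 0
  else if Real.pi < Γ.θ i ∧ Real.pi < Γ.θ (i + 1) then 1
  else if Γ.θ i < Real.pi ∧ Γ.θ (i + 1) < Real.pi then -1
  else 0

/-- The `φ`-curvature of an admissible curve on its piece `i`. -/
def curvature (φ : Plane → ℝ) (Γ : PolygonalCurve n) (i : Fin n) : ℝ :=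
  Γ.transition i * facetLength φ (Γ.piece i).normal / (Γ.piece i).length

/-- `Δ` is parallel to `Γ`: corresponding pieces have the same normal and are of the same kind, and
corresponding half-lines have bounded symmetric difference. -/
def Parallel (Γ Δ : PolygonalCurve n) : Prop :=
  ∀ i, (Δ.piece i).normal = (Γ.piece i).normal ∧
    ((Γ.piece i).IsHalfLine ↔ (Δ.piece i).IsHalfLine) ∧
    ((Γ.piece i).IsHalfLine →
      Bornology.IsBounded (symmDiff (Γ.piece i).carrier (Δ.piece i).carrier))

/-- The coefficient `δ i = ℋ¹(F i)² φᵒ(ν i)`. -/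
def δ (φ : Plane → ℝ) (Γ : PolygonalCurve n) (i : Fin n) : ℝ :=
  facetLength φ (Γ.piece i).normal ^ 2 * dual φ (Γ.piece i).normal

/-- The right-hand side of the system of ordinary differential equations of the flow. -/
def elasticForce (φ : Plane → ℝ) (α : ℝ) (Γ : PolygonalCurve n) (i : Fin n) : ℝ :=
  - (Γ.transition i * facetLength φ (Γ.piece i).normal / (Γ.piece i).length)
  - α / (Γ.piece i).length *
    (Γ.transition (i - 1) ^ 2 * Γ.δ φ (i - 1)
        / ((Γ.piece (i - 1)).length ^ 2 * Real.sin (Γ.θ i))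
      + Γ.transition i ^ 2 * Γ.δ φ i * (Real.cot (Γ.θ i) + Real.cot (Γ.θ (i + 1)))
        / (Γ.piece i).length ^ 2
      + Γ.transition (i + 1) ^ 2 * Γ.δ φ (i + 1)
        / ((Γ.piece (i + 1)).length ^ 2 * Real.sin (Γ.θ (i + 1))))

end PolygonalCurve

/-! ### The crystalline elastic flow -/

/-- The signed height at time `t` of piece `i` of the family `Γ` over the initial curve `Γ₀`. -/
def height {n : ℕ} [NeZero n] (Γ₀ : PolygonalCurve n) (Γ : ℝ → PolygonalCurve n) (i : Fin n)
    (t : ℝ) : ℝ :=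
  (Γ₀.piece i).signedHeight ((Γ t).piece i)

/-- The family `Γ t`, `t ∈ [0, T)`, is a crystalline elastic flow starting from `Γ₀`
(values of `Γ` at times outside `[0, T)` play no role). -/
structure IsFlow {n : ℕ} [NeZero n] (φ : Plane → ℝ) (α : ℝ) (Γ₀ : PolygonalCurve n) (T : EReal)
    (Γ : ℝ → PolygonalCurve n) : Prop where
  pos : 0 < T
  initial : Γ 0 = Γ₀
  parallel : ∀ t : ℝ, 0 ≤ t → (t : EReal) < T → Γ₀.Parallel (Γ t)
  continuousOn : ∀ i, ContinuousOn (height Γ₀ Γ i) {t : ℝ | 0 ≤ t ∧ (t : EReal) < T}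
  contDiffOn : ∀ i, ContDiffOn ℝ 1 (height Γ₀ Γ i) {t : ℝ | 0 < t ∧ (t : EReal) < T}
  ode : ∀ i, ¬ (Γ₀.piece i).IsHalfLine → ∀ t : ℝ, 0 < t → (t : EReal) < T →
    deriv (height Γ₀ Γ i) t / dual φ (Γ₀.piece i).normal = (Γ t).elasticForce φ α i

/-- A flow on `[0, T)` whose time of existence `T` is maximal among all flows from `Γ₀`. -/
def IsMaximalFlow {n : ℕ} [NeZero n] (φ : Plane → ℝ) (α : ℝ) (Γ₀ : PolygonalCurve n) (T : EReal)
    (Γ : ℝ → PolygonalCurve n) : Prop :=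
  IsFlow φ α Γ₀ T Γ ∧ ∀ (T' : EReal) (Δ : ℝ → PolygonalCurve n), IsFlow φ α Γ₀ T' Δ → T' ≤ T

/-! ### Kuratowski convergence -/

/-- The Kuratowski lower limit of the sets `A t` along the filter `l`. -/
def kuratowskiLiminf (A : ℝ → Set Plane) (l : Filter ℝ) : Set Plane :=
  {x | ∀ ε > 0, ∀ᶠ t in l, (A t ∩ Metric.ball x ε).Nonempty}

/-- The Kuratowski upper limit of the sets `A t` along the filter `l`. -/
def kuratowskiLimsup (A : ℝ → Set Plane) (l : Filter ℝ) : Set Plane :=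
  {x | ∀ ε > 0, ∃ᶠ t in l, (A t ∩ Metric.ball x ε).Nonempty}

/-- Continuity of a set-valued map on `I` with respect to Kuratowski convergence. -/
def KuratowskiContinuousOn (A : ℝ → Set Plane) (I : Set ℝ) : Prop :=
  ∀ t ∈ I, kuratowskiLiminf A (𝓝[I] t) = A t ∧ kuratowskiLimsup A (𝓝[I] t) = A t

end Crystalline

end

/-!
The heights of the pieces are unknowns of an ordinary differential equation. A curve parallel to
`Γ₀` is determined by the offsets `H i` of the lines carrying its pieces, and conversely offsets
define a parallel curve (`PolygonalCurve.curveOf`) as soon as they lie in the open set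
`PolygonalCurve.region` where all the segments, whose signed lengths are linear in `H`, have
positive length; on half-lines the offset is frozen. In these coordinates a crystalline elastic flow
is precisely a solution of `y' = X y` in this open set, with a smooth field `X`
(`IsFlow.isSolution`, `IsSolution.isFlow`). Existence of a maximal solution, uniqueness and the
semigroup property are then those of autonomous systems (`exists_maximal_isSolution`,
`IsSolution.eq`, `IsSolution.le_sub_of_maximal`).

Suppose now that the curve is closed and the maximal time `T` is finite.

*Segments of nonzero curvature do not shrink to points.* The elastic energy, the sum of
`c_j² δ_j / ℓ_j` over the segments, grows at most exponentially: completing the square in its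
derivative leaves at most a multiple of the energy itself (`IsSolution.elasticEnergy_le`). As
`c_j² δ_j > 0` when `c_j ≠ 0`, those lengths stay above a positive constant
(`IsSolution.exists_le_lengthOf`).

*Segments of zero curvature have convergent lengths.* The two neighbours of such a segment have the
same normal, since the facet of `W^φ` adjacent to a given one on a given side is unique; hence the
length depends on the heights of the neighbours only. A neighbour of nonzero curvature has bounded
speed, since its length is bounded below, and a neighbour of zero curvature moves in the direction
that shortens the segment. So the derivative of the length is bounded above and the length converges
(`IsSolution.exists_deriv_lengthOf_le`). If the limit is positive, or if the curvature is nonzero,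
the speed stays bounded and the offset of the segment converges (`IsSolution.collapsed_or_stable`).
If no segment collapsed, the limit offsets would lie in the region and the solution could be
continued (`IsSolution.exists_collapsed`); nor can all of them collapse, because then all of them
would have zero curvature and the curve would not move (`IsSolution.exists_not_collapsed`).

*The limit curve.* The moving curve is a cyclic chain of segments of which some collapse. A
collapsing segment sits between two segments with equal normals, so it may be deleted and its
neighbours merged into one segment whose normal is adjacent to the next ones (`Chain.merge`); this
changes the point set by an amount tending to zero (`Chain.hausdorffClose_merge`). After finitely
many deletions no segment collapses, all vertices converge, and the limit is an admissible closed
curve, attained in the Hausdorff sense (`Chain.exists_limit`). Hausdorff convergence to a compact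
set gives the Kuratowski continuity.
-/

noncomputable section

namespace Crystalline

/-! ### Maximal solutions of autonomous differential equations -/

section ODE

variable {E : Type*} [NormedAddCommGroup E] [NormedSpace ℝ E]

/-- `y` solves `y' = X y` on `[0, T)` with `y 0 = x₀`, staying in `U`. As for crystalline elastic
flows, the equation is only required at positive times. -/
structure IsSolution (X : E → E) (U : Set E) (x₀ : E) (T : EReal) (y : ℝ → E) : Prop where
  initial : y 0 = x₀
  mem : ∀ t : ℝ, 0 ≤ t → (t : EReal) < T → y t ∈ U
  continuousOn : ContinuousOn y {t : ℝ | 0 ≤ t ∧ (t : EReal) < T}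
  hasDerivAt : ∀ t : ℝ, 0 < t → (t : EReal) < T → HasDerivAt y (X (y t)) t

lemma isOpen_setOf_pos_lt (T : EReal) : IsOpen {t : ℝ | 0 < t ∧ (t : EReal) < T} :=
  (isOpen_lt continuous_const continuous_id).inter
    (isOpen_lt continuous_coe_real_ereal continuous_const)

lemma Icc_subset_of_lt {T : EReal} {b : ℝ} (hb : (b : EReal) < T) :
    Icc 0 b ⊆ {t : ℝ | 0 ≤ t ∧ (t : EReal) < T} := fun _ ht =>
  ⟨ht.1, (EReal.coe_le_coe_iff.2 ht.2).trans_lt hb⟩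

lemma mem_nhdsWithin_Ici_of_lt {T : EReal} {t : ℝ} (ht : 0 ≤ t) (hT : (t : EReal) < T) :
    {t : ℝ | 0 ≤ t ∧ (t : EReal) < T} ∈ 𝓝[Ici t] t := by
  have h : {s : ℝ | (s : EReal) < T} ∈ 𝓝 t :=
    (isOpen_lt continuous_coe_real_ereal continuous_const).mem_nhds hT
  filter_upwards [mem_nhdsWithin_of_mem_nhds h, self_mem_nhdsWithin] with s hs hs'
  exact ⟨ht.trans hs', hs⟩

variable {X : E → E} {U : Set E} {x₀ : E} {T T' : EReal} {y z : ℝ → E}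

lemma IsSolution.hasDerivWithinAt (h : IsSolution X U x₀ T y) (hX : ContinuousOn X U)
    (hU : IsOpen U) {t : ℝ} (ht : 0 ≤ t) (hT : (t : EReal) < T) :
    HasDerivWithinAt y (X (y t)) (Ici t) t := by
  rcases ht.eq_or_lt with rfl | h0
  · have hs : {t : ℝ | 0 < t ∧ (t : EReal) < T} ∈ 𝓝[>] (0 : ℝ) := by
      filter_upwards [self_mem_nhdsWithin,
        nhdsWithin_mono _ Ioi_subset_Ici_self (mem_nhdsWithin_Ici_of_lt le_rfl hT)] with s h1 h2
      exact ⟨h1, h2.2⟩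
    have hc : ContinuousWithinAt y (Ioi 0) 0 :=
      ((h.continuousOn 0 ⟨le_rfl, hT⟩).mono_of_mem_nhdsWithin
        (mem_nhdsWithin_Ici_of_lt le_rfl hT)).mono Ioi_subset_Ici_self
    refine hasDerivWithinAt_Ici_of_tendsto_deriv
      (s := {t : ℝ | 0 < t ∧ (t : EReal) < T}) ?_ (hc.mono fun s hs => hs.1) hs ?_
    · exact fun s hs => (h.hasDerivAt s hs.1 hs.2).differentiableAt.differentiableWithinAt
    · have : Tendsto (fun s => X (y s)) (𝓝[>] 0) (𝓝 (X (y 0))) :=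
        ((hX.continuousAt (hU.mem_nhds (h.mem 0 le_rfl hT))).tendsto).comp hc
      refine this.congr' ?_
      filter_upwards [hs] with s hs
      exact (h.hasDerivAt s hs.1 hs.2).deriv.symm
  · exact (h.hasDerivAt t h0 hT).hasDerivWithinAt

lemma locallyLipschitzOn_of_contDiffOn (hU : IsOpen U) (hX : ContDiffOn ℝ 1 X U) :
    LocallyLipschitzOn U X := by
  intro x hx
  obtain ⟨K, t, ht, hL⟩ := (hX.contDiffAt (hU.mem_nhds hx)).exists_lipschitzOnWith
  exact ⟨K, t, mem_nhdsWithin_of_mem_nhds ht, hL⟩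

theorem IsSolution.eq (hU : IsOpen U) (hX : ContDiffOn ℝ 1 X U) (h : IsSolution X U x₀ T y)
    (h' : IsSolution X U x₀ T' z) {t : ℝ} (ht : 0 ≤ t) (hT : (t : EReal) < T)
    (hT' : (t : EReal) < T') : y t = z t := by
  have hy := h.continuousOn.mono (Icc_subset_of_lt hT)
  have hz := h'.continuousOn.mono (Icc_subset_of_lt hT')
  -- `X` is Lipschitz on the compact set swept by the two trajectories.
  set S := y '' Icc 0 t ∪ z '' Icc 0 t with hS
  have hSc : IsCompact S := (isCompact_Icc.image_of_continuousOn hy).union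
    (isCompact_Icc.image_of_continuousOn hz)
  have hSU : S ⊆ U := by
    rintro _ (⟨s, hs, rfl⟩ | ⟨s, hs, rfl⟩)
    · exact h.mem s hs.1 (Icc_subset_of_lt hT hs).2
    · exact h'.mem s hs.1 (Icc_subset_of_lt hT' hs).2
  obtain ⟨K, hK⟩ := ((locallyLipschitzOn_of_contDiffOn hU hX).mono
    hSU).exists_lipschitzOnWith_of_compact hSc
  refine ODE_solution_unique_of_mem_Icc_right (v := fun _ => X) (s := fun _ => S) (K := K)
    (fun _ _ => hK) hy ?_ ?_ hz ?_ ?_ (h.initial.trans h'.initial.symm) ⟨ht, le_rfl⟩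
  · exact fun s hs => h.hasDerivWithinAt hX.continuousOn hU hs.1
      (Icc_subset_of_lt hT (Ico_subset_Icc_self hs)).2
  · exact fun s hs => Or.inl ⟨s, Ico_subset_Icc_self hs, rfl⟩
  · exact fun s hs => h'.hasDerivWithinAt hX.continuousOn hU hs.1
      (Icc_subset_of_lt hT' (Ico_subset_Icc_self hs)).2
  · exact fun s hs => Or.inr ⟨s, Ico_subset_Icc_self hs, rfl⟩

/-- Solutions with initial points near a given point exist for a uniform time. -/
theorem exists_isSolution_of_mem_ball [CompleteSpace E] (hU : IsOpen U) (hX : ContDiffOn ℝ 1 X U)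
    {x : E} (hx : x ∈ U) : ∃ r > 0, ∃ ε > (0 : ℝ), ∀ x₀ ∈ Metric.ball x r, ∃ y : ℝ → E,
      IsSolution X U x₀ (ε : ℝ) y := by
  obtain ⟨ε, hε, a, r, L, K, hr, hpl⟩ :=
    IsPicardLindelof.of_contDiffAt_one (hX.contDiffAt (hU.mem_nhds hx))
  obtain ⟨Φ, hΦ, hc⟩ := (hpl 0).exists_forall_mem_closedBall_eq_hasDerivWithinAt_continuousOn
  simp only [zero_sub, zero_add] at hΦ hc
  -- By joint continuity, the local flow `Φ` stays in `U` after shrinking radius and time.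
  have h0 : Φ (x, 0) ∈ U := by
    rw [(hΦ x (Metric.mem_closedBall_self r.2)).1]; exact hx
  have hnhds : Metric.closedBall x r ×ˢ Icc (-ε) ε ∈ 𝓝 (x, (0 : ℝ)) :=
    prod_mem_nhds (Metric.closedBall_mem_nhds x hr) (Icc_mem_nhds (by linarith) hε)
  have hpre := (hc.continuousAt hnhds).preimage_mem_nhds (hU.mem_nhds h0)
  rw [nhds_prod_eq] at hpre
  obtain ⟨A, hA, B, hB, hAB⟩ := mem_prod_iff.1 hpre
  obtain ⟨r', hr', hrA⟩ := Metric.mem_nhds_iff.1 hA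
  obtain ⟨ε', hε', hεB⟩ := Metric.mem_nhds_iff.1 hB
  refine ⟨min r r', lt_min hr hr', min ε ε', lt_min hε hε', fun x₀ hx₀ => ⟨fun t => Φ (x₀, t), ?_⟩⟩
  have hx₁ : x₀ ∈ Metric.closedBall x r := Metric.ball_subset_closedBall
    (Metric.ball_subset_ball (min_le_left _ _) hx₀)
  obtain ⟨hi, hd⟩ := hΦ x₀ hx₁
  refine ⟨hi, fun t h0 ht => ?_, ?_, fun t h0 ht => ?_⟩
  · have ht := EReal.coe_lt_coe_iff.1 ht
    refine hAB ⟨hrA (Metric.ball_subset_ball (min_le_right _ _) hx₀), hεB ?_⟩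
    rw [Metric.mem_ball, Real.dist_0_eq_abs, abs_of_nonneg h0]
    exact ht.trans_le (min_le_right _ _)
  · intro t ht
    have ht' := (EReal.coe_lt_coe_iff.1 ht.2).trans_le (min_le_left _ _)
    refine ((hd t ⟨by linarith [ht.1], ht'.le⟩).continuousWithinAt).mono fun s hs => ?_
    exact ⟨by linarith [hs.1], ((EReal.coe_lt_coe_iff.1 hs.2).trans_le (min_le_left _ _)).le⟩
  · have ht' := (EReal.coe_lt_coe_iff.1 ht).trans_le (min_le_left _ _)
    exact (hd t ⟨by linarith, ht'.le⟩).hasDerivAt (Icc_mem_nhds (by linarith) ht')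

theorem IsSolution.shift (h : IsSolution X U x₀ T y) {s : ℝ} (hs : 0 ≤ s) :
    IsSolution X U (y s) (T - s) (fun t => y (s + t)) := by
  have key : ∀ t : ℝ, (t : EReal) < T - s → ((s + t : ℝ) : EReal) < T := fun t ht => by
    rw [EReal.lt_sub_iff_add_lt (by simp) (by simp)] at ht
    rwa [add_comm, EReal.coe_add]
  refine ⟨by simp, fun t h0 ht => h.mem _ (by positivity) (key t ht), ?_, fun t h0 ht => ?_⟩
  · exact h.continuousOn.comp (by fun_prop) fun t ht => ⟨add_nonneg hs ht.1, key t ht.2⟩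
  · exact (h.hasDerivAt _ (by positivity) (key t ht)).comp_const_add s t

/-- A solution that starts from a later value of a given one can be appended to the latter: by
uniqueness they agree on a common interval, so that the result is differentiable. -/
theorem IsSolution.concat (hU : IsOpen U) (hX : ContDiffOn ℝ 1 X U) (h : IsSolution X U x₀ T y)
    {s : ℝ} (hs : 0 ≤ s) (hsT : (s : EReal) < T) (h' : IsSolution X U (y s) T' z) :
    ∃ w, IsSolution X U x₀ (s + T') w := by
  have key : ∀ t : ℝ, (t : EReal) < s + T' → ((t - s : ℝ) : EReal) < T' := fun t ht => by
    rw [EReal.coe_sub]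
    exact EReal.sub_lt_of_lt_add' ht
  have agree : ∀ t : ℝ, s ≤ t → (t : EReal) < T → (t : EReal) < s + T' → y t = z (t - s) := by
    intro t hst hT hT'
    have := (h.shift hs).eq hU hX h' (t := t - s) (by linarith) ?_ (key t hT')
    · simpa using this
    · rw [EReal.lt_sub_iff_add_lt (by simp) (by simp), ← EReal.coe_add]
      simpa using hT
  set w : ℝ → E := fun t => if t ≤ s then y t else z (t - s) with hw
  have w1 : ∀ t : ℝ, (t : EReal) < T → (t : EReal) < s + T' → w t = y t := by
    intro t h1 h2
    rcases le_or_gt t s with h3 | h3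
    · simp [hw, h3]
    · simp only [hw, not_le.2 h3, if_false]
      exact (agree t h3.le h1 h2).symm
  have w2 : ∀ t : ℝ, s < t → w t = z (t - s) := fun t ht => by simp [hw, not_le.2 ht]
  have o1 : IsOpen {t : ℝ | (t : EReal) < T} := isOpen_lt continuous_coe_real_ereal continuous_const
  have o2 : IsOpen {t : ℝ | (t : EReal) < s + T'} :=
    isOpen_lt continuous_coe_real_ereal continuous_const
  refine ⟨w, ?_, fun t h0 ht => ?_, fun t ht => ?_, fun t h0 ht => ?_⟩
  · simp [hw, hs, h.initial]
  · rcases le_or_gt t s with h3 | h3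
    · simp only [hw, h3, if_true]
      exact h.mem t h0 ((EReal.coe_le_coe_iff.2 h3).trans_lt hsT)
    · rw [w2 t h3]
      exact h'.mem _ (by linarith) (key t ht)
  · rcases le_or_gt t s with h3 | h3
    · have hT := (EReal.coe_le_coe_iff.2 h3).trans_lt hsT
      have hc : ContinuousWithinAt y {t : ℝ | 0 ≤ t ∧ (t : EReal) < s + T'} t :=
        (h.continuousOn t ⟨ht.1, hT⟩).mono_of_mem_nhdsWithin <| by
          filter_upwards [mem_nhdsWithin_of_mem_nhds (o1.mem_nhds hT), self_mem_nhdsWithin]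
            with u hu hu'
          exact ⟨hu'.1, hu⟩
      refine hc.congr_of_eventuallyEq ?_ (w1 t hT ht.2)
      filter_upwards [mem_nhdsWithin_of_mem_nhds (o1.mem_nhds hT), self_mem_nhdsWithin]
            with u hu hu'
      exact w1 u hu hu'.2
    · have hp : 0 < t - s := sub_pos.2 h3
      have hc : ContinuousAt (fun u => z (u - s)) t :=
        ContinuousAt.comp (f := fun u : ℝ => u - s) (x := t)
          (h'.hasDerivAt _ hp (key t ht.2)).continuousAt (by fun_prop)
      refine (hc.congr ?_).continuousWithinAt
      filter_upwards [lt_mem_nhds h3] with u hu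
      exact (w2 u hu).symm
  · rcases le_or_gt t s with h3 | h3
    · have hT := (EReal.coe_le_coe_iff.2 h3).trans_lt hsT
      rw [w1 t hT ht]
      refine (h.hasDerivAt t h0 hT).congr_of_eventuallyEq ?_
      filter_upwards [o1.mem_nhds hT, o2.mem_nhds ht] with u hu hu'
      exact w1 u hu hu'
    · rw [w2 t h3]
      refine ((h'.hasDerivAt _ (sub_pos.2 h3) (key t ht)).comp_sub_const t s).congr_of_eventuallyEq ?_
      filter_upwards [lt_mem_nhds h3] with u hu
      exact w2 u hu

/-- The maximal solution: it extends every solution with the same initial value. -/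
theorem exists_maximal_isSolution [CompleteSpace E] (hU : IsOpen U) (hX : ContDiffOn ℝ 1 X U)
    (hx₀ : x₀ ∈ U) : ∃ (T : EReal) (y : ℝ → E), 0 < T ∧ IsSolution X U x₀ T y ∧
      ∀ T' z, IsSolution X U x₀ T' z → T' ≤ T := by
  set 𝒯 : Set EReal := {T | ∃ z, IsSolution X U x₀ T z} with h𝒯
  have hex : ∀ t : ℝ, (t : EReal) < sSup 𝒯 → ∃ T' z, (t : EReal) < T' ∧ IsSolution X U x₀ T' z := by
    intro t ht
    obtain ⟨T', ⟨z, hz⟩, hT'⟩ := lt_sSup_iff.1 ht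
    exact ⟨T', z, hT', hz⟩
  choose! τ z hτ hz using hex
  -- By uniqueness, the diagonal `t ↦ z t t` agrees with each solution `z t` on its domain.
  set y : ℝ → E := fun t => z t t with hy
  have agree : ∀ t s : ℝ, (t : EReal) < sSup 𝒯 → 0 ≤ s → (s : EReal) < τ t →
      (s : EReal) < sSup 𝒯 → y s = z t s := fun t s ht h0 hs hs' =>
    (hz s hs').eq hU hX (hz t ht) h0 (hτ s hs') hs
  have near : ∀ t : ℝ, (t : EReal) < sSup 𝒯 →
      {s : ℝ | (s : EReal) < τ t ∧ (s : EReal) < sSup 𝒯} ∈ 𝓝 t := fun t ht =>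
    ((isOpen_lt continuous_coe_real_ereal continuous_const).inter
      (isOpen_lt continuous_coe_real_ereal continuous_const)).mem_nhds ⟨hτ t ht, ht⟩
  have hpos : 0 < sSup 𝒯 := by
    obtain ⟨r, hr, ε, hε, h⟩ := exists_isSolution_of_mem_ball hU hX hx₀
    obtain ⟨w, hw⟩ := h x₀ (Metric.mem_ball_self hr)
    exact (EReal.coe_lt_coe_iff.2 hε).trans_le (le_sSup ⟨w, hw⟩)
  refine ⟨sSup 𝒯, y, hpos, ⟨?_, fun t h0 ht => ?_, fun t ht => ?_, fun t h0 ht => ?_⟩,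
    fun T' w hw => le_sSup ⟨w, hw⟩⟩
  · exact (hz 0 hpos).initial
  · exact (hz t ht).mem t h0 (hτ t ht)
  · have hn : {s : ℝ | (s : EReal) < τ t ∧ (s : EReal) < sSup 𝒯} ∈
        𝓝[{t : ℝ | 0 ≤ t ∧ (t : EReal) < sSup 𝒯}] t := mem_nhdsWithin_of_mem_nhds (near t ht.2)
    have hc : ContinuousWithinAt (z t) {t : ℝ | 0 ≤ t ∧ (t : EReal) < sSup 𝒯} t :=
      ((hz t ht.2).continuousOn t ⟨ht.1, hτ t ht.2⟩).mono_of_mem_nhdsWithin <| by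
        filter_upwards [hn, self_mem_nhdsWithin] with s hs hs'
        exact ⟨hs'.1, hs.1⟩
    refine hc.congr_of_eventuallyEq ?_ rfl
    filter_upwards [hn, self_mem_nhdsWithin] with s hs hs'
    exact agree t s ht.2 hs'.1 hs.1 hs'.2
  · refine ((hz t ht).hasDerivAt t h0 (hτ t ht)).congr_of_eventuallyEq ?_
    filter_upwards [near t ht, lt_mem_nhds h0] with s hs hs'
    exact agree t s ht hs'.le hs.1 hs.2

/-- The maximal solution restarted at time `s` is maximal. -/
theorem IsSolution.le_sub_of_maximal (hU : IsOpen U) (hX : ContDiffOn ℝ 1 X U)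
    (h : IsSolution X U x₀ T y) (hmax : ∀ T' z, IsSolution X U x₀ T' z → T' ≤ T)
    {s : ℝ} (hs : 0 ≤ s) (hsT : (s : EReal) < T) (h' : IsSolution X U (y s) T' z) :
    T' ≤ T - s := by
  obtain ⟨w, hw⟩ := h.concat hU hX hs hsT h'
  rw [EReal.le_sub_iff_add_le (by simp) (by simp), add_comm]
  exact hmax _ _ hw

/-- A maximal solution that ends at a finite time leaves `U`. -/
theorem IsSolution.not_tendsto_of_maximal [CompleteSpace E] (hU : IsOpen U)
    (hX : ContDiffOn ℝ 1 X U) {T : ℝ} (hT : 0 < T) (h : IsSolution X U x₀ T y)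
    (hmax : ∀ T' z, IsSolution X U x₀ T' z → T' ≤ T) {x : E} (hx : x ∈ U) :
    ¬ Tendsto y (𝓝[<] T) (𝓝 x) := by
  intro hlim
  obtain ⟨r, hr, ε, hε, hsol⟩ := exists_isSolution_of_mem_ball hU hX hx
  -- Restarting at a time `s > T - ε` at which `y` is close to `x` gives a solution beyond `T`.
  have e1 : y ⁻¹' Metric.ball x r ∈ 𝓝[<] T := hlim (Metric.ball_mem_nhds x hr)
  have e2 : Ioo (max 0 (T - ε)) T ∈ 𝓝[<] T := Ioo_mem_nhdsLT (by simp [hT, hε])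
  obtain ⟨s, hs1, hs2⟩ := (Filter.inter_mem e1 e2 |> Filter.nonempty_of_mem)
  obtain ⟨z, hz⟩ := hsol _ hs1
  have h0 : 0 ≤ s := (le_max_left _ _).trans hs2.1.le
  have := h.le_sub_of_maximal hU hX hmax h0 (EReal.coe_lt_coe_iff.2 hs2.2) hz
  rw [← EReal.coe_sub, EReal.coe_le_coe_iff] at this
  have := (le_max_right 0 (T - ε)).trans_lt hs2.1
  linarith

end ODE

end Crystalline

namespace Crystalline

/-! ### Plane geometry and the Wulff shape -/

/-- The determinant of two vectors of the plane. -/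
def det (u v : Plane) : ℝ := u 0 * v 1 - u 1 * v 0

lemma inner_eq (x y : Plane) : inner ℝ x y = x 0 * y 0 + x 1 * y 1 := by
  simp [PiLp.inner_apply, Fin.sum_univ_two, mul_comm]

@[simp] lemma rot_zero (v : Plane) : rot v 0 = -v 1 := by simp [rot]

@[simp] lemma rot_one (v : Plane) : rot v 1 = v 0 := by simp [rot]

lemma plane_ext {u v : Plane} (h0 : u 0 = v 0) (h1 : u 1 = v 1) : u = v := by
  ext i; fin_cases i <;> assumption

lemma norm_sq_eq (v : Plane) : ‖v‖ ^ 2 = v 0 ^ 2 + v 1 ^ 2 := by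
  rw [← real_inner_self_eq_norm_sq, inner_eq]; ring

lemma norm_rot (v : Plane) : ‖rot v‖ = ‖v‖ := by
  rw [← sq_eq_sq₀ (norm_nonneg _) (norm_nonneg _), norm_sq_eq, norm_sq_eq]
  simp; ring

lemma rot_injective : Function.Injective rot := fun u v h => by
  have h0 := congrArg (fun w : Plane => w 0) h
  have h1 := congrArg (fun w : Plane => w 1) h
  simp only [rot_zero, rot_one, neg_inj] at h0 h1
  exact plane_ext h1 h0

lemma rot_neg_rot (v : Plane) : rot (-rot v) = v := by
  apply plane_ext <;> simp

lemma rot_smul (r : ℝ) (v : Plane) : rot (r • v) = r • rot v := by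
  apply plane_ext <;> simp

lemma inner_rot_self (v : Plane) : inner ℝ v (rot v) = 0 := by
  rw [inner_eq]; simp; ring

lemma inner_rot_right (u v : Plane) : inner ℝ u (rot v) = det v u := by
  rw [inner_eq, det]; simp; ring

lemma det_rot_rot (u v : Plane) : det (rot u) (rot v) = det u v := by
  simp [det]; ring

lemma sq_coord_add (v : Plane) (h : ‖v‖ = 1) : v 0 ^ 2 + v 1 ^ 2 = 1 := by
  rw [← norm_sq_eq, h, one_pow]

/-- Unit vectors with vanishing determinant agree up to sign. -/
lemma eq_or_eq_neg_of_det_eq_zero {u v : Plane} (hu : ‖u‖ = 1) (hv : ‖v‖ = 1) (h : det u v = 0) :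
    u = v ∨ u = -v := by
  have h1 := sq_coord_add u hu
  have h2 := sq_coord_add v hv
  rw [det] at h
  have h3 : (u 0 * v 0 + u 1 * v 1) ^ 2 = 1 := by
    have : (u 0 * v 0 + u 1 * v 1) ^ 2 + (u 0 * v 1 - u 1 * v 0) ^ 2
      = (u 0 ^ 2 + u 1 ^ 2) * (v 0 ^ 2 + v 1 ^ 2) := by ring
    rw [h, h1, h2] at this; linarith
  rcases sq_eq_sq_iff_eq_or_eq_neg.1 (h3.trans (one_pow 2).symm) with h4 | h4
  · left
    have : (u 0 - v 0) ^ 2 + (u 1 - v 1) ^ 2 = 0 := by nlinarith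
    apply plane_ext <;> nlinarith [sq_nonneg (u 0 - v 0), sq_nonneg (u 1 - v 1)]
  · right
    have : (u 0 + v 0) ^ 2 + (u 1 + v 1) ^ 2 = 0 := by nlinarith
    apply plane_ext <;> simp <;> nlinarith [sq_nonneg (u 0 + v 0), sq_nonneg (u 1 + v 1)]

/-- A vector orthogonal to `rot τ` is a multiple of the unit vector `τ`. -/
lemma eq_inner_smul_of_inner_rot_eq_zero {τ x : Plane} (hτ : ‖τ‖ = 1) (h : inner ℝ x (rot τ) = 0) :
    x = (inner ℝ x τ) • τ := by
  have h1 := sq_coord_add τ hτ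
  rw [inner_eq] at h ⊢
  simp only [rot_zero, rot_one] at h
  apply plane_ext <;> simp only [PiLp.smul_apply, smul_eq_mul]
  · linear_combination (-x 0) * h1 + (-τ 1) * h
  · linear_combination (-x 1) * h1 + (τ 0) * h

/-- A vector orthogonal to two independent vectors vanishes. -/
lemma eq_zero_of_inner_eq_zero {u v x : Plane} (h : det u v ≠ 0) (hu : inner ℝ x u = 0)
    (hv : inner ℝ x v = 0) : x = 0 := by
  rw [inner_eq] at hu hv
  have h0 : x 0 * det u v = 0 := by rw [det]; linear_combination (v 1) * hu - (u 1) * hv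
  have h1 : x 1 * det u v = 0 := by rw [det]; linear_combination (u 0) * hv - (v 0) * hu
  exact plane_ext ((mul_eq_zero.1 h0).resolve_right h) ((mul_eq_zero.1 h1).resolve_right h)

variable {φ : Plane → ℝ}

lemma IsAnisotropy.norm_le (hφ : IsAnisotropy φ) : ∃ R : ℝ, ∀ x ∈ wulff φ, ‖x‖ ≤ R := by
  obtain ⟨c, C, hc, h⟩ := hφ.bounds
  refine ⟨1 / c, fun x hx => ?_⟩
  rw [le_div_iff₀ hc, mul_comm]
  exact (h x).1.trans hx

lemma IsAnisotropy.inner_le_dual (hφ : IsAnisotropy φ) (ν : Plane) {x : Plane} (hx : x ∈ wulff φ) :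
    inner ℝ ν x ≤ dual φ ν := by
  obtain ⟨R, hR⟩ := hφ.norm_le
  refine le_csSup ⟨‖ν‖ * R, ?_⟩ ⟨x, hx, rfl⟩
  rintro _ ⟨y, hy, rfl⟩
  exact (real_inner_le_norm ν y).trans (by gcongr; exact hR y hy)

lemma IsAnisotropy.dual_pos (hφ : IsAnisotropy φ) {ν : Plane} (hν : ‖ν‖ = 1) : 0 < dual φ ν := by
  obtain ⟨c, C, hc, h⟩ := hφ.bounds
  have hC : 0 < C := by
    have := (h ν).1.trans (h ν).2
    rw [hν] at this; linarith
  have hm : (1 / C) • ν ∈ wulff φ := by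
    change φ _ ≤ 1
    rw [hφ.homogeneous _ _ (by positivity), one_div, ← div_eq_inv_mul, div_le_one hC]
    simpa [hν] using (h ν).2
  refine lt_of_lt_of_le ?_ (hφ.inner_le_dual ν hm)
  rw [inner_smul_right, real_inner_self_eq_norm_sq, hν]
  positivity

lemma IsAnisotropy.convex_wulff (hφ : IsAnisotropy φ) : Convex ℝ (wulff φ) := by
  have := hφ.convex.convex_le 1
  simpa [wulff] using this

lemma IsAnisotropy.convex_face (hφ : IsAnisotropy φ) (ν : Plane) : Convex ℝ (face φ ν) := by
  refine hφ.convex_wulff.inter ?_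
  exact convex_hyperplane (IsLinearMap.mk (fun x y => inner_add_right _ _ _)
    (fun c x => by rw [inner_smul_right]; rfl)) _

/-- Two points of a facet differ by a multiple of its direction. -/
lemma exists_eq_add_smul_of_mem_face {ν x y : Plane} (hν : ‖ν‖ = 1) (hx : x ∈ face φ ν)
    (hy : y ∈ face φ ν) : ∃ u : ℝ, y = x + u • rot ν := by
  refine ⟨inner ℝ (y - x) (rot ν), ?_⟩
  have := eq_inner_smul_of_inner_rot_eq_zero (τ := rot ν) (x := y - x) (by rw [norm_rot, hν]) ?_
  · rw [← this]; abel
  · have e : rot (rot ν) = -ν := by apply plane_ext <;> simp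
    rw [e, inner_neg_right, inner_sub_left, real_inner_comm, real_inner_comm ν x, hx.2, hy.2,
      sub_self, neg_zero]

lemma IsAnisotropy.facetLength_pos (hφ : IsAnisotropy φ) {ν : Plane} (h : IsFacetNormal φ ν) :
    0 < facetLength φ ν := by
  obtain ⟨hν, x, hx, y, hy, hxy⟩ := h
  obtain ⟨R, hR⟩ := hφ.norm_le
  refine ENNReal.toReal_pos ?_ ?_
  · have h1 : segment ℝ x y ⊆ face φ ν := (hφ.convex_face ν).segment_subset hx hy
    have h2 := MeasureTheory.measure_mono (μ := MeasureTheory.Measure.hausdorffMeasure 1) h1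
    rw [MeasureTheory.hausdorffMeasure_segment] at h2
    exact ((edist_pos.2 hxy).trans_le h2).ne'
  · have hsub : face φ ν ⊆ segment ℝ (x - (2 * R) • rot ν) (x + (2 * R) • rot ν) := by
      intro z hz
      obtain ⟨u, rfl⟩ := exists_eq_add_smul_of_mem_face hν hx hz
      have h1 : |u| ≤ 2 * R := by
        have e : ‖u • rot ν‖ = |u| := by rw [norm_smul, norm_rot, hν]; simp
        have h2 := norm_sub_le (x + u • rot ν) x
        rw [add_sub_cancel_left, e] at h2
        linarith [hR _ hz.1, hR _ hx.1]
      have h0 : 0 ≤ 2 * R := (abs_nonneg u).trans h1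
      rcases h0.eq_or_lt with h0 | h0
      · have hu : u = 0 := abs_eq_zero.1 (le_antisymm (h1.trans h0.ge) (abs_nonneg u))
        rw [← h0, hu]; simp
      · rw [segment_eq_image']
        refine ⟨(u + 2 * R) / (2 * (2 * R)), ⟨?_, ?_⟩, ?_⟩
        · have := (abs_le.1 h1).1
          apply div_nonneg <;> linarith
        · rw [div_le_one (by linarith)]
          linarith [(abs_le.1 h1).2]
        · have : (x + (2 * R) • rot ν) - (x - (2 * R) • rot ν) = (2 * (2 * R)) • rot ν := by
            module
          simp only [this]
          rw [smul_smul, div_mul_cancel₀ _ (by linarith)]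
          module
    refine ((MeasureTheory.measure_mono hsub).trans_lt ?_).ne
    rw [MeasureTheory.hausdorffMeasure_segment]
    exact edist_lt_top _ _

lemma AdjacentFacets.det_ne_zero (hφ : IsAnisotropy φ) {ν ν' : Plane} (h : AdjacentFacets φ ν ν') :
    det ν ν' ≠ 0 := by
  obtain ⟨h1, h2, h3, p, hp, hp'⟩ := h
  intro h0
  rcases eq_or_eq_neg_of_det_eq_zero h1.1 h2.1 h0 with h | h
  · exact h3 h
  · have a := hφ.dual_pos h1.1
    have b := hφ.dual_pos h2.1
    rw [← hp.2, h, inner_neg_left, hp'.2] at a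
    linarith

lemma AdjacentFacets.symm {ν ν' : Plane} (h : AdjacentFacets φ ν ν') : AdjacentFacets φ ν' ν :=
  ⟨h.2.1, h.1, h.2.2.1.symm, by rw [inter_comm]; exact h.2.2.2⟩

/-- A facet has only one neighbour on either side: both neighbours would contain the same extreme
point of the facet, and of two facets that leave this point to the same side, the outer one would
cut off the other. -/
lemma AdjacentFacets.eq_of_det_mul_pos (hφ : IsAnisotropy φ) {ν ν' ν'' : Plane}
    (h' : AdjacentFacets φ ν ν') (h'' : AdjacentFacets φ ν ν'')
    (hd : 0 < det ν ν' * det ν ν'') : ν' = ν'' := by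
  obtain ⟨h1, h2, -, p, hp, hp'⟩ := h'
  obtain ⟨-, h3, -, q, hq, hq'⟩ := h''
  -- A point of the Wulff shape lies on the inner side of the supporting line through a facet.
  have supp : ∀ {μ x : Plane} {a b : Plane} (u : ℝ), a ∈ face φ μ → b ∈ wulff φ →
      b = a + u • rot x → u * det x μ ≤ 0 := by
    intro μ x a b u ha hb e
    have := hφ.inner_le_dual μ hb
    rw [e, ← ha.2, inner_add_right, inner_smul_right, inner_rot_right] at this
    linarith
  -- Both neighbours meet the facet in the same extreme point, as they lie on the same side.
  have hpq : q = p := by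
    obtain ⟨u, hu⟩ := exists_eq_add_smul_of_mem_face h1.1 hp hq
    have a := supp u hp' hq.1 hu
    have b := supp (-u) hq' hp.1 (by rw [hu]; module : p = q + (-u) • rot ν)
    have : u = 0 := by
      by_contra h0
      rcases lt_or_gt_of_ne h0 with h0 | h0
      · have c : 0 ≤ det ν ν' := by nlinarith
        have d : det ν ν'' ≤ 0 := by nlinarith
        nlinarith
      · have c : det ν ν' ≤ 0 := by nlinarith
        have d : 0 ≤ det ν ν'' := by nlinarith
        nlinarith
    rw [hu, this]; simp
  subst hpq
  have other : ∀ {μ : Plane}, IsFacetNormal φ μ → q ∈ face φ μ →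
      ∃ u : ℝ, u ≠ 0 ∧ q + u • rot μ ∈ face φ μ := by
    intro μ hμ hqμ
    obtain ⟨y, hy, hyq⟩ := hμ.2.exists_ne q
    obtain ⟨u, hu⟩ := exists_eq_add_smul_of_mem_face hμ.1 hqμ hy
    refine ⟨u, ?_, hu ▸ hy⟩
    rintro rfl
    simp at hu; exact hyq hu
  -- The second points of the two neighbours would each be cut off by the other, unless the facets
  -- have the same direction.
  obtain ⟨u, hu0, hu⟩ := other h2 hp'
  obtain ⟨v, hv0, hv⟩ := other h3 hq'
  have swap : ∀ a b : Plane, det a b = -det b a := fun a b => by simp only [det]; ring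
  have a1 := supp u hp hu.1 rfl
  have a2 := supp v hp hv.1 rfl
  have a3 := supp u hq' hu.1 rfl
  have a4 := supp v hp' hv.1 rfl
  rw [swap] at a1 a2
  rw [swap ν'' ν'] at a4
  have h0 : det ν' ν'' = 0 := by
    by_contra h0
    have huv : 0 < u * v := by
      have : 0 ≤ (u * v) * (det ν ν' * det ν ν'') := by nlinarith
      rcases lt_or_gt_of_ne (mul_ne_zero hu0 hv0) with h | h
      · nlinarith
      · exact h
    have h5 : 0 ≤ (u * det ν' ν'') * (v * -det ν' ν'') := by nlinarith
    have : 0 < det ν' ν'' ^ 2 := by positivity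
    nlinarith
  rcases eq_or_eq_neg_of_det_eq_zero h2.1 h3.1 h0 with h | h
  · exact h
  · have : det ν ν' = -det ν ν'' := by rw [h]; simp [det]; ring
    rw [this] at hd
    nlinarith [sq_nonneg (det ν ν'')]

/-! ### Angles -/

namespace Piece

lemma norm_tangent {S : Piece} (h : S.Nondegenerate) : ‖S.tangent‖ = 1 := by
  cases S with
  | segment p q =>
    have : ‖q - p‖ ≠ 0 := norm_ne_zero_iff.2 (sub_ne_zero.2 (Ne.symm h))
    simp [tangent, norm_smul, this]
  | incoming q τ => exact h
  | outgoing p τ => exact h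

lemma norm_normal {S : Piece} (h : S.Nondegenerate) : ‖S.normal‖ = 1 := by
  rw [normal, norm_rot, norm_tangent h]

variable {S T : Piece}

lemma inner_normal_tangent (S T : Piece) : inner ℝ S.normal T.tangent = det S.tangent T.tangent := by
  rw [real_inner_comm, normal, inner_rot_right]

lemma det_normal (S T : Piece) : det S.normal T.normal = det S.tangent T.tangent := det_rot_rot _ _

lemma cos_unoriented_angle (hS : S.Nondegenerate) (hT : T.Nondegenerate) :
    Real.cos (InnerProductGeometry.angle (-S.tangent) T.tangent)
      = -inner ℝ S.tangent T.tangent := by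
  rw [InnerProductGeometry.cos_angle, norm_neg, norm_tangent hS, norm_tangent hT, inner_neg_left]
  simp

lemma sin_unoriented_angle (hS : S.Nondegenerate) (hT : T.Nondegenerate) :
    Real.sin (InnerProductGeometry.angle (-S.tangent) T.tangent) = |det S.tangent T.tangent| := by
  rw [Real.sin_eq_sqrt_one_sub_cos_sq (InnerProductGeometry.angle_nonneg _ _)
    (InnerProductGeometry.angle_le_pi _ _), cos_unoriented_angle hS hT, ← Real.sqrt_sq_eq_abs]
  congr 1
  have h1 := sq_coord_add _ (norm_tangent hS)
  have h2 := sq_coord_add _ (norm_tangent hT)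
  rw [inner_eq, det]
  linear_combination (-1 : ℝ) * h1 - (S.tangent 0 ^ 2 + S.tangent 1 ^ 2) * h2

lemma cos_angle (hS : S.Nondegenerate) (hT : T.Nondegenerate) :
    Real.cos (S.angle T) = -inner ℝ S.tangent T.tangent := by
  rw [angle]
  split_ifs
  · exact cos_unoriented_angle hS hT
  · rw [Real.cos_two_pi_sub, cos_unoriented_angle hS hT]

lemma sin_angle (hS : S.Nondegenerate) (hT : T.Nondegenerate) :
    Real.sin (S.angle T) = det S.tangent T.tangent := by
  rw [angle, inner_normal_tangent]
  split_ifs with h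
  · rw [sin_unoriented_angle hS hT, abs_of_pos h]
  · rw [Real.sin_two_pi_sub, sin_unoriented_angle hS hT, abs_of_nonpos (not_lt.1 h), neg_neg]

lemma angle_lt_pi (hS : S.Nondegenerate) (hT : T.Nondegenerate) (h : 0 < det S.tangent T.tangent) :
    S.angle T < Real.pi := by
  rw [angle, inner_normal_tangent, if_pos h]
  refine lt_of_le_of_ne (InnerProductGeometry.angle_le_pi _ _) fun h' => ?_
  have := sin_unoriented_angle hS hT
  rw [h', Real.sin_pi, abs_of_pos h] at this
  exact h.ne this

lemma pi_lt_angle (hS : S.Nondegenerate) (hT : T.Nondegenerate) (h : det S.tangent T.tangent < 0) :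
    Real.pi < S.angle T := by
  rw [angle, inner_normal_tangent, if_neg h.not_gt]
  have : InnerProductGeometry.angle (-S.tangent) T.tangent < Real.pi := by
    refine lt_of_le_of_ne (InnerProductGeometry.angle_le_pi _ _) fun h' => ?_
    have := sin_unoriented_angle hS hT
    rw [h', Real.sin_pi, abs_of_neg h] at this
    linarith
  linarith

end Piece

end Crystalline

namespace Crystalline

/-! ### Half-lines -/

/-- The half-line from `p` in direction `τ`. -/
def ray (p τ : Plane) : Set Plane := {x | ∃ s : ℝ, 0 ≤ s ∧ x = p + s • τ}

lemma isBounded_symmDiff_ray {p τ : Plane} (hτ : ‖τ‖ = 1) (u : ℝ) :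
    Bornology.IsBounded (symmDiff (ray p τ) (ray (p + u • τ) τ)) := by
  refine (Metric.isBounded_closedBall (x := p) (r := |u|)).subset ?_
  rintro x (⟨⟨s, hs, rfl⟩, h⟩ | ⟨⟨s, hs, rfl⟩, h⟩)
  · have hsu : s < u := by
      by_contra! hsu
      exact h ⟨s - u, by linarith, by module⟩
    rw [mem_closedBall_iff_norm, add_sub_cancel_left, norm_smul, hτ, mul_one, Real.norm_eq_abs,
      abs_of_nonneg hs]
    exact hsu.le.trans (le_abs_self u)
  · have hsu : s + u < 0 := by
      by_contra! hsu
      exact h ⟨s + u, hsu, by module⟩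
    have e : p + u • τ + s • τ - p = (s + u) • τ := by module
    rw [mem_closedBall_iff_norm, e, norm_smul, hτ, mul_one, Real.norm_eq_abs, abs_of_neg hsu]
    have := neg_abs_le u
    linarith

lemma not_isBounded_ray {p τ : Plane} (hτ : ‖τ‖ = 1) : ¬ Bornology.IsBounded (ray p τ) := by
  intro h
  obtain ⟨R, hR⟩ := h.subset_closedBall p
  have := hR (⟨|R| + 1, by positivity, rfl⟩ : p + (|R| + 1) • τ ∈ ray p τ)
  rw [mem_closedBall_iff_norm, add_sub_cancel_left, norm_smul, hτ, mul_one, Real.norm_eq_abs,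
    abs_of_nonneg (by positivity)] at this
  linarith [le_abs_self R]

/-- Half-lines in the same direction that have bounded symmetric difference lie on the same
line. -/
lemma inner_rot_eq_of_isBounded_symmDiff_ray {p q τ : Plane} (hτ : ‖τ‖ = 1)
    (h : Bornology.IsBounded (symmDiff (ray p τ) (ray q τ))) :
    inner ℝ p (rot τ) = inner ℝ q (rot τ) := by
  by_contra hne
  refine not_isBounded_ray (p := p) hτ (h.subset fun x hx => Or.inl ⟨hx, ?_⟩)
  obtain ⟨s, -, rfl⟩ := hx
  rintro ⟨s', -, hs'⟩
  apply hne
  have := congrArg (fun x => inner ℝ x (rot τ)) hs'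
  simpa [inner_add_left, inner_smul_left, inner_rot_self] using this

/-- The intersection of the lines with tangents `τ`, `τ'` and offsets `a`, `a'`. -/
def lineInter (τ τ' : Plane) (a a' : ℝ) : Plane := (det τ τ')⁻¹ • (a • τ' - a' • τ)

lemma det_swap (τ τ' : Plane) : det τ' τ = -det τ τ' := by simp only [det]; ring

lemma inner_lineInter_left {τ τ' : Plane} (h : det τ τ' ≠ 0) (a a' : ℝ) :
    inner ℝ (lineInter τ τ' a a') (rot τ) = a := by
  rw [inner_rot_right, lineInter]
  simp only [det] at h ⊢
  simp only [PiLp.smul_apply, PiLp.sub_apply, smul_eq_mul]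
  field_simp
  ring

lemma inner_lineInter_right {τ τ' : Plane} (h : det τ τ' ≠ 0) (a a' : ℝ) :
    inner ℝ (lineInter τ τ' a a') (rot τ') = a' := by
  rw [inner_rot_right, lineInter, ← mul_right_inj' h]
  simp only [det] at h ⊢
  simp only [PiLp.smul_apply, PiLp.sub_apply, smul_eq_mul]
  field_simp
  ring

lemma eq_lineInter {τ τ' : Plane} (h : det τ τ' ≠ 0) (x : Plane) :
    x = lineInter τ τ' (inner ℝ x (rot τ)) (inner ℝ x (rot τ')) := by
  rw [← sub_eq_zero]
  refine eq_zero_of_inner_eq_zero (u := rot τ) (v := rot τ') (by rwa [det_rot_rot]) ?_ ?_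
  · rw [inner_sub_left, inner_lineInter_left h, sub_self]
  · rw [inner_sub_left, inner_lineInter_right h, sub_self]

namespace Piece

variable {S : Piece}

lemma inner_start {p : Plane} (h : S.start = some p) :
    inner ℝ p S.normal = inner ℝ S.point S.normal := by
  cases S <;> simp_all [start, point]

lemma inner_finish {q : Plane} (h : S.finish = some q) :
    inner ℝ q S.normal = inner ℝ S.point S.normal := by
  cases S with
  | segment p q' =>
    simp only [finish, Option.some.injEq] at h
    subst h
    rw [← sub_eq_zero, ← inner_sub_left]
    simp only [point, normal, tangent, rot_smul, inner_smul_right, inner_rot_self, mul_zero]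
  | incoming q τ => simp_all [finish, point]
  | outgoing p τ => simp_all [finish]

end Piece

/-! ### Parallel curves and their heights -/

namespace PolygonalCurve

variable {n : ℕ} [NeZero n] {φ : Plane → ℝ} {Γ₀ Γ : PolygonalCurve n} {H : Fin n → ℝ}

/-- The signed distances from the origin of the lines that carry the pieces. -/
def offset (Γ : PolygonalCurve n) (i : Fin n) : ℝ := inner ℝ (Γ.piece i).point (Γ.piece i).normal

/-- Consecutive pieces are not parallel. -/
def Transversal (Γ : PolygonalCurve n) : Prop :=
  ∀ i, (Γ.piece i).finish ≠ none → det (Γ.piece i).tangent (Γ.piece (i + 1)).tangent ≠ 0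

lemma Admissible.transversal (hφ : IsAnisotropy φ) (h : Γ.Admissible φ) : Γ.Transversal :=
  fun i hi => by
    rw [← Piece.det_normal]
    exact (h i hi).det_ne_zero hφ

/-- The initial vertex of the piece `i` of the curve that is parallel to `Γ₀` and has offsets
`H`. -/
def vertex (Γ₀ : PolygonalCurve n) (H : Fin n → ℝ) (i : Fin n) : Plane :=
  lineInter (Γ₀.piece (i - 1)).tangent (Γ₀.piece i).tangent (H (i - 1)) (H i)

open Classical in
/-- The (signed) length of the segment `i` of the curve that is parallel to `Γ₀` and has offsets
`H`; the value at half-lines plays no role, except that it is positive. -/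
def lengthOf (Γ₀ : PolygonalCurve n) (H : Fin n → ℝ) (i : Fin n) : ℝ :=
  if (Γ₀.piece i).IsHalfLine then 1
  else -(H (i - 1) / Real.sin (Γ₀.θ i) + H i * (Real.cot (Γ₀.θ i) + Real.cot (Γ₀.θ (i + 1)))
    + H (i + 1) / Real.sin (Γ₀.θ (i + 1)))

/-- The offsets for which all segments have positive length. -/
def region (Γ₀ : PolygonalCurve n) : Set (Fin n → ℝ) := {H | ∀ i, 0 < Γ₀.lengthOf H i}

/-- The piece `i` of the curve that is parallel to `Γ₀` and has offsets `H`. -/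
def movedPiece (Γ₀ : PolygonalCurve n) (H : Fin n → ℝ) (i : Fin n) : Piece :=
  match Γ₀.piece i with
  | .segment _ _ => .segment (Γ₀.vertex H i) (Γ₀.vertex H (i + 1))
  | .incoming _ τ => .incoming (Γ₀.vertex H (i + 1)) τ
  | .outgoing _ τ => .outgoing (Γ₀.vertex H i) τ

open Classical in
/-- The curve that is parallel to `Γ₀` and has offsets `H`; the junk value `Γ₀` is taken outside
`Γ₀.region`. -/
def curveOf (Γ₀ : PolygonalCurve n) (H : Fin n → ℝ) : PolygonalCurve n :=
  if h : ∀ i, (Γ₀.movedPiece H i).Nondegenerate then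
    { piece := Γ₀.movedPiece H
      nondegenerate := h
      consecutive := fun i => by
        have := Γ₀.consecutive i
        simp only [movedPiece]
        cases h1 : Γ₀.piece i <;> cases h2 : Γ₀.piece (i + 1) <;>
          simp_all [Piece.start, Piece.finish]
      unbounded_only_at_ends := fun i hi => by
        refine Γ₀.unbounded_only_at_ends i ?_
        simp only [movedPiece] at hi
        cases h1 : Γ₀.piece i <;> simp_all [Piece.start] }
  else Γ₀

lemma norm_tangent (Γ : PolygonalCurve n) (i : Fin n) : ‖(Γ.piece i).tangent‖ = 1 :=
  Piece.norm_tangent (Γ.nondegenerate i)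

lemma sin_θ (Γ : PolygonalCurve n) (i : Fin n) :
    Real.sin (Γ.θ i) = det (Γ.piece (i - 1)).tangent (Γ.piece i).tangent :=
  Piece.sin_angle (Γ.nondegenerate _) (Γ.nondegenerate _)

lemma cos_θ (Γ : PolygonalCurve n) (i : Fin n) :
    Real.cos (Γ.θ i) = -inner ℝ (Γ.piece (i - 1)).tangent (Γ.piece i).tangent :=
  Piece.cos_angle (Γ.nondegenerate _) (Γ.nondegenerate _)

lemma finish_eq (Γ : PolygonalCurve n) (i : Fin n) :
    (Γ.piece (i - 1)).finish = (Γ.piece i).start := by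
  have := Γ.consecutive (i - 1)
  rwa [sub_add_cancel] at this

lemma Transversal.det_ne_zero (h : Γ.Transversal) {i : Fin n} (hi : (Γ.piece i).start ≠ none) :
    det (Γ.piece (i - 1)).tangent (Γ.piece i).tangent ≠ 0 := by
  have := h (i - 1)
  rw [sub_add_cancel, finish_eq] at this
  exact this hi

lemma start_ne_none (hi : ¬ (Γ.piece i).IsHalfLine) : (Γ.piece i).start ≠ none := by
  cases h : Γ.piece i <;> simp_all [Piece.start, Piece.IsHalfLine]

lemma finish_ne_none (hi : ¬ (Γ.piece i).IsHalfLine) : (Γ.piece i).finish ≠ none := by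
  cases h : Γ.piece i <;> simp_all [Piece.finish, Piece.IsHalfLine]

lemma inner_vertex (h : Γ₀.Transversal) (H : Fin n → ℝ) {i : Fin n}
    (hi : (Γ₀.piece i).start ≠ none) :
    inner ℝ (Γ₀.vertex H i) (Γ₀.piece i).normal = H i :=
  inner_lineInter_right (h.det_ne_zero hi) _ _

lemma inner_vertex_succ (h : Γ₀.Transversal) (H : Fin n → ℝ) {i : Fin n}
    (hi : (Γ₀.piece i).finish ≠ none) :
    inner ℝ (Γ₀.vertex H (i + 1)) (Γ₀.piece i).normal = H i := by
  rw [vertex, add_sub_cancel_right]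
  exact inner_lineInter_left (h i hi) _ _

/-- The edges of the moved curve keep the tangents of `Γ₀`, and `lengthOf` is their signed
length. -/
theorem vertex_succ_sub_vertex (h : Γ₀.Transversal) (H : Fin n → ℝ) {i : Fin n}
    (hi : ¬ (Γ₀.piece i).IsHalfLine) :
    Γ₀.vertex H (i + 1) - Γ₀.vertex H i = Γ₀.lengthOf H i • (Γ₀.piece i).tangent := by
  have e := eq_inner_smul_of_inner_rot_eq_zero (x := Γ₀.vertex H (i + 1) - Γ₀.vertex H i)
    (Γ₀.norm_tangent i) ?_
  · rw [e]
    congr 1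
    have h1 : inner ℝ (Γ₀.piece i).tangent (Γ₀.piece i).tangent = (1 : ℝ) := by
      rw [real_inner_self_eq_norm_sq, norm_tangent, one_pow]
    have s := Γ₀.sin_θ (i + 1)
    have c := Γ₀.cos_θ (i + 1)
    rw [add_sub_cancel_right] at s c
    rw [lengthOf, if_neg hi, inner_sub_left, vertex, vertex, add_sub_cancel_right, lineInter,
      lineInter, Real.cot_eq_cos_div_sin, Real.cot_eq_cos_div_sin, ← s, ← sin_θ, c, cos_θ]
    simp only [inner_smul_left, inner_sub_left, h1, conj_trivial, div_eq_mul_inv]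
    rw [real_inner_comm (Γ₀.piece i).tangent (Γ₀.piece (i + 1)).tangent]
    ring
  · have a := inner_vertex h H (start_ne_none hi)
    have b := inner_vertex_succ h H (finish_ne_none hi)
    rw [Piece.normal] at a b
    rw [inner_sub_left, a, b, sub_self]

lemma nondegenerate_movedPiece (h : Γ₀.Transversal) (hH : H ∈ Γ₀.region) (i : Fin n) :
    (Γ₀.movedPiece H i).Nondegenerate := by
  have hn := Γ₀.nondegenerate i
  rw [movedPiece]
  cases hp : Γ₀.piece i with
  | segment p q =>
    have hi : ¬ (Γ₀.piece i).IsHalfLine := by rw [hp]; exact id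
    intro he
    have := vertex_succ_sub_vertex h H hi
    rw [he, sub_self, eq_comm, smul_eq_zero] at this
    rcases this with h0 | h0
    · exact (hH i).ne' h0
    · have := Γ₀.norm_tangent i
      rw [h0, norm_zero] at this
      exact zero_ne_one this
  | incoming q τ => rw [hp] at hn; exact hn
  | outgoing p τ => rw [hp] at hn; exact hn

lemma piece_curveOf (h : Γ₀.Transversal) (hH : H ∈ Γ₀.region) (i : Fin n) :
    (Γ₀.curveOf H).piece i = Γ₀.movedPiece H i := by
  rw [curveOf, dif_pos (nondegenerate_movedPiece h hH)]

lemma isHalfLine_movedPiece (Γ₀ : PolygonalCurve n) (H : Fin n → ℝ) (i : Fin n) :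
    (Γ₀.movedPiece H i).IsHalfLine ↔ (Γ₀.piece i).IsHalfLine := by
  rw [movedPiece]
  cases hp : Γ₀.piece i <;> rfl

lemma tangent_movedPiece (h : Γ₀.Transversal) (hH : H ∈ Γ₀.region) (i : Fin n) :
    (Γ₀.movedPiece H i).tangent = (Γ₀.piece i).tangent := by
  have hv := vertex_succ_sub_vertex (i := i) h H
  have hτ := Γ₀.norm_tangent i
  rw [movedPiece]
  cases hp : Γ₀.piece i with
  | segment p q =>
    rw [hp] at hv hτ
    simp only [Piece.tangent] at hv hτ ⊢
    rw [hv id, norm_smul, hτ, mul_one, Real.norm_eq_abs, abs_of_pos (hH i), smul_smul,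
      inv_mul_cancel₀ (hH i).ne', one_smul]
  | incoming q τ => rfl
  | outgoing p τ => rfl

lemma normal_movedPiece (h : Γ₀.Transversal) (hH : H ∈ Γ₀.region) (i : Fin n) :
    (Γ₀.movedPiece H i).normal = (Γ₀.piece i).normal := by
  rw [Piece.normal, tangent_movedPiece h hH, Piece.normal]

theorem offset_curveOf (h : Γ₀.Transversal) (hH : H ∈ Γ₀.region) : (Γ₀.curveOf H).offset = H := by
  funext i
  rw [offset, piece_curveOf h hH, normal_movedPiece h hH, movedPiece]
  have a := inner_vertex (i := i) h H
  have b := inner_vertex_succ (i := i) h H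
  cases hp : Γ₀.piece i <;> simp_all [Piece.start, Piece.finish, Piece.point]

theorem parallel_curveOf (h : Γ₀.Transversal) (hH : H ∈ Γ₀.region)
    (hl : ∀ i, (Γ₀.piece i).IsHalfLine → H i = Γ₀.offset i) : Γ₀.Parallel (Γ₀.curveOf H) := by
  intro i
  have ho := congrFun (offset_curveOf h hH) i
  rw [offset] at ho
  rw [piece_curveOf h hH] at ho ⊢
  refine ⟨normal_movedPiece h hH i, (isHalfLine_movedPiece _ _ _).symm, fun hi => ?_⟩
  rw [hl i hi, offset, normal_movedPiece h hH, ← sub_eq_zero, ← inner_sub_left, Piece.normal] at ho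
  have hτ := Γ₀.norm_tangent i
  have e := eq_inner_smul_of_inner_rot_eq_zero hτ ho
  set u := inner ℝ ((Γ₀.movedPiece H i).point - (Γ₀.piece i).point) (Γ₀.piece i).tangent
  rw [sub_eq_iff_eq_add, add_comm] at e
  clear_value u
  rw [movedPiece] at e ⊢
  cases hp : Γ₀.piece i with
  | segment p q => rw [hp] at hi; exact hi.elim
  | incoming q τ =>
    rw [hp] at e hτ
    simp only [Piece.point, Piece.tangent] at e hτ
    have := isBounded_symmDiff_ray (p := q) (τ := -τ) (by rwa [norm_neg]) (-u)
    simp only [Piece.carrier, e]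
    convert this using 2
    · ext x; simp [ray, sub_eq_add_neg]
    · ext x; simp [ray, sub_eq_add_neg]
  | outgoing p τ =>
    rw [hp] at e hτ
    simp only [Piece.point, Piece.tangent] at e hτ
    simp only [Piece.carrier, e]
    exact isBounded_symmDiff_ray (p := p) hτ u

lemma Parallel.tangent (h : Γ₀.Parallel Γ) (i : Fin n) :
    (Γ.piece i).tangent = (Γ₀.piece i).tangent := rot_injective (h i).1

lemma Parallel.isHalfLine_iff (h : Γ₀.Parallel Γ) (i : Fin n) :
    (Γ.piece i).IsHalfLine ↔ (Γ₀.piece i).IsHalfLine := (h i).2.1.symm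

lemma Parallel.refl (Γ : PolygonalCurve n) : Γ.Parallel Γ :=
  fun _ => ⟨rfl, Iff.rfl, fun _ => by simp⟩

lemma Parallel.symm (h : Γ₀.Parallel Γ) : Γ.Parallel Γ₀ := fun i =>
  ⟨(h i).1.symm, (h i).2.1.symm, fun hi => by
    rw [symmDiff_comm]; exact (h i).2.2 ((h i).2.1.2 hi)⟩

lemma Parallel.trans {Γ' : PolygonalCurve n} (h : Γ₀.Parallel Γ) (h' : Γ.Parallel Γ') :
    Γ₀.Parallel Γ' := fun i =>
  ⟨(h' i).1.trans (h i).1, (h i).2.1.trans (h' i).2.1, fun hi =>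
    (((h i).2.2 hi).union ((h' i).2.2 ((h i).2.1.1 hi))).subset (symmDiff_triangle _ _ _)⟩

lemma Parallel.θ_eq (h : Γ₀.Parallel Γ) (i : Fin n) : Γ.θ i = Γ₀.θ i := by
  simp only [θ, Piece.angle, (h _).1, h.tangent]

lemma Parallel.transition_eq (h : Γ₀.Parallel Γ) (i : Fin n) :
    Γ.transition i = Γ₀.transition i := by
  have hi := h.isHalfLine_iff i
  by_cases h' : (Γ₀.piece i).IsHalfLine
  · simp only [transition, if_pos h', if_pos (hi.2 h')]
  · simp only [transition, if_neg h', if_neg (mt hi.1 h'), h.θ_eq]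

lemma Parallel.δ_eq (h : Γ₀.Parallel Γ) (i : Fin n) : Γ.δ φ i = Γ₀.δ φ i := by
  simp only [δ, (h _).1]

/-- An incoming half-line has index `0`, an outgoing one has index `n - 1`, and `n ≠ 1`. -/
lemma not_incoming_outgoing {Γ Δ : PolygonalCurve n} {i : Fin n} {q τ p τ' : Plane}
    (h1 : Γ.piece i = .incoming q τ) (h2 : Δ.piece i = .outgoing p τ') : False := by
  have a := Γ.unbounded_only_at_ends i (by rw [h1]; rfl)
  have b := Δ.consecutive i
  rw [h2] at b
  have c := Δ.unbounded_only_at_ends (i + 1) b.symm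
  rw [c, ← a, h2] at b
  simp [Piece.start, Piece.finish] at b

lemma Parallel.start_eq_none_iff (h : Γ₀.Parallel Γ) (i : Fin n) :
    (Γ.piece i).start = none ↔ (Γ₀.piece i).start = none := by
  have hi := h.isHalfLine_iff i
  cases h1 : Γ.piece i <;> cases h2 : Γ₀.piece i <;>
    simp_all [Piece.start, Piece.IsHalfLine]
  · exact not_incoming_outgoing h1 h2
  · exact not_incoming_outgoing h2 h1

lemma Parallel.finish_eq_none_iff (h : Γ₀.Parallel Γ) (i : Fin n) :
    (Γ.piece i).finish = none ↔ (Γ₀.piece i).finish = none := by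
  rw [Γ.consecutive, Γ₀.consecutive, h.start_eq_none_iff]

lemma Parallel.admissible (h : Γ₀.Parallel Γ) (h₀ : Γ₀.Admissible φ) : Γ.Admissible φ :=
  fun i hi => by
    rw [(h i).1, (h (i + 1)).1]
    exact h₀ i fun h' => hi ((h.finish_eq_none_iff i).2 h')

lemma Parallel.start_eq_vertex (ht : Γ₀.Transversal) (h : Γ₀.Parallel Γ) {i : Fin n} {p : Plane}
    (hp : (Γ.piece i).start = some p) : p = Γ₀.vertex Γ.offset i := by
  have h1 := Piece.inner_start hp
  have h2 := Piece.inner_finish ((Γ.finish_eq i).trans hp)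
  have h3 : (Γ₀.piece i).start ≠ none := fun h' => by
    rw [← h.start_eq_none_iff, hp] at h'; simp at h'
  rw [vertex, offset, offset, ← h1, ← h2, (h _).1, (h _).1]
  exact eq_lineInter (ht.det_ne_zero h3) p

lemma Parallel.finish_eq_vertex (ht : Γ₀.Transversal) (h : Γ₀.Parallel Γ) {i : Fin n} {p : Plane}
    (hp : (Γ.piece i).finish = some p) : p = Γ₀.vertex Γ.offset (i + 1) :=
  h.start_eq_vertex ht ((Γ.consecutive i).symm.trans hp)

lemma Parallel.movedPiece_eq (ht : Γ₀.Transversal) (h : Γ₀.Parallel Γ) (i : Fin n) :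
    Γ₀.movedPiece Γ.offset i = Γ.piece i := by
  have hi := h.isHalfLine_iff i
  have hs := h.start_eq_none_iff i
  have hτ := h.tangent i
  have a := fun p => h.start_eq_vertex (i := i) (p := p) ht
  have b := fun p => h.finish_eq_vertex (i := i) (p := p) ht
  rw [movedPiece]
  cases h1 : Γ.piece i <;> cases h2 : Γ₀.piece i <;>
    simp_all [Piece.start, Piece.finish, Piece.IsHalfLine, Piece.tangent]

theorem Parallel.length_eq (ht : Γ₀.Transversal) (h : Γ₀.Parallel Γ) {i : Fin n}
    (hi : ¬ (Γ₀.piece i).IsHalfLine) : (Γ.piece i).length = Γ₀.lengthOf Γ.offset i := by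
  have hv := vertex_succ_sub_vertex ht Γ.offset hi
  have hm := h.movedPiece_eq ht i
  have hτ := h.tangent i
  have hn := Γ.nondegenerate i
  rw [← hτ] at hv
  rw [movedPiece] at hm
  cases hp : Γ₀.piece i with
  | segment p q =>
    rw [hp] at hm
    simp only at hm
    rw [← hm] at hv hn ⊢
    simp only [Piece.length, Piece.tangent] at hv ⊢
    rw [smul_smul] at hv
    have hne : Γ₀.vertex Γ.offset (i + 1) - Γ₀.vertex Γ.offset i ≠ 0 := sub_ne_zero.2 (Ne.symm hn)
    have h1 : Γ₀.lengthOf Γ.offset i * ‖Γ₀.vertex Γ.offset (i + 1) - Γ₀.vertex Γ.offset i‖⁻¹ = 1 := by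
      have : (1 - Γ₀.lengthOf Γ.offset i * ‖Γ₀.vertex Γ.offset (i + 1) - Γ₀.vertex Γ.offset i‖⁻¹) •
        (Γ₀.vertex Γ.offset (i + 1) - Γ₀.vertex Γ.offset i) = 0 := by
        rw [sub_smul, one_smul, ← hv, sub_self]
      have := (smul_eq_zero.1 this).resolve_right hne
      linarith
    rw [dist_comm, dist_eq_norm]
    rw [mul_inv_eq_one₀ (norm_ne_zero_iff.2 hne)] at h1
    exact h1.symm
  | incoming q τ => rw [hp] at hi; exact absurd trivial hi
  | outgoing q τ => rw [hp] at hi; exact absurd trivial hi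

lemma length_pos (Γ : PolygonalCurve n) {i : Fin n} (hi : ¬ (Γ.piece i).IsHalfLine) :
    0 < (Γ.piece i).length := by
  have hn := Γ.nondegenerate i
  cases hp : Γ.piece i with
  | segment p q => rw [hp] at hn; exact dist_pos.2 hn
  | incoming q τ => rw [hp] at hi; exact absurd trivial hi
  | outgoing q τ => rw [hp] at hi; exact absurd trivial hi

theorem Parallel.offset_mem_region (ht : Γ₀.Transversal) (h : Γ₀.Parallel Γ) :
    Γ.offset ∈ Γ₀.region := by
  intro i
  by_cases hi : (Γ₀.piece i).IsHalfLine
  · rw [lengthOf, if_pos hi]; exact one_pos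
  · rw [← h.length_eq ht hi]
    exact Γ.length_pos (by rwa [h.isHalfLine_iff])

/-- A curve parallel to `Γ₀` is determined by its offsets. -/
theorem Parallel.eq_curveOf (ht : Γ₀.Transversal) (h : Γ₀.Parallel Γ) :
    Γ = Γ₀.curveOf Γ.offset := by
  ext i
  rw [piece_curveOf ht (h.offset_mem_region ht), h.movedPiece_eq ht]

/-- Half-lines of parallel curves lie on the same line, hence have height zero. -/
theorem Parallel.offset_eq_of_isHalfLine (h : Γ₀.Parallel Γ) {i : Fin n}
    (hi : (Γ₀.piece i).IsHalfLine) : Γ.offset i = Γ₀.offset i := by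
  have hb := (h i).2.2 hi
  have hi' := (h.isHalfLine_iff i).2 hi
  have hτ := h.tangent i
  have hτ' := Γ₀.norm_tangent i
  rw [offset, offset, (h i).1, Piece.normal]
  cases h1 : Γ.piece i <;> cases h2 : Γ₀.piece i <;>
    rw [h1] at hi' hτ <;> rw [h2] at hi hτ hτ' <;>
    first | exact hi.elim | exact hi'.elim | skip
  · simp only [Piece.tangent] at hτ hτ'
    rw [h1, h2, hτ, symmDiff_comm] at hb
    have := inner_rot_eq_of_isBounded_symmDiff_ray (p := _) (q := _) (τ := -_)
      (by rwa [norm_neg]) (by simpa [Piece.carrier, ray, sub_eq_add_neg] using hb)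
    have e : ∀ v : Plane, rot (-v) = -rot v := fun v => by apply plane_ext <;> simp
    rw [e, inner_neg_right, inner_neg_right, neg_inj] at this
    exact this
  · exact (not_incoming_outgoing h1 h2).elim
  · exact (not_incoming_outgoing h2 h1).elim
  · simp only [Piece.tangent] at hτ hτ'
    rw [h1, h2, hτ, symmDiff_comm] at hb
    exact inner_rot_eq_of_isBounded_symmDiff_ray hτ' hb

end PolygonalCurve

end Crystalline

namespace Crystalline

/-! ### The flow as a system of differential equations for the heights -/

namespace PolygonalCurve

variable {n : ℕ} [NeZero n] {φ : Plane → ℝ} {α : ℝ} {Γ₀ Γ : PolygonalCurve n} {H : Fin n → ℝ}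

/-- The right-hand side of the system as a function of the offsets. -/
def force (φ : Plane → ℝ) (α : ℝ) (Γ₀ : PolygonalCurve n) (H : Fin n → ℝ) (i : Fin n) : ℝ :=
  - (Γ₀.transition i * facetLength φ (Γ₀.piece i).normal / Γ₀.lengthOf H i)
  - α / Γ₀.lengthOf H i *
    (Γ₀.transition (i - 1) ^ 2 * Γ₀.δ φ (i - 1)
        / (Γ₀.lengthOf H (i - 1) ^ 2 * Real.sin (Γ₀.θ i))
      + Γ₀.transition i ^ 2 * Γ₀.δ φ i * (Real.cot (Γ₀.θ i) + Real.cot (Γ₀.θ (i + 1)))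
        / Γ₀.lengthOf H i ^ 2
      + Γ₀.transition (i + 1) ^ 2 * Γ₀.δ φ (i + 1)
        / (Γ₀.lengthOf H (i + 1) ^ 2 * Real.sin (Γ₀.θ (i + 1))))

open Classical in
/-- The vector field on `Γ₀.region` whose integral curves are the crystalline elastic flows. -/
def velocity (φ : Plane → ℝ) (α : ℝ) (Γ₀ : PolygonalCurve n) (H : Fin n → ℝ) (i : Fin n) : ℝ :=
  if (Γ₀.piece i).IsHalfLine then 0 else dual φ (Γ₀.piece i).normal * Γ₀.force φ α H i

lemma transition_of_isHalfLine {i : Fin n} (h : (Γ.piece i).IsHalfLine) : Γ.transition i = 0 := by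
  simp [transition, h]

theorem Parallel.elasticForce_eq (ht : Γ₀.Transversal) (h : Γ₀.Parallel Γ) {i : Fin n}
    (hi : ¬ (Γ₀.piece i).IsHalfLine) : Γ.elasticForce φ α i = Γ₀.force φ α Γ.offset i := by
  have key : ∀ (j : Fin n) (a b : ℝ), Γ₀.transition j ^ 2 * a / ((Γ.piece j).length ^ 2 * b)
      = Γ₀.transition j ^ 2 * a / (Γ₀.lengthOf Γ.offset j ^ 2 * b) := by
    intro j a b
    by_cases hj : (Γ₀.piece j).IsHalfLine
    · simp [transition_of_isHalfLine hj]
    · rw [h.length_eq ht hj]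
  simp only [elasticForce, force, h.transition_eq, h.δ_eq, h.θ_eq, (h _).1, key,
    h.length_eq ht hi]

lemma contDiff_lengthOf (Γ₀ : PolygonalCurve n) (i : Fin n) :
    ContDiff ℝ 1 fun H => Γ₀.lengthOf H i := by
  simp only [lengthOf, div_eq_mul_inv]
  split_ifs <;> fun_prop

lemma continuous_lengthOf (Γ₀ : PolygonalCurve n) (i : Fin n) :
    Continuous fun H => Γ₀.lengthOf H i := (Γ₀.contDiff_lengthOf i).continuous

lemma isOpen_region (Γ₀ : PolygonalCurve n) : IsOpen Γ₀.region := by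
  have : Γ₀.region = ⋂ i, {H | 0 < Γ₀.lengthOf H i} := by ext; simp [region]
  rw [this]
  exact isOpen_iInter_of_finite fun i => isOpen_lt continuous_const (Γ₀.continuous_lengthOf i)

lemma contDiffOn_velocity (φ : Plane → ℝ) (α : ℝ) (Γ₀ : PolygonalCurve n) :
    ContDiffOn ℝ 1 (Γ₀.velocity φ α) Γ₀.region := by
  have hl : ∀ j, ContDiffOn ℝ 1 (fun H => (Γ₀.lengthOf H j)⁻¹) Γ₀.region := fun j =>
    (Γ₀.contDiff_lengthOf j).contDiffOn.inv fun H hH => (hH j).ne'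
  rw [contDiffOn_pi]
  intro i
  have h1 := hl (i - 1)
  have h2 := hl i
  have h3 := hl (i + 1)
  simp only [velocity, force, div_eq_mul_inv, mul_inv, ← inv_pow]
  split_ifs
  · exact contDiffOn_const
  · fun_prop

lemma height_eq {Γ : ℝ → PolygonalCurve n} {t : ℝ} (h : Γ₀.Parallel (Γ t)) (i : Fin n) :
    height Γ₀ Γ i t = (Γ t).offset i - Γ₀.offset i := by
  rw [height, Piece.signedHeight, inner_sub_left, offset, offset, (h i).1]

lemma Parallel.lengthOf_eq (h : Γ₀.Parallel Γ) (H : Fin n → ℝ) (i : Fin n) :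
    Γ.lengthOf H i = Γ₀.lengthOf H i := by
  have hi := h.isHalfLine_iff i
  by_cases h' : (Γ₀.piece i).IsHalfLine
  · simp only [lengthOf, if_pos h', if_pos (hi.2 h')]
  · simp only [lengthOf, if_neg h', if_neg (mt hi.1 h'), h.θ_eq]

lemma Parallel.velocity_eq (h : Γ₀.Parallel Γ) : Γ.velocity φ α = Γ₀.velocity φ α := by
  funext H i
  have hi := h.isHalfLine_iff i
  by_cases h' : (Γ₀.piece i).IsHalfLine
  · simp only [velocity, if_pos h', if_pos (hi.2 h')]
  · simp only [velocity, if_neg h', if_neg (mt hi.1 h'), force, h.lengthOf_eq, h.transition_eq, h.δ_eq,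
      h.θ_eq, (h _).1]

lemma Parallel.region_eq (h : Γ₀.Parallel Γ) : Γ.region = Γ₀.region := by
  simp only [region, h.lengthOf_eq]

end PolygonalCurve

open PolygonalCurve

variable {n : ℕ} [NeZero n] {φ : Plane → ℝ} {α : ℝ} {Γ₀ : PolygonalCurve n} {T T' : EReal}

theorem IsFlow.isSolution (hφ : IsAnisotropy φ) (ht : Γ₀.Transversal)
    {Γ : ℝ → PolygonalCurve n} (h : IsFlow φ α Γ₀ T Γ) :
    IsSolution (Γ₀.velocity φ α) Γ₀.region Γ₀.offset T fun t => (Γ t).offset := by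
  refine ⟨by simp only [h.initial], fun t h0 hT => (h.parallel t h0 hT).offset_mem_region ht,
    continuousOn_pi.2 fun i => ?_, fun t h0 hT => hasDerivAt_pi.2 fun i => ?_⟩
  · refine ((h.continuousOn i).add_const (Γ₀.offset i)).congr fun t ht => ?_
    simp only [height_eq (h.parallel t ht.1 ht.2) i, sub_add_cancel]
  · have ho := (isOpen_setOf_pos_lt T).mem_nhds ⟨h0, hT⟩
    by_cases hi : (Γ₀.piece i).IsHalfLine
    · rw [velocity, if_pos hi]
      refine (hasDerivAt_const t (Γ₀.offset i)).congr_of_eventuallyEq ?_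
      filter_upwards [ho] with s hs
      exact (h.parallel s hs.1.le hs.2).offset_eq_of_isHalfLine hi
    · have hp := h.parallel t h0.le hT
      have hd := ((h.contDiffOn i).differentiableOn one_ne_zero |>.differentiableAt ho).hasDerivAt
      have ho' := h.ode i hi t h0 hT
      rw [div_eq_iff (hφ.dual_pos (Piece.norm_normal (Γ₀.nondegenerate i))).ne', mul_comm,
        hp.elasticForce_eq ht hi] at ho'
      rw [velocity, if_neg hi, ← ho']
      refine (hd.add_const (Γ₀.offset i)).congr_of_eventuallyEq ?_
      filter_upwards [ho] with s hs
      rw [height_eq (h.parallel s hs.1.le hs.2) i, sub_add_cancel]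

theorem IsSolution.apply_of_isHalfLine {y : ℝ → Fin n → ℝ}
    (h : IsSolution (Γ₀.velocity φ α) Γ₀.region Γ₀.offset T y) {t : ℝ} (h0 : 0 ≤ t)
    (hT : (t : EReal) < T) {i : Fin n} (hi : (Γ₀.piece i).IsHalfLine) :
    y t i = Γ₀.offset i := by
  have hc := (continuousOn_pi.1 h.continuousOn i).mono (Icc_subset_of_lt hT)
  rw [constant_of_has_deriv_right_zero hc (fun s hs => ?_) t ⟨h0, le_rfl⟩, h.initial]
  have := h.hasDerivWithinAt (contDiffOn_velocity φ α Γ₀).continuousOn Γ₀.isOpen_region hs.1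
    (Icc_subset_of_lt hT (Ico_subset_Icc_self hs)).2
  have := hasDerivWithinAt_pi.1 this i
  rwa [velocity, if_pos hi] at this

theorem IsSolution.parallel (ht : Γ₀.Transversal) {y : ℝ → Fin n → ℝ}
    (h : IsSolution (Γ₀.velocity φ α) Γ₀.region Γ₀.offset T y) {t : ℝ} (h0 : 0 ≤ t)
    (hT : (t : EReal) < T) : Γ₀.Parallel (Γ₀.curveOf (y t)) :=
  parallel_curveOf ht (h.mem t h0 hT) fun _ hi => h.apply_of_isHalfLine h0 hT hi

theorem IsSolution.isFlow (hφ : IsAnisotropy φ) (ht : Γ₀.Transversal) (hT : 0 < T)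
    {y : ℝ → Fin n → ℝ} (h : IsSolution (Γ₀.velocity φ α) Γ₀.region Γ₀.offset T y) :
    IsFlow φ α Γ₀ T fun t => Γ₀.curveOf (y t) := by
  have hh : ∀ i, ∀ t ∈ {t : ℝ | 0 ≤ t ∧ (t : EReal) < T},
      height Γ₀ (fun t => Γ₀.curveOf (y t)) i t = y t i - Γ₀.offset i := fun i t hs => by
    rw [height_eq (h.parallel ht hs.1 hs.2), offset_curveOf ht (h.mem t hs.1 hs.2)]
  have hd : ∀ i, ∀ t ∈ {t : ℝ | 0 < t ∧ (t : EReal) < T},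
      HasDerivAt (height Γ₀ (fun t => Γ₀.curveOf (y t)) i) (Γ₀.velocity φ α (y t) i) t := by
    intro i t hs
    refine ((hasDerivAt_pi.1 (h.hasDerivAt t hs.1 hs.2) i).sub_const
      (Γ₀.offset i)).congr_of_eventuallyEq ?_
    filter_upwards [(isOpen_setOf_pos_lt T).mem_nhds hs] with s hs
    exact hh i s ⟨hs.1.le, hs.2⟩
  have hsub : {t : ℝ | 0 < t ∧ (t : EReal) < T} ⊆ {t : ℝ | 0 ≤ t ∧ (t : EReal) < T} :=
    fun s hs => ⟨hs.1.le, hs.2⟩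
  refine ⟨hT, ?_, fun t h0 hT => h.parallel ht h0 hT, fun i => ?_, fun i => ?_,
    fun i hi t h0 hT => ?_⟩
  · simp only [h.initial]
    exact ((Parallel.refl Γ₀).eq_curveOf ht).symm
  · exact ((continuousOn_pi.1 h.continuousOn i).sub continuousOn_const).congr (hh i)
  · rw [← zero_add (1 : WithTop ℕ∞), contDiffOn_succ_iff_deriv_of_isOpen (isOpen_setOf_pos_lt T)]
    refine ⟨fun t hs => (hd i t hs).differentiableAt.differentiableWithinAt, by simp, ?_⟩
    rw [contDiffOn_zero]
    have hv := (contDiffOn_velocity φ α Γ₀).continuousOn.comp (h.continuousOn.mono hsub)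
      fun t hs => h.mem t (hsub hs).1 hs.2
    exact (continuousOn_pi.1 hv i).congr fun t hs => (hd i t hs).deriv
  · have hp := h.parallel ht h0.le hT
    rw [(hd i t ⟨h0, hT⟩).deriv, hp.elasticForce_eq ht hi,
      offset_curveOf ht (h.mem t h0.le hT), velocity, if_neg hi,
      mul_div_cancel_left₀ _ (hφ.dual_pos (Piece.norm_normal (Γ₀.nondegenerate i))).ne']

theorem IsFlow.eq (hφ : IsAnisotropy φ) (ht : Γ₀.Transversal) {Γ Δ : ℝ → PolygonalCurve n}
    (h : IsFlow φ α Γ₀ T Γ) (h' : IsFlow φ α Γ₀ T' Δ) {t : ℝ} (h0 : 0 ≤ t)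
    (hT : (t : EReal) < T) (hT' : (t : EReal) < T') : Γ t = Δ t := by
  have := (h.isSolution hφ ht).eq Γ₀.isOpen_region (contDiffOn_velocity φ α Γ₀)
    (h'.isSolution hφ ht) h0 hT hT'
  rw [(h.parallel t h0 hT).eq_curveOf ht, (h'.parallel t h0 hT').eq_curveOf ht, this]

/-- A maximal flow comes from a maximal solution for the heights. -/
theorem exists_isMaximalFlow (hφ : IsAnisotropy φ) (ht : Γ₀.Transversal) (α : ℝ) :
    ∃ (T : EReal) (y : ℝ → Fin n → ℝ), 0 < T ∧
      IsSolution (Γ₀.velocity φ α) Γ₀.region Γ₀.offset T y ∧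
      (∀ T' z, IsSolution (Γ₀.velocity φ α) Γ₀.region Γ₀.offset T' z → T' ≤ T) ∧
      IsMaximalFlow φ α Γ₀ T fun t => Γ₀.curveOf (y t) := by
  obtain ⟨T, y, hT, hy, hmax⟩ := exists_maximal_isSolution Γ₀.isOpen_region
    (contDiffOn_velocity φ α Γ₀) ((Parallel.refl Γ₀).offset_mem_region ht)
  exact ⟨T, y, hT, hy, hmax, hy.isFlow hφ ht hT,
    fun T' Δ hΔ => hmax T' _ (hΔ.isSolution hφ ht)⟩

theorem IsMaximalFlow.restart (hφ : IsAnisotropy φ) (ht : Γ₀.Transversal)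
    {Γ : ℝ → PolygonalCurve n} (h : IsMaximalFlow φ α Γ₀ T Γ) {s : ℝ} (hs : 0 ≤ s)
    (hsT : (s : EReal) < T) (hts : (Γ s).Transversal) :
    IsMaximalFlow φ α (Γ s) (T - s) (fun t => Γ (s + t)) := by
  have hp := h.1.parallel s hs hsT
  have hsol := h.1.isSolution hφ ht
  have hT0 : 0 < T - s := by
    rw [EReal.lt_sub_iff_add_lt (by simp) (by simp), zero_add]; exact hsT
  have key : ∀ t : ℝ, (t : EReal) < T - s → ((s + t : ℝ) : EReal) < T := fun t ht => by
    rw [EReal.lt_sub_iff_add_lt (by simp) (by simp)] at ht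
    rwa [add_comm, EReal.coe_add]
  have hsol' : IsSolution ((Γ s).velocity φ α) (Γ s).region (Γ s).offset (T - s)
      fun t => (Γ (s + t)).offset := by
    rw [hp.velocity_eq, hp.region_eq]
    exact hsol.shift hs
  refine ⟨?_, fun T' Δ hΔ => ?_⟩
  · have hf := hsol'.isFlow hφ hts hT0
    have e : ∀ t : ℝ, 0 ≤ t → (t : EReal) < T - s →
        (Γ s).curveOf (Γ (s + t)).offset = Γ (s + t) := fun t h0 hT =>
      ((hp.symm.trans (h.1.parallel (s + t) (by linarith) (key t hT))).eq_curveOf hts).symm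
    have eh : ∀ i (t : ℝ), 0 ≤ t → (t : EReal) < T - s →
        height (Γ s) (fun t => Γ (s + t)) i t
          = height (Γ s) (fun t => (Γ s).curveOf (Γ (s + t)).offset) i t := fun i t h0 hT => by
      rw [height, height, e t h0 hT]
    refine ⟨hf.pos, by simp, fun t h0 hT => ?_, fun i => ?_, fun i => ?_, fun i hi t h0 hT => ?_⟩
    · exact hp.symm.trans (h.1.parallel (s + t) (by linarith) (key t hT))
    · exact (hf.continuousOn i).congr fun t ht => eh i t ht.1 ht.2
    · exact (hf.contDiffOn i).congr fun t ht => eh i t ht.1.le ht.2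
    · have := hf.ode i hi t h0 hT
      rw [e t h0.le hT] at this
      rw [← this]
      congr 1
      refine Filter.EventuallyEq.deriv_eq ?_
      filter_upwards [(isOpen_setOf_pos_lt (T - s)).mem_nhds ⟨h0, hT⟩] with u hu
      exact eh i u hu.1.le hu.2
  · have hΔ' := hΔ.isSolution hφ hts
    rw [hp.velocity_eq, hp.region_eq] at hΔ'
    refine hsol.le_sub_of_maximal Γ₀.isOpen_region (contDiffOn_velocity φ α Γ₀) ?_ hs hsT hΔ'
    intro T'' z hz
    rcases le_or_gt T'' 0 with h0 | h0
    · exact h0.trans h.1.pos.le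
    · exact h.2 _ _ (hz.isFlow hφ ht h0)

end Crystalline

namespace Crystalline

/-! ### Limits of chains of segments -/

/-- Two sets are within Hausdorff distance `ε`. -/
def HausdorffClose (ε : ℝ) (A B : Set Plane) : Prop :=
  (∀ x ∈ A, ∃ y ∈ B, dist x y ≤ ε) ∧ ∀ y ∈ B, ∃ x ∈ A, dist x y ≤ ε

lemma HausdorffClose.trans {ε ε' : ℝ} {A B C : Set Plane} (h : HausdorffClose ε A B)
    (h' : HausdorffClose ε' B C) : HausdorffClose (ε + ε') A C := by
  constructor
  · intro x hx
    obtain ⟨y, hy, hxy⟩ := h.1 x hx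
    obtain ⟨z, hz, hyz⟩ := h'.1 y hy
    exact ⟨z, hz, (dist_triangle x y z).trans (add_le_add hxy hyz)⟩
  · intro z hz
    obtain ⟨y, hy, hyz⟩ := h'.2 z hz
    obtain ⟨x, hx, hxy⟩ := h.2 y hy
    exact ⟨x, hx, (dist_triangle x y z).trans (add_le_add hxy hyz)⟩

lemma exists_mem_segment_dist_le {a b a' b' x : Plane} {ε : ℝ} (ha : dist a a' ≤ ε)
    (hb : dist b b' ≤ ε) (hx : x ∈ segment ℝ a b) : ∃ y ∈ segment ℝ a' b', dist x y ≤ ε := by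
  obtain ⟨r, s, hr, hs, hrs, rfl⟩ := hx
  refine ⟨r • a' + s • b', ⟨r, s, hr, hs, hrs, rfl⟩, ?_⟩
  rw [dist_eq_norm] at *
  have e : r • a + s • b - (r • a' + s • b') = r • (a - a') + s • (b - b') := by module
  rw [e]
  calc _ ≤ ‖r • (a - a')‖ + ‖s • (b - b')‖ := norm_add_le _ _
    _ = r * ‖a - a'‖ + s * ‖b - b'‖ := by
      rw [norm_smul, norm_smul, Real.norm_of_nonneg hr, Real.norm_of_nonneg hs]
    _ ≤ r * ε + s * ε := by gcongr
    _ = ε := by rw [← add_mul, hrs, one_mul]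

/-- Comparison of the first part of a nearly straight path with the segment `[a, d]` between its
endpoints. -/
lemma segment_compare {a b d τ : Plane} {ℓ ℓ' ε : ℝ} (hℓ : 0 ≤ ℓ) (hℓ' : 0 ≤ ℓ')
    (hb : ‖b - a - ℓ • τ‖ ≤ ε) (hd : ‖d - a - (ℓ + ℓ') • τ‖ ≤ 3 * ε) :
    (∀ x ∈ segment ℝ a b, ∃ y ∈ segment ℝ a d, dist x y ≤ 4 * ε) ∧
    ∀ u : ℝ, 0 ≤ u → u ≤ 1 → u * (ℓ + ℓ') ≤ ℓ →
      ∃ x ∈ segment ℝ a b, dist x (a + u • (d - a)) ≤ 4 * ε := by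
  have main : ∀ s u : ℝ, 0 ≤ s → s ≤ 1 → 0 ≤ u → u ≤ 1 → s * ℓ = u * (ℓ + ℓ') →
      dist (a + s • (b - a)) (a + u • (d - a)) ≤ 4 * ε := by
    intro s u hs hs1 hu hu1 h
    have e : a + s • (b - a) - (a + u • (d - a))
        = s • (b - a - ℓ • τ) - u • (d - a - (ℓ + ℓ') • τ) := by
      have e' : s • (b - a - ℓ • τ) - u • (d - a - (ℓ + ℓ') • τ)
          = a + s • (b - a) - (a + u • (d - a)) - ((s * ℓ) • τ - (u * (ℓ + ℓ')) • τ) := by module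
      rw [e', h, sub_self, sub_zero]
    rw [dist_eq_norm, e]
    calc _ ≤ ‖s • (b - a - ℓ • τ)‖ + ‖u • (d - a - (ℓ + ℓ') • τ)‖ := norm_sub_le _ _
      _ = s * ‖b - a - ℓ • τ‖ + u * ‖d - a - (ℓ + ℓ') • τ‖ := by
        rw [norm_smul, norm_smul, Real.norm_of_nonneg hs, Real.norm_of_nonneg hu]
      _ ≤ 1 * ε + 1 * (3 * ε) := by gcongr
      _ = 4 * ε := by ring
  constructor
  · intro x hx
    rw [segment_eq_image'] at hx
    obtain ⟨s, ⟨hs, hs1⟩, rfl⟩ := hx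
    have h1 : s * ℓ / (ℓ + ℓ') ≤ 1 := div_le_one_of_le₀ (by nlinarith) (by positivity)
    have h0 : 0 ≤ s * ℓ / (ℓ + ℓ') := by positivity
    refine ⟨a + (s * ℓ / (ℓ + ℓ')) • (d - a), ?_, main s _ hs hs1 h0 h1 ?_⟩
    · rw [segment_eq_image']
      exact ⟨_, ⟨h0, h1⟩, rfl⟩
    · rcases (add_nonneg hℓ hℓ').eq_or_lt with h | h
      · have : ℓ = 0 := by linarith
        simp [this]
      · rw [div_mul_cancel₀ _ h.ne']
  · intro u hu hu1 h
    have h1 : u * (ℓ + ℓ') / ℓ ≤ 1 := div_le_one_of_le₀ h hℓ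
    have h0 : 0 ≤ u * (ℓ + ℓ') / ℓ := by positivity
    refine ⟨a + (u * (ℓ + ℓ') / ℓ) • (b - a), ?_, main _ u h0 h1 hu hu1 ?_⟩
    · rw [segment_eq_image']
      exact ⟨_, ⟨h0, h1⟩, rfl⟩
    · rcases hℓ.eq_or_lt with h' | h'
      · subst h'
        have : 0 ≤ u * (0 + ℓ') := by positivity
        rw [mul_zero]; linarith
      · rw [div_mul_cancel₀ _ h'.ne']

/-- A nearly straight path with vertices `a`, `b`, `c`, `d` is close to the segment `[a, d]`. -/
lemma hausdorffClose_path {a b c d τ : Plane} {ℓ ℓ' ε : ℝ} (hℓ : 0 ≤ ℓ) (hℓ' : 0 ≤ ℓ')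
    (hb : ‖b - a - ℓ • τ‖ ≤ ε) (hc : ‖c - b‖ ≤ ε) (hd : ‖d - c - ℓ' • τ‖ ≤ ε) :
    HausdorffClose (5 * ε) (segment ℝ a b ∪ segment ℝ b c ∪ segment ℝ c d) (segment ℝ a d) := by
  have hε : 0 ≤ ε := (norm_nonneg _).trans hc
  have hsum : ‖d - a - (ℓ + ℓ') • τ‖ ≤ 3 * ε := by
    have e : d - a - (ℓ + ℓ') • τ = (b - a - ℓ • τ) + (c - b) + (d - c - ℓ' • τ) := by module
    rw [e]
    linarith [norm_add₃_le (a := b - a - ℓ • τ) (b := c - b) (c := d - c - ℓ' • τ)]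
  obtain ⟨h1, h2⟩ := segment_compare hℓ hℓ' hb hsum
  obtain ⟨h3, h4⟩ := segment_compare (a := d) (b := c) (d := a) (τ := -τ) (ε := ε) hℓ' hℓ
    (by rwa [show c - d - ℓ' • -τ = -(d - c - ℓ' • τ) by module, norm_neg])
    (by rwa [show a - d - (ℓ' + ℓ) • -τ = -(d - a - (ℓ + ℓ') • τ) by module, norm_neg])
  constructor
  · rintro x ((hx | hx) | hx)
    · obtain ⟨y, hy, hxy⟩ := h1 x hx
      exact ⟨y, hy, by linarith⟩
    · obtain ⟨y, hy, hxy⟩ := h1 b (right_mem_segment ℝ a b)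
      obtain ⟨z, hz, hxz⟩ := exists_mem_segment_dist_le (a' := b) (b' := b) (ε := ε)
        (by simpa using hε) (by rwa [dist_eq_norm]) hx
      rw [segment_same, mem_singleton_iff] at hz
      subst hz
      exact ⟨y, hy, by linarith [dist_triangle x z y]⟩
    · obtain ⟨y, hy, hxy⟩ := h3 x (by rwa [segment_symm])
      exact ⟨y, by rwa [segment_symm], by linarith⟩
  · intro y hy
    rw [segment_eq_image'] at hy
    obtain ⟨u, ⟨hu, hu1⟩, rfl⟩ := hy
    rcases le_total (u * (ℓ + ℓ')) ℓ with h | h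
    · obtain ⟨x, hx, hxy⟩ := h2 u hu hu1 h
      exact ⟨x, Or.inl (Or.inl hx), by linarith⟩
    · obtain ⟨x, hx, hxy⟩ := h4 (1 - u) (by linarith) (by linarith) (by linarith)
      refine ⟨x, Or.inr (by rwa [segment_symm]), ?_⟩
      have e : d + (1 - u) • (a - d) = a + u • (d - a) := by module
      rw [e] at hxy
      linarith

/-- A closed chain of `m` segments depending on a parameter: the vertices `V j`, the normals `ν j`
and the approximate lengths `ℓ j` are indexed by natural numbers and `m`-periodic. Along the filter
`l`, the edges are asymptotically orthogonal to the normals. Each edge either *collapses*, and then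
its two neighbours have equal normals, or is *stable*: its length is bounded below and the line that
carries it converges. -/
structure Chain (φ : Plane → ℝ) (l : Filter ℝ) (m : ℕ) (ν : ℕ → Plane) (V : ℕ → ℝ → Plane)
    (ℓ : ℕ → ℝ → ℝ) : Prop where
  periodic_ν : Function.Periodic ν m
  periodic_V : Function.Periodic V m
  periodic_ℓ : Function.Periodic ℓ m
  adj : ∀ j, AdjacentFacets φ (ν j) (ν (j + 1))
  nonneg : ∀ j, ∀ᶠ t in l, 0 ≤ ℓ j t
  edge : ∀ j, Tendsto (fun t => V (j + 1) t - V j t - ℓ j t • (-rot (ν j))) l (𝓝 0)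
  turn : ∀ j, Tendsto (ℓ (j + 1)) l (𝓝 0) → ν (j + 2) = ν j
  alt : ∀ j, Tendsto (ℓ j) l (𝓝 0) ∨ ((∃ ε > 0, ∀ᶠ t in l, ε ≤ ℓ j t) ∧
    ∃ h, Tendsto (fun t => inner ℝ (V j t) (ν j)) l (𝓝 h))

/-- The point set of a chain. -/
def chainCarrier (V : ℕ → Plane) : Set Plane := ⋃ j, segment ℝ (V j) (V (j + 1))

lemma succ_mod (j : ℕ) {p : ℕ} (hp : 0 < p) :
    (j % p + 1 < p ∧ (j + 1) % p = j % p + 1) ∨ (j % p + 1 = p ∧ (j + 1) % p = 0) := by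
  have h := (Nat.mod_add_mod j p 1).symm
  rcases Nat.lt_or_ge (j % p + 1) p with h1 | h1
  · exact Or.inl ⟨h1, by rw [h, Nat.mod_eq_of_lt h1]⟩
  · have h2 : j % p + 1 = p := le_antisymm (Nat.mod_lt j hp) h1
    exact Or.inr ⟨h2, by rw [h, h2, Nat.mod_self]⟩

namespace Chain

variable {φ : Plane → ℝ} {l : Filter ℝ} {m p : ℕ} {ν : ℕ → Plane} {V : ℕ → ℝ → Plane}
  {ℓ : ℕ → ℝ → ℝ}

lemma rotate (h : Chain φ l m ν V ℓ) (k : ℕ) :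
    Chain φ l m (fun j => ν (j + k)) (fun j => V (j + k)) (fun j => ℓ (j + k)) where
  periodic_ν j := by simp only [add_right_comm j m k, h.periodic_ν (j + k)]
  periodic_V j := by simp only [add_right_comm j m k, h.periodic_V (j + k)]
  periodic_ℓ j := by simp only [add_right_comm j m k, h.periodic_ℓ (j + k)]
  adj j := by simpa only [add_right_comm j 1 k] using h.adj (j + k)
  nonneg j := h.nonneg (j + k)
  edge j := by simpa only [add_right_comm j 1 k] using h.edge (j + k)
  turn j := by simpa only [add_right_comm j 1 k, add_right_comm j 2 k] using h.turn (j + k)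
  alt j := h.alt (j + k)

lemma chainCarrier_rotate {V : ℕ → Plane} (hV : Function.Periodic V m) (hm : 0 < m) (k : ℕ) :
    chainCarrier (fun j => V (j + k)) = chainCarrier V := by
  apply Subset.antisymm
  · refine iUnion_subset fun j => ?_
    have := subset_iUnion (fun j => segment ℝ (V j) (V (j + 1))) (j + k)
    simpa only [chainCarrier, add_right_comm j 1 k] using this
  · refine iUnion_subset fun j => ?_
    have h1 : ∀ i, V (i + k * m) = V i := fun i => by simpa using hV.nat_mul k i
    have hk : k ≤ k * m := Nat.le_mul_of_pos_right k hm
    have e1 : j + (k * m - k) + k = j + k * m := by omega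
    have e2 : j + (k * m - k) + 1 + k = j + 1 + k * m := by omega
    have := subset_iUnion (fun j => segment ℝ (V (j + k)) (V (j + 1 + k))) (j + (k * m - k))
    simp only [e1, e2, h1] at this
    exact this

/-- Along an edge, the distance to the origin of the line that carries it is asymptotically
constant. -/
lemma tendsto_inner_sub (h : Chain φ l m ν V ℓ) (j : ℕ) :
    Tendsto (fun t => inner ℝ (V (j + 1) t) (ν j) - inner ℝ (V j t) (ν j)) l (𝓝 0) := by
  have h1 : Tendsto (fun t => inner ℝ (V (j + 1) t - V j t - ℓ j t • (-rot (ν j))) (ν j)) l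
      (𝓝 (inner ℝ (0 : Plane) (ν j))) := (h.edge j).inner tendsto_const_nhds
  rw [inner_zero_left] at h1
  refine h1.congr fun t => ?_
  rw [inner_sub_left, inner_sub_left, inner_smul_left, inner_neg_left, real_inner_comm _ (rot _),
    inner_rot_self]
  simp

lemma tendsto_sub_of_collapsed (h : Chain φ l m ν V ℓ) {j : ℕ} (hj : Tendsto (ℓ j) l (𝓝 0)) :
    Tendsto (fun t => V (j + 1) t - V j t) l (𝓝 0) := by
  have := (h.edge j).add (hj.smul (tendsto_const_nhds (x := -rot (ν j))))
  simpa using this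

lemma collapsed_of_tendsto_sub (h : Chain φ l m ν V ℓ) {j : ℕ}
    (hj : Tendsto (fun t => V (j + 1) t - V j t) l (𝓝 0)) : Tendsto (ℓ j) l (𝓝 0) := by
  have h1 : Tendsto (fun t => ℓ j t • (-rot (ν j))) l (𝓝 0) := by
    have := hj.sub (h.edge j)
    simpa using this
  have h2 := h1.norm
  simp only [norm_smul, norm_neg, norm_rot, (h.adj j).1.1, mul_one, norm_zero] at h2
  exact tendsto_zero_iff_norm_tendsto_zero.2 h2

/-- Removal of the collapsed edge `p + 1` of a chain of `p + 2` segments. Its neighbours, the edges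
`p` and `p + 2 ≡ 0`, are replaced by a single edge, which gets the index `0`. -/
theorem merge (h : Chain φ l (p + 2) ν V ℓ) (hp : 0 < p) (hc : Tendsto (ℓ (p + 1)) l (𝓝 0)) :
    Chain φ l p (fun j => ν (j % p)) (fun j => if j % p = 0 then V p else V (j % p))
      (fun j => if j % p = 0 then ℓ p + ℓ 0 else ℓ (j % p)) := by
  have hν0 : ν (p + 2) = ν 0 := by simpa using h.periodic_ν 0
  have hV0 : V (p + 2) = V 0 := by simpa using h.periodic_V 0
  have hν1 : ν (p + 2 + 1) = ν 1 := by simpa [add_comm, add_left_comm] using h.periodic_ν 1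
  have hV1 : V (p + 2 + 1) = V 1 := by simpa [add_comm, add_left_comm] using h.periodic_V 1
  have hℓ0 : ℓ (p + 2) = ℓ 0 := by simpa using h.periodic_ℓ 0
  have hνp : ν p = ν 0 := by rw [← hν0, h.turn p hc]
  have nextν : ∀ j, ν ((j + 1) % p) = ν (j % p + 1) := by
    intro j
    rcases succ_mod j hp with ⟨-, h2⟩ | ⟨h1, h2⟩
    · rw [h2]
    · rw [h2, h1, hνp]
  have nextV : ∀ j, (if (j + 1) % p = 0 then V p else V ((j + 1) % p)) = V (j % p + 1) := by
    intro j
    rcases succ_mod j hp with ⟨-, h2⟩ | ⟨h1, h2⟩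
    · rw [h2, if_neg (Nat.succ_ne_zero _)]
    · rw [h2, h1, if_pos rfl]
  have hsub := h.tendsto_sub_of_collapsed hc
  have both : Tendsto (ℓ p + ℓ 0) l (𝓝 0) → Tendsto (ℓ p) l (𝓝 0) ∧ Tendsto (ℓ 0) l (𝓝 0) := by
    intro hs
    constructor
    · refine tendsto_of_tendsto_of_tendsto_of_le_of_le' tendsto_const_nhds hs (h.nonneg p) ?_
      filter_upwards [h.nonneg 0] with t ht
      simpa using ht
    · refine tendsto_of_tendsto_of_tendsto_of_le_of_le' tendsto_const_nhds hs (h.nonneg 0) ?_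
      filter_upwards [h.nonneg p] with t ht
      simpa using ht
  refine ⟨fun j => by simp, fun j => by simp, fun j => by simp, fun j => ?_, fun j => ?_,
    fun j => ?_, fun j hj => ?_, fun j => ?_⟩
  · simp only [nextν]; exact h.adj _
  · split_ifs with h0
    · filter_upwards [h.nonneg p, h.nonneg 0] with t h1 h2
      exact add_nonneg h1 h2
    · exact h.nonneg _
  · simp only [nextV]
    by_cases h0 : j % p = 0
    · simp only [h0, if_true]
      have e := ((h.edge p).add hsub).add (h.edge (p + 2))
      rw [add_zero, add_zero] at e
      refine e.congr fun t => ?_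
      rw [hV1, hν0, hℓ0, hνp, zero_add, Pi.add_apply]
      module
    · simp only [h0, if_false]
      exact h.edge _
  · simp only [show j + 2 = j + 1 + 1 from rfl, nextν (j + 1)]
    rcases succ_mod j hp with ⟨h1, h2⟩ | ⟨h1, h2⟩
    · rw [h2] at hj ⊢
      rw [if_neg (Nat.succ_ne_zero _)] at hj
      exact h.turn _ hj
    · rw [h2, if_pos rfl] at hj
      obtain ⟨c1, c2⟩ := both hj
      have e := h.turn (j % p) (by rwa [h1])
      rw [show j % p + 2 = p + 1 by omega] at e
      rw [h2, zero_add, ← hν1, show p + 2 + 1 = p + 1 + 2 from rfl, h.turn (p + 1) (by rwa [hℓ0]), e]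
  · by_cases h0 : j % p = 0
    · simp only [h0, if_true]
      have hp0 := h.alt p
      have h00 := h.alt 0
      rw [hνp] at hp0
      rcases hp0 with c1 | ⟨⟨ε, hε, hs⟩, hh⟩
      -- If the edge `p` collapses, then `V p` and `V 0` have the same limit, and the merged edge
      -- behaves like the edge `0`. Otherwise it inherits the stability of the edge `p`.
      · rcases h00 with c2 | ⟨⟨ε, hε, hs⟩, a, hh⟩
        · left
          have := c1.add c2
          rwa [add_zero] at this
        · right
          refine ⟨⟨ε, hε, ?_⟩, a, ?_⟩
          · filter_upwards [hs, h.nonneg p] with t h1 h2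
            rw [Pi.add_apply]; linarith
          · have hd : Tendsto (fun t => V 0 t - V p t) l (𝓝 0) := by
              have := hsub.add (h.tendsto_sub_of_collapsed c1)
              rw [add_zero] at this
              refine this.congr fun t => ?_
              rw [← hV0]
              abel
            have hd' : Tendsto (fun t => inner ℝ (V 0 t - V p t) (ν 0)) l
              (𝓝 (inner ℝ (0 : Plane) (ν 0))) := hd.inner tendsto_const_nhds
            rw [inner_zero_left] at hd'
            have := hh.sub hd'
            rw [sub_zero] at this
            refine this.congr fun t => ?_
            rw [inner_sub_left]; ring
      · right
        refine ⟨⟨ε, hε, ?_⟩, hh⟩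
        filter_upwards [hs, h.nonneg 0] with t h1 h2
        rw [Pi.add_apply]; linarith
    · simp only [h0, if_false]
      exact h.alt _

lemma exists_not_collapsed_merge (h : Chain φ l (p + 2) ν V ℓ) (hp : 0 < p)
    (hc : Tendsto (ℓ (p + 1)) l (𝓝 0)) (hs : ∃ j, ¬ Tendsto (ℓ j) l (𝓝 0)) :
    ∃ j, ¬ Tendsto (if j % p = 0 then ℓ p + ℓ 0 else ℓ (j % p)) l (𝓝 0) := by
  by_contra! hall
  obtain ⟨j, hj⟩ := hs
  apply hj
  rw [← h.periodic_ℓ.map_mod_nat]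
  have hlt := Nat.mod_lt j (show 0 < p + 2 by omega)
  have h0 := hall 0
  rw [Nat.zero_mod, if_pos rfl] at h0
  generalize j % (p + 2) = r at hlt
  rcases Nat.lt_or_ge r p with h1 | h1
  · rcases Nat.eq_zero_or_pos r with rfl | h2
    · refine tendsto_of_tendsto_of_tendsto_of_le_of_le' tendsto_const_nhds h0 (h.nonneg 0) ?_
      filter_upwards [h.nonneg p] with t ht
      simpa using ht
    · have := hall r
      rwa [Nat.mod_eq_of_lt h1, if_neg h2.ne'] at this
  · rcases (show r = p ∨ r = p + 1 by omega) with rfl | rfl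
    · refine tendsto_of_tendsto_of_tendsto_of_le_of_le' tendsto_const_nhds h0 (h.nonneg r) ?_
      filter_upwards [h.nonneg 0] with t ht
      simpa using ht
    · exact hc

/-- The removal of a collapsed edge does not change the limit of the point sets. -/
theorem hausdorffClose_merge (h : Chain φ l (p + 2) ν V ℓ) (hp : 0 < p)
    (hc : Tendsto (ℓ (p + 1)) l (𝓝 0)) {ε : ℝ} (hε : 0 < ε) :
    ∀ᶠ t in l, HausdorffClose ε (chainCarrier fun j => V j t)
      (chainCarrier fun j => (if j % p = 0 then V p else V (j % p)) t) := by
  have hν0 : ν (p + 2) = ν 0 := by simpa using h.periodic_ν 0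
  have hV0 : V (p + 2) = V 0 := by simpa using h.periodic_V 0
  have hνp : ν p = ν 0 := by rw [← hν0, h.turn p hc]
  have nextV : ∀ j, (if (j + 1) % p = 0 then V p else V ((j + 1) % p)) = V (j % p + 1) := by
    intro j
    rcases succ_mod j hp with ⟨-, h2⟩ | ⟨h1, h2⟩
    · rw [h2, if_neg (Nat.succ_ne_zero _)]
    · rw [h2, h1, if_pos rfl]
  have small : ∀ {f : ℝ → Plane}, Tendsto f l (𝓝 0) → ∀ᶠ t in l, ‖f t‖ ≤ ε / 5 := by
    intro f hf
    have := hf.norm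
    rw [norm_zero] at this
    exact this.eventually_le_const (by positivity)
  filter_upwards [small (h.edge p), small (h.edge 0), small (h.tendsto_sub_of_collapsed hc),
    h.nonneg p, h.nonneg 0] with t e1 e2 e3 n1 n2
  rw [hνp] at e1
  rw [show p + 1 + 1 = p + 2 from rfl, hV0] at e3
  have path := hausdorffClose_path n1 n2 e1 e3 e2
  rw [show 5 * (ε / 5) = ε by ring, zero_add] at path
  have sub1 : ∀ r, r < p → r ≠ 0 → segment ℝ (V r t) (V (r + 1) t) ⊆
      chainCarrier fun j => (if j % p = 0 then V p else V (j % p)) t := by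
    intro r hr h0
    have := subset_iUnion (fun j => segment ℝ ((if j % p = 0 then V p else V (j % p)) t)
      ((if (j + 1) % p = 0 then V p else V ((j + 1) % p)) t)) r
    simpa only [chainCarrier, nextV, Nat.mod_eq_of_lt hr, if_neg h0] using this
  have sub2 : segment ℝ (V p t) (V 1 t) ⊆
      chainCarrier fun j => (if j % p = 0 then V p else V (j % p)) t := by
    have := subset_iUnion (fun j => segment ℝ ((if j % p = 0 then V p else V (j % p)) t)
      ((if (j + 1) % p = 0 then V p else V ((j + 1) % p)) t)) 0
    rw [nextV, Nat.zero_mod, if_pos rfl, zero_add] at this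
    exact this
  have sub3 : ∀ r, segment ℝ (V r t) (V (r + 1) t) ⊆ chainCarrier fun j => V j t := fun r =>
    subset_iUnion (fun j => segment ℝ (V j t) (V (j + 1) t)) r
  have hself : ∀ x : Plane, dist x x ≤ ε := fun x => by rw [dist_self]; exact hε.le
  constructor
  · intro x hx
    obtain ⟨j, hj⟩ := mem_iUnion.1 hx
    have hj' : x ∈ segment ℝ (V (j % (p + 2)) t) (V (j % (p + 2) + 1) t) := by
      rw [h.periodic_V.map_mod_nat]
      rcases succ_mod j (show 0 < p + 2 by omega) with ⟨-, h2⟩ | ⟨h1, h2⟩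
      · rwa [← h2, h.periodic_V.map_mod_nat]
      · rw [h1, hV0, ← h2, h.periodic_V.map_mod_nat]
        exact hj
    have hlt := Nat.mod_lt j (show 0 < p + 2 by omega)
    generalize j % (p + 2) = r at hlt hj'
    have viaPath : x ∈ segment ℝ (V p t) (V (p + 1) t) ∪ segment ℝ (V (p + 1) t) (V 0 t) ∪
        segment ℝ (V 0 t) (V 1 t) →
        ∃ y ∈ chainCarrier fun j => (if j % p = 0 then V p else V (j % p)) t, dist x y ≤ ε := by
      intro hx
      obtain ⟨y, hy, hxy⟩ := path.1 x hx
      exact ⟨y, sub2 hy, hxy⟩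
    rcases Nat.lt_or_ge r p with h1 | h1
    · rcases Nat.eq_zero_or_pos r with rfl | h2
      · exact viaPath (Or.inr hj')
      · exact ⟨x, sub1 r h1 h2.ne' hj', hself x⟩
    · rcases (show r = p ∨ r = p + 1 by omega) with rfl | rfl
      · exact viaPath (Or.inl (Or.inl hj'))
      · rw [show p + 1 + 1 = p + 2 from rfl, hV0] at hj'
        exact viaPath (Or.inl (Or.inr hj'))
  · intro y hy
    obtain ⟨j, hj⟩ := mem_iUnion.1 hy
    simp only [nextV] at hj
    by_cases h0 : j % p = 0
    · rw [if_pos h0, h0] at hj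
      obtain ⟨x, hx, hxy⟩ := path.2 y hj
      refine ⟨x, ?_, hxy⟩
      rcases hx with (hx | hx) | hx
      · exact sub3 p hx
      · refine sub3 (p + 1) ?_
        rwa [show p + 1 + 1 = p + 2 from rfl, hV0]
      · exact sub3 0 hx
    · rw [if_neg h0] at hj
      exact ⟨y, sub3 _ hj, hself y⟩

/-- If no edge collapses, all vertices converge. -/
theorem exists_limit_of_stable (h : Chain φ l m ν V ℓ) (hφ : IsAnisotropy φ) [l.NeBot] [NeZero m]
    (hs : ∀ j, ¬ Tendsto (ℓ j) l (𝓝 0)) :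
    ∃ Γ : PolygonalCurve m, Γ.Admissible φ ∧ IsCompact Γ.carrier ∧
      ∀ ε > 0, ∀ᶠ t in l, HausdorffClose ε (chainCarrier fun j => V j t) Γ.carrier := by
  have hst := fun j => (h.alt j).resolve_left (hs j)
  have hm : 0 < m := NeZero.pos m
  -- A vertex is the intersection of the lines that carry its two edges, and these lines converge.
  have conv' : ∀ j, ∃ v, Tendsto (V (j + 1)) l (𝓝 v) := by
    intro j
    obtain ⟨a, ha⟩ := (hst j).2
    obtain ⟨b, hb⟩ := (hst (j + 1)).2
    have ha' : Tendsto (fun t => inner ℝ (V (j + 1) t) (ν j)) l (𝓝 a) := by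
      have := (h.tendsto_inner_sub j).add ha
      simpa using this
    have hd : det (-rot (ν j)) (-rot (ν (j + 1))) ≠ 0 := by
      have := (h.adj j).det_ne_zero hφ
      rw [← det_rot_rot] at this
      simpa [det] using this
    refine ⟨lineInter (-rot (ν j)) (-rot (ν (j + 1))) a b, ?_⟩
    have : Tendsto (fun t => lineInter (-rot (ν j)) (-rot (ν (j + 1)))
        (inner ℝ (V (j + 1) t) (ν j)) (inner ℝ (V (j + 1) t) (ν (j + 1)))) l
        (𝓝 (lineInter (-rot (ν j)) (-rot (ν (j + 1))) a b)) :=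
      ((ha'.smul tendsto_const_nhds).sub (hb.smul tendsto_const_nhds)).const_smul _
    refine this.congr fun t => ?_
    have e := eq_lineInter hd (V (j + 1) t)
    rw [rot_neg_rot, rot_neg_rot] at e
    exact e.symm
  have conv : ∀ j, ∃ v, Tendsto (V j) l (𝓝 v) := fun j => by
    obtain ⟨v, hv⟩ := conv' (j + m - 1)
    rw [show j + m - 1 + 1 = j + m by omega, h.periodic_V] at hv
    exact ⟨v, hv⟩
  choose v hv using conv
  have hvp : Function.Periodic v m := fun j =>
    tendsto_nhds_unique (hv (j + m)) (by rw [h.periodic_V]; exact hv j)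
  have hedge : ∀ j, ∃ r > (0 : ℝ), v (j + 1) - v j = r • (-rot (ν j)) := by
    intro j
    have hτ : ‖-rot (ν j)‖ = 1 := by rw [norm_neg, norm_rot, (h.adj j).1.1]
    have h1 : Tendsto (fun t => V (j + 1) t - V j t) l (𝓝 (v (j + 1) - v j)) :=
      (hv (j + 1)).sub (hv j)
    have h2 := (h1.sub (h.edge j)).inner (𝕜 := ℝ) (tendsto_const_nhds (x := -rot (ν j)))
    simp only [sub_sub_cancel, sub_zero, inner_smul_left, real_inner_self_eq_norm_sq, hτ] at h2
    simp only [one_pow, mul_one, conj_trivial] at h2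
    obtain ⟨ε, hε, hle⟩ := (hst j).1
    refine ⟨_, hε.trans_le (ge_of_tendsto h2 hle), ?_⟩
    have h3 := h1.sub (h2.smul (tendsto_const_nhds (x := -rot (ν j))))
    exact sub_eq_zero.1 (tendsto_nhds_unique h3 (h.edge j))
  have hnext : ∀ i : Fin m, v (i + 1 : Fin m) = v (i.val + 1) := by
    intro i
    rw [Fin.val_add, ← hvp.map_mod_nat (i.val + 1)]
    congr 1
    rw [Fin.val_one']
    simp
  have hnextν : ∀ i : Fin m, ν (i + 1 : Fin m) = ν (i.val + 1) := by
    intro i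
    rw [Fin.val_add, ← h.periodic_ν.map_mod_nat (i.val + 1)]
    congr 1
    rw [Fin.val_one']
    simp
  have hnormal : ∀ j, (Piece.segment (v j) (v (j + 1))).normal = ν j := by
    intro j
    obtain ⟨r, hr, e⟩ := hedge j
    rw [Piece.normal, Piece.tangent, e, norm_smul, norm_neg, norm_rot, (h.adj j).1.1, mul_one,
      Real.norm_of_nonneg hr.le, smul_smul, inv_mul_cancel₀ hr.ne', one_smul, rot_neg_rot]
  let Γ : PolygonalCurve m :=
    { piece := fun i => .segment (v i.val) (v (i.val + 1))
      nondegenerate := fun i => by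
        obtain ⟨r, hr, e⟩ := hedge i.val
        intro he
        rw [← he, sub_self, eq_comm, smul_eq_zero] at e
        rcases e with e | e
        · exact hr.ne' e
        · have : ‖-rot (ν i.val)‖ = 1 := by rw [norm_neg, norm_rot, (h.adj i.val).1.1]
          rw [e, norm_zero] at this
          exact zero_ne_one this
      consecutive := fun i => by simp only [Piece.start, Piece.finish, hnext]
      unbounded_only_at_ends := fun i hi => by simp [Piece.start] at hi }
  have hcar : Γ.carrier = chainCarrier v := by
    apply Subset.antisymm
    · exact iUnion_subset fun i =>
        subset_iUnion (fun j => segment ℝ (v j) (v (j + 1))) i.val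
    · refine iUnion_subset fun j => ?_
      have h1 := subset_iUnion (fun i => (Γ.piece i).carrier) ⟨j % m, Nat.mod_lt j hm⟩
      have e : v (j % m + 1) = v (j + 1) := by
        rw [← hvp.map_mod_nat (j % m + 1), Nat.mod_add_mod, hvp.map_mod_nat]
      change segment ℝ (v (j % m)) (v (j % m + 1)) ⊆ Γ.carrier at h1
      rwa [hvp.map_mod_nat, e] at h1
  refine ⟨Γ, fun i _ => ?_, ?_, fun ε hε => ?_⟩
  · change AdjacentFacets φ (Piece.segment (v i.val) (v (i.val + 1))).normal
      (Piece.segment (v (i + 1 : Fin m)) (v ((i + 1 : Fin m).val + 1))).normal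
    rw [hnormal, hnormal, hnextν]
    exact h.adj i.val
  · refine isCompact_iUnion fun i => ?_
    change IsCompact (segment ℝ _ _)
    rw [segment_eq_image']
    exact isCompact_Icc.image (by fun_prop)
  · have hclose : ∀ᶠ t in l, ∀ j ∈ Finset.range m, dist (V j t) (v j) ≤ ε := by
      rw [Filter.eventually_all_finset]
      intro j _
      have := tendsto_iff_dist_tendsto_zero.1 (hv j)
      exact this.eventually_le_const hε
    filter_upwards [hclose] with t ht
    have ht' : ∀ j, dist (V j t) (v j) ≤ ε := by
      intro j
      have := ht (j % m) (Finset.mem_range.2 (Nat.mod_lt j hm))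
      rwa [h.periodic_V.map_mod_nat, hvp.map_mod_nat] at this
    rw [hcar]
    constructor
    · intro x hx
      obtain ⟨j, hj⟩ := mem_iUnion.1 hx
      obtain ⟨y, hy, hxy⟩ := exists_mem_segment_dist_le (ht' j) (ht' (j + 1)) hj
      exact ⟨y, mem_iUnion.2 ⟨j, hy⟩, hxy⟩
    · intro y hy
      obtain ⟨j, hj⟩ := mem_iUnion.1 hy
      obtain ⟨x, hx, hxy⟩ := exists_mem_segment_dist_le (a' := V j t) (b' := V (j + 1) t) (ε := ε)
        (by rw [dist_comm]; exact ht' j) (by rw [dist_comm]; exact ht' (j + 1)) hj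
      exact ⟨x, mem_iUnion.2 ⟨j, hx⟩, by rwa [dist_comm]⟩

/-- A chain that does not collapse altogether converges to an admissible closed curve. -/
theorem exists_limit (hφ : IsAnisotropy φ) [l.NeBot] (m : ℕ) (hm : 0 < m) (ν : ℕ → Plane)
    (V : ℕ → ℝ → Plane) (ℓ : ℕ → ℝ → ℝ) (h : Chain φ l m ν V ℓ)
    (hs : ∃ j, ¬ Tendsto (ℓ j) l (𝓝 0)) :
    ∃ (m' : ℕ) (_ : NeZero m') (Γ : PolygonalCurve m'), Γ.Admissible φ ∧ IsCompact Γ.carrier ∧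
      ∀ ε > 0, ∀ᶠ t in l, HausdorffClose ε (chainCarrier fun j => V j t) Γ.carrier := by
  induction m using Nat.strong_induction_on generalizing ν V ℓ with
  | _ m ih =>
  by_cases hall : ∀ j, ¬ Tendsto (ℓ j) l (𝓝 0)
  · have : NeZero m := ⟨hm.ne'⟩
    obtain ⟨Γ, hΓ⟩ := h.exists_limit_of_stable hφ hall
    exact ⟨m, this, Γ, hΓ⟩
  push Not at hall
  obtain ⟨k, hk⟩ := hall
  obtain ⟨i, hi⟩ := hs
  -- Rotate the indices so that the collapsed edge becomes the last one.
  have h' := h.rotate (k + 1)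
  have hk' : Tendsto (ℓ (m - 1 + (k + 1))) l (𝓝 0) := by
    rw [show m - 1 + (k + 1) = k + m by omega, h.periodic_ℓ]; exact hk
  have hi' : ∃ j, ¬ Tendsto (ℓ (j + (k + 1))) l (𝓝 0) := by
    refine ⟨i + ((k + 1) * m - (k + 1)), ?_⟩
    have := Nat.le_mul_of_pos_right (k + 1) hm
    rw [show i + ((k + 1) * m - (k + 1)) + (k + 1) = i + (k + 1) * m by omega]
    have e : ℓ (i + (k + 1) * m) = ℓ i := by simpa using h.periodic_ℓ.nat_mul (k + 1) i
    rwa [e]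
  rcases (show m = 1 ∨ m = 2 ∨ ∃ p, 0 < p ∧ m = p + 2 from by
    rcases m with _ | _ | _ | p
    · omega
    · simp
    · simp
    · exact Or.inr (Or.inr ⟨p + 1, by omega, rfl⟩)) with rfl | rfl | ⟨p, hp, rfl⟩
  -- A single edge would be adjacent to itself.
  · exact absurd (h.periodic_ν 0).symm (h.adj 0).2.2.1
  · -- A closed chain of two edges collapses altogether.
    exfalso
    obtain ⟨j, hj⟩ := hi'
    have c1 : Tendsto (ℓ (1 + (k + 1))) l (𝓝 0) := hk'
    have c0 : Tendsto (ℓ (0 + (k + 1))) l (𝓝 0) := by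
      refine h'.collapsed_of_tendsto_sub (j := 0) ?_
      have := (h'.tendsto_sub_of_collapsed (j := 1) c1).neg
      rw [neg_zero] at this
      refine this.congr fun t => ?_
      have e : V (1 + 1 + (k + 1)) = V (0 + (k + 1)) := h'.periodic_V 0
      simp only [e, zero_add]
      abel
    apply hj
    have e := h'.periodic_ℓ.map_mod_nat j
    rw [← e]
    rcases Nat.mod_two_eq_zero_or_one j with h2 | h2 <;> rw [h2] <;> assumption
  · have hk'' : Tendsto (ℓ (p + 1 + (k + 1))) l (𝓝 0) := hk'
    obtain ⟨m', hm', Γ, h1, h2, h3⟩ := ih p (by omega) hp _ _ _ (h'.merge hp hk'')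
      (h'.exists_not_collapsed_merge hp hk'' hi')
    refine ⟨m', hm', Γ, h1, h2, fun ε hε => ?_⟩
    filter_upwards [h3 (ε / 2) (by positivity),
      h'.hausdorffClose_merge hp hk'' (show 0 < ε / 2 by positivity)] with t a b
    have := b.trans a
    rw [add_halves] at this
    have e := chainCarrier_rotate (V := fun j => V j t) (m := p + 2)
      (fun j => by simp only [h.periodic_V j]) hm (k + 1)
    rwa [e] at this

end Chain

end Crystalline

namespace Crystalline
open PolygonalCurve

/-! ### A priori estimates for closed curves -/

/-- A function on an interval that is bounded below and whose derivative is bounded above has a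
limit at the right endpoint. -/
lemma exists_tendsto_of_deriv_le {f f' : ℝ → ℝ} {a T C b : ℝ} (haT : a < T)
    (hf : ∀ t ∈ Ioo a T, HasDerivAt f (f' t) t) (hC : ∀ t ∈ Ioo a T, f' t ≤ C)
    (hb : ∀ t ∈ Ioo a T, b ≤ f t) : ∃ x, Tendsto f (𝓝[<] T) (𝓝 x) := by
  have hg : ∀ t ∈ Ioo a T, HasDerivAt (fun t => C * t - f t) (C - f' t) t := fun t ht => by
    simpa using ((hasDerivAt_id t).const_mul C).fun_sub (hf t ht)
  have hmono : MonotoneOn (fun t => C * t - f t) (Ioo a T) := by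
    refine monotoneOn_of_deriv_nonneg (convex_Ioo a T)
      (fun t ht => (hg t ht).continuousAt.continuousWithinAt) ?_ ?_ <;> rw [interior_Ioo]
    · exact fun t ht => (hg t ht).differentiableAt.differentiableWithinAt
    · intro t ht
      rw [(hg t ht).deriv]
      linarith [hC t ht]
  have hbdd : BddAbove ((fun t => C * t - f t) '' Ioo a T) := by
    refine ⟨|C| * max |a| |T| - b, ?_⟩
    rintro _ ⟨t, ht, rfl⟩
    have h1 : C * t ≤ |C| * max |a| |T| := by
      refine (le_abs_self _).trans ?_
      rw [abs_mul]
      gcongr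
      exact abs_le_max_abs_abs ht.1.le ht.2.le
    simp only
    linarith [hb t ht]
  have hlim := hmono.tendsto_nhdsWithin_Ioo_left (nonempty_Ioo.2 haT) hbdd
  have hid : Tendsto (fun t : ℝ => C * t) (𝓝[<] T) (𝓝 (C * T)) :=
    ((continuous_const.mul continuous_id).tendsto T).mono_left nhdsWithin_le_nhds
  exact ⟨_, (hid.sub hlim).congr fun t => by ring⟩

/-- A function with bounded derivative on an interval has a limit at the right endpoint. -/
lemma exists_tendsto_of_abs_deriv_le {f f' : ℝ → ℝ} {a T C : ℝ} (haT : a < T)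
    (hf : ∀ t ∈ Ioo a T, HasDerivAt f (f' t) t) (hC : ∀ t ∈ Ioo a T, |f' t| ≤ C) :
    ∃ x, Tendsto f (𝓝[<] T) (𝓝 x) := by
  obtain ⟨c, hac, hcT⟩ := exists_between haT
  have hsub : Ioo c T ⊆ Ioo a T := Ioo_subset_Ioo_left hac.le
  refine exists_tendsto_of_deriv_le hcT (fun t ht => hf t (hsub ht))
    (fun t ht => (abs_le.1 (hC t (hsub ht))).2) (b := f c - C * (T - c)) fun t ht => ?_
  have h := (convex_Ioo a T).norm_image_sub_le_of_norm_hasDerivWithin_le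
    (fun s hs => (hf s hs).hasDerivWithinAt) (fun s hs => hC s hs) ⟨hac, hcT⟩ (hsub ht)
  rw [Real.norm_eq_abs, Real.norm_eq_abs, abs_of_pos (sub_pos.2 ht.1)] at h
  have h1 := (abs_le.1 h).1
  have h0 : 0 ≤ C := (abs_nonneg _).trans (hC c ⟨hac, hcT⟩)
  nlinarith [ht.2]

variable {n : ℕ} [NeZero n] {φ : Plane → ℝ} {α : ℝ} {Γ₀ : PolygonalCurve n} {T : ℝ}
  {y : ℝ → Fin n → ℝ}

namespace PolygonalCurve

lemma Admissible.sin_θ_ne_zero (hφ : IsAnisotropy φ) (h : Γ₀.Admissible φ) {i : Fin n}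
    (hi : ¬ (Γ₀.piece i).IsHalfLine) : Real.sin (Γ₀.θ i) ≠ 0 := by
  rw [sin_θ]
  exact (h.transversal hφ).det_ne_zero (start_ne_none hi)

/-- If a segment has zero curvature then the curve turns in opposite directions at its endpoints, so
that its neighbours have the same normal. -/
theorem Admissible.normal_eq_of_transition_eq_zero (hφ : IsAnisotropy φ) (h : Γ₀.Admissible φ)
    {i : Fin n} (hi : ¬ (Γ₀.piece i).IsHalfLine) (hc : Γ₀.transition i = 0) :
    (Γ₀.piece (i + 1)).normal = (Γ₀.piece (i - 1)).normal := by
  have h1 := h (i - 1)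
  have h2 := h i (finish_ne_none hi)
  rw [sub_add_cancel, finish_eq] at h1
  replace h1 := h1 (start_ne_none hi)
  have d1 := h1.det_ne_zero hφ
  have d2 := h2.det_ne_zero hφ
  have n0 := Γ₀.nondegenerate (i - 1)
  have n1 := Γ₀.nondegenerate i
  have n2 := Γ₀.nondegenerate (i + 1)
  have e : Γ₀.θ (i + 1) = (Γ₀.piece i).angle (Γ₀.piece (i + 1)) := by
    rw [θ, add_sub_cancel_right]
  refine h2.eq_of_det_mul_pos hφ h1.symm ?_
  rw [det_swap (Γ₀.piece (i - 1)).normal]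
  rw [Piece.det_normal] at d1 d2 ⊢
  rw [Piece.det_normal]
  rcases lt_or_gt_of_ne d1 with s1 | s1 <;> rcases lt_or_gt_of_ne d2 with s2 | s2
  · have a1 := Piece.pi_lt_angle n0 n1 s1
    have a2 := Piece.pi_lt_angle n1 n2 s2
    rw [← e] at a2
    rw [transition, if_neg hi, if_pos ⟨a1, a2⟩] at hc
    exact absurd hc one_ne_zero
  · nlinarith
  · nlinarith
  · have a1 := Piece.angle_lt_pi n0 n1 s1
    have a2 := Piece.angle_lt_pi n1 n2 s2
    rw [← e] at a2
    rw [transition, if_neg hi, if_neg fun h => h.2.not_gt a2, if_pos ⟨a1, a2⟩] at hc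
    norm_num at hc

lemma Admissible.sin_θ_succ (hφ : IsAnisotropy φ) (h : Γ₀.Admissible φ)
    {i : Fin n} (hi : ¬ (Γ₀.piece i).IsHalfLine) (hc : Γ₀.transition i = 0) :
    Real.sin (Γ₀.θ (i + 1)) = -Real.sin (Γ₀.θ i) := by
  have e := rot_injective (h.normal_eq_of_transition_eq_zero hφ hi hc)
  rw [sin_θ, sin_θ, add_sub_cancel_right, e, det_swap]

lemma Admissible.cot_θ_add (hφ : IsAnisotropy φ) (h : Γ₀.Admissible φ)
    {i : Fin n} (hi : ¬ (Γ₀.piece i).IsHalfLine) (hc : Γ₀.transition i = 0) :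
    Real.cot (Γ₀.θ i) + Real.cot (Γ₀.θ (i + 1)) = 0 := by
  have e := rot_injective (h.normal_eq_of_transition_eq_zero hφ hi hc)
  rw [Real.cot_eq_cos_div_sin, Real.cot_eq_cos_div_sin, h.sin_θ_succ hφ hi hc, cos_θ, cos_θ,
    add_sub_cancel_right, e, real_inner_comm]
  ring

/-- The density of the elastic energy on the piece `i`, divided by its length. -/
def density (φ : Plane → ℝ) (Γ₀ : PolygonalCurve n) (H : Fin n → ℝ) (i : Fin n) : ℝ :=
  Γ₀.transition i ^ 2 * Γ₀.δ φ i / Γ₀.lengthOf H i ^ 2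

/-- The derivative of the elastic energy with respect to the height of the piece `i`. -/
def energyGradient (φ : Plane → ℝ) (Γ₀ : PolygonalCurve n) (H : Fin n → ℝ) (i : Fin n) : ℝ :=
  Γ₀.density φ H (i - 1) / Real.sin (Γ₀.θ i)
    + Γ₀.density φ H i * (Real.cot (Γ₀.θ i) + Real.cot (Γ₀.θ (i + 1)))
    + Γ₀.density φ H (i + 1) / Real.sin (Γ₀.θ (i + 1))

/-- The elastic energy `∑ cᵢ² δᵢ / ℓᵢ`. -/
def elasticEnergy (φ : Plane → ℝ) (Γ₀ : PolygonalCurve n) (H : Fin n → ℝ) : ℝ :=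
  ∑ i, Γ₀.transition i ^ 2 * Γ₀.δ φ i / Γ₀.lengthOf H i

lemma velocity_eq_energyGradient (hcl : ∀ i, ¬ (Γ₀.piece i).IsHalfLine) (H : Fin n → ℝ)
    (i : Fin n) : Γ₀.velocity φ α H i = dual φ (Γ₀.piece i).normal *
      (-(Γ₀.transition i * facetLength φ (Γ₀.piece i).normal)
        - α * Γ₀.energyGradient φ H i) / Γ₀.lengthOf H i := by
  rw [velocity, if_neg (hcl i), force, energyGradient, density, density, density]
  simp only [div_eq_mul_inv, mul_inv]
  ring

lemma lengthOf_eq (hcl : ∀ i, ¬ (Γ₀.piece i).IsHalfLine) (H : Fin n → ℝ) (i : Fin n) :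
    Γ₀.lengthOf H i = -(H (i - 1) / Real.sin (Γ₀.θ i)
      + H i * (Real.cot (Γ₀.θ i) + Real.cot (Γ₀.θ (i + 1)))
      + H (i + 1) / Real.sin (Γ₀.θ (i + 1))) := by
  rw [lengthOf, if_neg (hcl i)]

lemma dual_normal_pos (hφ : IsAnisotropy φ) (Γ : PolygonalCurve n) (i : Fin n) :
    0 < dual φ (Γ.piece i).normal := hφ.dual_pos (Piece.norm_normal (Γ.nondegenerate i))

lemma δ_nonneg (hφ : IsAnisotropy φ) (Γ : PolygonalCurve n) (i : Fin n) : 0 ≤ Γ.δ φ i :=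
  mul_nonneg (sq_nonneg _) (dual_normal_pos hφ Γ i).le

lemma Admissible.δ_pos (hφ : IsAnisotropy φ) (h : Γ₀.Admissible φ) {i : Fin n}
    (hi : ¬ (Γ₀.piece i).IsHalfLine) : 0 < Γ₀.δ φ i :=
  mul_pos (pow_pos (hφ.facetLength_pos (h i (finish_ne_none hi)).1) 2) (dual_normal_pos hφ Γ₀ i)

lemma sum_density_mul_lengthOf (hcl : ∀ i, ¬ (Γ₀.piece i).IsHalfLine) (H v : Fin n → ℝ) :
    ∑ i, -(Γ₀.density φ H i) * Γ₀.lengthOf v i = ∑ i, v i * Γ₀.energyGradient φ H i := by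
  have e1 : ∑ i, Γ₀.density φ H i * v (i - 1) / Real.sin (Γ₀.θ i)
      = ∑ i, Γ₀.density φ H (i + 1) * v i / Real.sin (Γ₀.θ (i + 1)) := by
    rw [← Equiv.sum_comp (Equiv.addRight (1 : Fin n))]
    simp
  have e2 : ∑ i, Γ₀.density φ H (i - 1) * v i / Real.sin (Γ₀.θ i)
      = ∑ i, Γ₀.density φ H i * v (i + 1) / Real.sin (Γ₀.θ (i + 1)) := by
    rw [← Equiv.sum_comp (Equiv.addRight (1 : Fin n))]
    simp
  calc _ = ∑ i, (Γ₀.density φ H i * v (i - 1) / Real.sin (Γ₀.θ i)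
        + v i * (Γ₀.density φ H i * (Real.cot (Γ₀.θ i) + Real.cot (Γ₀.θ (i + 1))))
        + Γ₀.density φ H i * v (i + 1) / Real.sin (Γ₀.θ (i + 1))) :=
      Finset.sum_congr rfl fun i _ => by rw [lengthOf_eq hcl]; ring
    _ = ∑ i, (Γ₀.density φ H (i + 1) * v i / Real.sin (Γ₀.θ (i + 1))
        + v i * (Γ₀.density φ H i * (Real.cot (Γ₀.θ i) + Real.cot (Γ₀.θ (i + 1))))
        + Γ₀.density φ H (i - 1) * v i / Real.sin (Γ₀.θ i)) := by
      simp only [Finset.sum_add_distrib, e1, e2]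
    _ = _ := Finset.sum_congr rfl fun i _ => by rw [energyGradient]; ring

/-- The flow is the gradient flow of length plus elastic energy with respect to a weighted metric.
Completing the square shows that the elastic energy alone grows at most exponentially. -/
lemma sum_velocity_mul_energyGradient_le (hφ : IsAnisotropy φ) (hα : 0 < α)
    (hcl : ∀ i, ¬ (Γ₀.piece i).IsHalfLine) {H : Fin n → ℝ} (hH : H ∈ Γ₀.region) :
    ∑ i, Γ₀.velocity φ α H i * Γ₀.energyGradient φ H i ≤ Γ₀.elasticEnergy φ H / (4 * α) := by
  rw [elasticEnergy, Finset.sum_div]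
  refine Finset.sum_le_sum fun i _ => ?_
  have hL := hH i
  have hd := dual_normal_pos hφ Γ₀ i
  rw [velocity_eq_energyGradient hcl, δ]
  set G := Γ₀.energyGradient φ H i
  set c := Γ₀.transition i
  set F := facetLength φ (Γ₀.piece i).normal
  set d := dual φ (Γ₀.piece i).normal
  set L := Γ₀.lengthOf H i
  have : c ^ 2 * (F ^ 2 * d) / L / (4 * α) - d * (-(c * F) - α * G) / L * G
      = d / (4 * α * L) * (c * F + 2 * α * G) ^ 2 := by
    field_simp; ring
  have : 0 ≤ d / (4 * α * L) * (c * F + 2 * α * G) ^ 2 := by positivity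
  linarith

end PolygonalCurve

namespace IsSolution

lemma hasDerivAt_apply (h : IsSolution (Γ₀.velocity φ α) Γ₀.region Γ₀.offset (T : ℝ) y)
    {t : ℝ} (ht : t ∈ Ioo 0 T) (i : Fin n) :
    HasDerivAt (fun t => y t i) (Γ₀.velocity φ α (y t) i) t :=
  hasDerivAt_pi.1 (h.hasDerivAt t ht.1 (EReal.coe_lt_coe_iff.2 ht.2)) i

lemma lengthOf_pos (h : IsSolution (Γ₀.velocity φ α) Γ₀.region Γ₀.offset (T : ℝ) y)
    {t : ℝ} (ht : t ∈ Ico 0 T) (i : Fin n) : 0 < Γ₀.lengthOf (y t) i :=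
  h.mem t ht.1 (EReal.coe_lt_coe_iff.2 ht.2) i

lemma continuousOn_Ico (h : IsSolution (Γ₀.velocity φ α) Γ₀.region Γ₀.offset (T : ℝ) y) :
    ContinuousOn y (Ico 0 T) :=
  h.continuousOn.mono fun _ ht => ⟨ht.1, EReal.coe_lt_coe_iff.2 ht.2⟩

lemma hasDerivAt_lengthOf (h : IsSolution (Γ₀.velocity φ α) Γ₀.region Γ₀.offset (T : ℝ) y)
    (hcl : ∀ i, ¬ (Γ₀.piece i).IsHalfLine) {t : ℝ} (ht : t ∈ Ioo 0 T) (i : Fin n) :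
    HasDerivAt (fun t => Γ₀.lengthOf (y t) i) (Γ₀.lengthOf (Γ₀.velocity φ α (y t)) i) t := by
  simp only [lengthOf_eq hcl]
  exact ((((h.hasDerivAt_apply ht (i - 1)).div_const _).add
    ((h.hasDerivAt_apply ht i).mul_const _)).add
    ((h.hasDerivAt_apply ht (i + 1)).div_const _)).neg

/-- Grönwall's inequality for the elastic energy. -/
lemma elasticEnergy_le (hφ : IsAnisotropy φ) (hα : 0 < α)
    (h : IsSolution (Γ₀.velocity φ α) Γ₀.region Γ₀.offset (T : ℝ) y)
    (hcl : ∀ i, ¬ (Γ₀.piece i).IsHalfLine) {t : ℝ} (ht : t ∈ Ico 0 T) :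
    Γ₀.elasticEnergy φ (y t) ≤ Γ₀.elasticEnergy φ Γ₀.offset * Real.exp (t / (4 * α)) := by
  have hd : ∀ s ∈ Ioo 0 T, HasDerivAt (fun s => Γ₀.elasticEnergy φ (y s))
      (∑ i, Γ₀.velocity φ α (y s) i * Γ₀.energyGradient φ (y s) i) s := by
    intro s hs
    rw [← sum_density_mul_lengthOf hcl]
    refine HasDerivAt.fun_sum fun i _ => ?_
    have := ((h.hasDerivAt_lengthOf hcl hs i).inv
      (h.lengthOf_pos ⟨hs.1.le, hs.2⟩ i).ne').const_mul (Γ₀.transition i ^ 2 * Γ₀.δ φ i)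
    simp only [← div_eq_mul_inv, Pi.inv_apply] at this
    refine this.congr_deriv ?_
    rw [density]; ring
  have hd' : ∀ s ∈ Ioo 0 T, HasDerivAt
      (fun s => Γ₀.elasticEnergy φ (y s) * Real.exp (-(s / (4 * α))))
      ((∑ i, Γ₀.velocity φ α (y s) i * Γ₀.energyGradient φ (y s) i) * Real.exp (-(s / (4 * α)))
        + Γ₀.elasticEnergy φ (y s) * (Real.exp (-(s / (4 * α))) * -(1 / (4 * α)))) s :=
    fun s hs => (hd s hs).mul ((((hasDerivAt_id s).div_const _).neg).exp)
  have hanti : AntitoneOn (fun s => Γ₀.elasticEnergy φ (y s) * Real.exp (-(s / (4 * α))))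
      (Ico 0 T) := by
    refine antitoneOn_of_deriv_nonpos (convex_Ico 0 T) ?_ ?_ ?_
    · refine ContinuousOn.mul ?_ (by fun_prop)
      refine continuousOn_finsetSum _ fun i _ => ?_
      refine continuousOn_const.div ((Γ₀.continuous_lengthOf i).comp_continuousOn
        h.continuousOn_Ico) fun s hs => (h.lengthOf_pos hs i).ne'
    · rw [interior_Ico]
      exact fun s hs => (hd' s hs).differentiableAt.differentiableWithinAt
    · rw [interior_Ico]
      intro s hs
      rw [(hd' s hs).deriv]
      have := sum_velocity_mul_energyGradient_le hφ hα hcl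
        (h.mem s hs.1.le (EReal.coe_lt_coe_iff.2 hs.2))
      have e := Real.exp_pos (-(s / (4 * α)))
      have e2 : (∑ i, Γ₀.velocity φ α (y s) i * Γ₀.energyGradient φ (y s) i)
          * Real.exp (-(s / (4 * α)))
          + Γ₀.elasticEnergy φ (y s) * (Real.exp (-(s / (4 * α))) * -(1 / (4 * α)))
        = ((∑ i, Γ₀.velocity φ α (y s) i * Γ₀.energyGradient φ (y s) i)
          - Γ₀.elasticEnergy φ (y s) / (4 * α)) * Real.exp (-(s / (4 * α))) := by ring
      rw [e2]
      exact mul_nonpos_of_nonpos_of_nonneg (by linarith) e.le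
  have := hanti ⟨le_rfl, ht.1.trans_lt ht.2⟩ ht ht.1
  simp only [zero_div, neg_zero, Real.exp_zero, mul_one, h.initial] at this
  rw [Real.exp_neg, ← div_eq_mul_inv, div_le_iff₀ (Real.exp_pos _)] at this
  exact this

/-- Segments with nonzero curvature do not shrink to a point in finite time. -/
theorem exists_le_lengthOf (hφ : IsAnisotropy φ) (hα : 0 < α) (hΓ₀ : Γ₀.Admissible φ)
    (h : IsSolution (Γ₀.velocity φ α) Γ₀.region Γ₀.offset (T : ℝ) y)
    (hcl : ∀ i, ¬ (Γ₀.piece i).IsHalfLine) {i : Fin n} (hc : Γ₀.transition i ≠ 0) :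
    ∃ ε > 0, ∀ t ∈ Ico 0 T, ε ≤ Γ₀.lengthOf (y t) i := by
  have hδ := hΓ₀.δ_pos hφ (hcl i)
  have hq : 0 < Γ₀.transition i ^ 2 * Γ₀.δ φ i := by positivity
  have hle : ∀ H ∈ Γ₀.region, Γ₀.transition i ^ 2 * Γ₀.δ φ i / Γ₀.lengthOf H i
      ≤ Γ₀.elasticEnergy φ H := fun H hH =>
    Finset.single_le_sum (f := fun i => Γ₀.transition i ^ 2 * Γ₀.δ φ i / Γ₀.lengthOf H i)
      (fun j _ => div_nonneg (mul_nonneg (sq_nonneg _) (δ_nonneg hφ Γ₀ j)) (hH j).le)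
      (Finset.mem_univ i)
  have hreg := (Parallel.refl Γ₀).offset_mem_region (hΓ₀.transversal hφ)
  have hE : 0 < Γ₀.elasticEnergy φ Γ₀.offset := (div_pos hq (hreg i)).trans_le (hle _ hreg)
  refine ⟨Γ₀.transition i ^ 2 * Γ₀.δ φ i / (Γ₀.elasticEnergy φ Γ₀.offset
    * Real.exp (T / (4 * α))), by positivity, fun t ht => ?_⟩
  rw [div_le_iff₀ (by positivity), ← div_le_iff₀' (h.lengthOf_pos ht i)]
  refine (hle _ (h.mem t ht.1 (EReal.coe_lt_coe_iff.2 ht.2))).trans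
    ((h.elasticEnergy_le hφ hα hcl ht).trans ?_)
  gcongr
  exact ht.2.le

lemma exists_density_le (hφ : IsAnisotropy φ) (hα : 0 < α) (hΓ₀ : Γ₀.Admissible φ)
    (h : IsSolution (Γ₀.velocity φ α) Γ₀.region Γ₀.offset (T : ℝ) y)
    (hcl : ∀ i, ¬ (Γ₀.piece i).IsHalfLine) (i : Fin n) :
    ∃ M, ∀ t ∈ Ico 0 T, |Γ₀.density φ (y t) i| ≤ M := by
  by_cases hc : Γ₀.transition i = 0
  · exact ⟨0, fun t _ => by simp [density, hc]⟩
  · obtain ⟨ε, hε, hle⟩ := h.exists_le_lengthOf hφ hα hΓ₀ hcl hc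
    refine ⟨Γ₀.transition i ^ 2 * Γ₀.δ φ i / ε ^ 2, fun t ht => ?_⟩
    have h1 : 0 ≤ Γ₀.transition i ^ 2 * Γ₀.δ φ i := mul_nonneg (sq_nonneg _) (δ_nonneg hφ Γ₀ i)
    rw [density, abs_of_nonneg (div_nonneg h1 (sq_nonneg _))]
    gcongr
    exact hle t ht

/-- The speed of a segment is bounded as long as its length is bounded below. -/
lemma exists_abs_velocity_le (hφ : IsAnisotropy φ) (hα : 0 < α) (hΓ₀ : Γ₀.Admissible φ)
    (h : IsSolution (Γ₀.velocity φ α) Γ₀.region Γ₀.offset (T : ℝ) y)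
    (hcl : ∀ i, ¬ (Γ₀.piece i).IsHalfLine) (i : Fin n) {ε : ℝ} (hε : 0 < ε) :
    ∃ M, ∀ t ∈ Ico 0 T, ε ≤ Γ₀.lengthOf (y t) i → |Γ₀.velocity φ α (y t) i| ≤ M := by
  obtain ⟨M₁, h₁⟩ := h.exists_density_le hφ hα hΓ₀ hcl (i - 1)
  obtain ⟨M₂, h₂⟩ := h.exists_density_le hφ hα hΓ₀ hcl i
  obtain ⟨M₃, h₃⟩ := h.exists_density_le hφ hα hΓ₀ hcl (i + 1)
  have hd := dual_normal_pos hφ Γ₀ i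
  refine ⟨dual φ (Γ₀.piece i).normal * (|Γ₀.transition i * facetLength φ (Γ₀.piece i).normal|
    + α * (M₁ / |Real.sin (Γ₀.θ i)| + M₂ * |Real.cot (Γ₀.θ i) + Real.cot (Γ₀.θ (i + 1))|
      + M₃ / |Real.sin (Γ₀.θ (i + 1))|)) / ε, fun t ht hle => ?_⟩
  have hG : |Γ₀.energyGradient φ (y t) i| ≤ M₁ / |Real.sin (Γ₀.θ i)|
      + M₂ * |Real.cot (Γ₀.θ i) + Real.cot (Γ₀.θ (i + 1))| + M₃ / |Real.sin (Γ₀.θ (i + 1))| := by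
    rw [energyGradient]
    refine (abs_add_three _ _ _).trans ?_
    rw [abs_div, abs_mul, abs_div]
    gcongr
    · exact h₁ t ht
    · exact h₂ t ht
    · exact h₃ t ht
  have hL := h.lengthOf_pos ht i
  rw [velocity_eq_energyGradient hcl, abs_div, abs_mul, abs_of_pos hd, abs_of_pos hL]
  have hN : |-(Γ₀.transition i * facetLength φ (Γ₀.piece i).normal)
      - α * Γ₀.energyGradient φ (y t) i| ≤
      |Γ₀.transition i * facetLength φ (Γ₀.piece i).normal|
    + α * (M₁ / |Real.sin (Γ₀.θ i)| + M₂ * |Real.cot (Γ₀.θ i) + Real.cot (Γ₀.θ (i + 1))|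
      + M₃ / |Real.sin (Γ₀.θ (i + 1))|) := by
    refine (abs_sub _ _).trans ?_
    rw [abs_neg, abs_mul α, abs_of_pos hα]
    gcongr
  have := (abs_nonneg _).trans hN
  gcongr

/-- The length of a segment with zero curvature grows at most at bounded speed. Indeed, neighbours
with nonzero curvature have bounded speed, and those with zero curvature move in the direction that
shortens the segment. -/
lemma exists_deriv_lengthOf_le (hφ : IsAnisotropy φ) (hα : 0 < α) (hΓ₀ : Γ₀.Admissible φ)
    (h : IsSolution (Γ₀.velocity φ α) Γ₀.region Γ₀.offset (T : ℝ) y)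
    (hcl : ∀ i, ¬ (Γ₀.piece i).IsHalfLine) {i : Fin n} (hc : Γ₀.transition i = 0) :
    ∃ C, ∀ t ∈ Ico 0 T, Γ₀.lengthOf (Γ₀.velocity φ α (y t)) i ≤ C := by
  have bound : ∀ (j : Fin n) (s : ℝ), s ≠ 0 → (Γ₀.transition j = 0 →
      ∀ t ∈ Ico 0 T, 0 ≤ Γ₀.velocity φ α (y t) j / s) →
      ∃ C, ∀ t ∈ Ico 0 T, -(Γ₀.velocity φ α (y t) j / s) ≤ C := by
    intro j s hs hj
    by_cases hcj : Γ₀.transition j = 0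
    · exact ⟨0, fun t ht => by linarith [hj hcj t ht]⟩
    · obtain ⟨ε, hε, hle⟩ := h.exists_le_lengthOf hφ hα hΓ₀ hcl hcj
      obtain ⟨M, hM⟩ := h.exists_abs_velocity_le hφ hα hΓ₀ hcl j hε
      refine ⟨M / |s|, fun t ht => (neg_le_abs _).trans ?_⟩
      rw [abs_div]
      gcongr
      exact hM t ht (hle t ht)
  have hgi : ∀ t, Γ₀.density φ (y t) i = 0 := fun t => by simp [density, hc]
  have hρ : ∀ j, ∀ t, 0 ≤ Γ₀.density φ (y t) j := fun j t =>
    div_nonneg (mul_nonneg (sq_nonneg _) (δ_nonneg hφ Γ₀ j)) (sq_nonneg _)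
  obtain ⟨C₁, h₁⟩ := bound (i - 1) _ (hΓ₀.sin_θ_ne_zero hφ (hcl i)) fun hcj t ht => by
    have hs := hΓ₀.sin_θ_succ hφ (hcl (i - 1)) hcj
    have hk := hΓ₀.cot_θ_add hφ (hcl (i - 1)) hcj
    have hL := h.lengthOf_pos ht (i - 1)
    have hd := dual_normal_pos hφ Γ₀ (i - 1)
    have hr := hρ (i - 1 - 1) t
    rw [sub_add_cancel] at hs
    rw [velocity_eq_energyGradient hcl, energyGradient, hk, hcj, sub_add_cancel, hgi,
      ← neg_eq_iff_eq_neg.2 hs]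
    have := hΓ₀.sin_θ_ne_zero hφ (hcl i)
    have e : dual φ (Γ₀.piece (i - 1)).normal *
        (-(0 * facetLength φ (Γ₀.piece (i - 1)).normal) -
          α * (Γ₀.density φ (y t) (i - 1 - 1) / -Real.sin (Γ₀.θ i)
            + Γ₀.density φ (y t) (i - 1) * 0 + 0 / Real.sin (Γ₀.θ i))) /
        Γ₀.lengthOf (y t) (i - 1) / Real.sin (Γ₀.θ i)
        = dual φ (Γ₀.piece (i - 1)).normal * α * Γ₀.density φ (y t) (i - 1 - 1)
          / (Γ₀.lengthOf (y t) (i - 1) * Real.sin (Γ₀.θ i) ^ 2) := by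
      field_simp
      ring
    rw [e]
    positivity
  obtain ⟨C₂, h₂⟩ := bound (i + 1) _ (by
      have := hΓ₀.sin_θ_ne_zero hφ (hcl (i + 1)); exact this) fun hcj t ht => by
    have hs := hΓ₀.sin_θ_succ hφ (hcl (i + 1)) hcj
    have hk := hΓ₀.cot_θ_add hφ (hcl (i + 1)) hcj
    have hL := h.lengthOf_pos ht (i + 1)
    have hd := dual_normal_pos hφ Γ₀ (i + 1)
    have hr := hρ (i + 1 + 1) t
    rw [velocity_eq_energyGradient hcl, energyGradient, hk, hcj, add_sub_cancel_right, hgi, hs]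
    have := hΓ₀.sin_θ_ne_zero hφ (hcl (i + 1))
    have e : dual φ (Γ₀.piece (i + 1)).normal *
        (-(0 * facetLength φ (Γ₀.piece (i + 1)).normal) -
          α * (0 / Real.sin (Γ₀.θ (i + 1)) + Γ₀.density φ (y t) (i + 1) * 0
            + Γ₀.density φ (y t) (i + 1 + 1) / -Real.sin (Γ₀.θ (i + 1)))) /
        Γ₀.lengthOf (y t) (i + 1) / Real.sin (Γ₀.θ (i + 1))
        = dual φ (Γ₀.piece (i + 1)).normal * α * Γ₀.density φ (y t) (i + 1 + 1)
          / (Γ₀.lengthOf (y t) (i + 1) * Real.sin (Γ₀.θ (i + 1)) ^ 2) := by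
      field_simp
      ring
    rw [e]
    positivity
  refine ⟨C₁ + C₂, fun t ht => ?_⟩
  rw [lengthOf_eq hcl, hΓ₀.cot_θ_add hφ (hcl i) hc]
  linarith [h₁ t ht, h₂ t ht]

/-- At a finite time, each segment either collapses, and then it has zero curvature, or it is
stable. -/
theorem collapsed_or_stable (hφ : IsAnisotropy φ) (hα : 0 < α) (hΓ₀ : Γ₀.Admissible φ) (hT : 0 < T)
    (h : IsSolution (Γ₀.velocity φ α) Γ₀.region Γ₀.offset (T : ℝ) y)
    (hcl : ∀ i, ¬ (Γ₀.piece i).IsHalfLine) (i : Fin n) :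
    (Γ₀.transition i = 0 ∧ Tendsto (fun t => Γ₀.lengthOf (y t) i) (𝓝[<] T) (𝓝 0)) ∨
    ((∃ ε > 0, ∀ᶠ t in 𝓝[<] T, ε ≤ Γ₀.lengthOf (y t) i) ∧
      ∃ x, Tendsto (fun t => y t i) (𝓝[<] T) (𝓝 x)) := by
  have stable : ∀ ε > 0, ∀ a, a < T → 0 ≤ a → (∀ t ∈ Ioo a T, ε ≤ Γ₀.lengthOf (y t) i) →
      ((∃ ε > 0, ∀ᶠ t in 𝓝[<] T, ε ≤ Γ₀.lengthOf (y t) i) ∧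
      ∃ x, Tendsto (fun t => y t i) (𝓝[<] T) (𝓝 x)) := by
    intro ε hε a haT ha hle
    obtain ⟨M, hM⟩ := h.exists_abs_velocity_le hφ hα hΓ₀ hcl i hε
    refine ⟨⟨ε, hε, ?_⟩, ?_⟩
    · filter_upwards [Ioo_mem_nhdsLT haT] with t ht using hle t ht
    · exact exists_tendsto_of_abs_deriv_le haT
        (fun t ht => h.hasDerivAt_apply ⟨ha.trans_lt ht.1, ht.2⟩ i)
        fun t ht => hM t ⟨ha.trans ht.1.le, ht.2⟩ (hle t ht)
  by_cases hc : Γ₀.transition i = 0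
  · obtain ⟨C, hC⟩ := h.exists_deriv_lengthOf_le hφ hα hΓ₀ hcl hc
    obtain ⟨x, hx⟩ := exists_tendsto_of_deriv_le hT (fun t ht => h.hasDerivAt_lengthOf hcl ht i)
      (fun t ht => hC t ⟨ht.1.le, ht.2⟩) (b := 0) fun t ht => (h.lengthOf_pos ⟨ht.1.le, ht.2⟩ i).le
    have hx0 : 0 ≤ x := by
      refine ge_of_tendsto hx ?_
      filter_upwards [Ioo_mem_nhdsLT hT] with t ht
      exact (h.lengthOf_pos ⟨ht.1.le, ht.2⟩ i).le
    rcases hx0.eq_or_lt with rfl | hx0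
    · exact Or.inl ⟨hc, hx⟩
    · right
      have hev := hx.eventually_const_le (half_lt_self hx0)
      obtain ⟨a, haT, ha⟩ := (mem_nhdsLT_iff_exists_Ioo_subset (a := T)).1 hev
      refine stable (x / 2) (by positivity) (max a 0) (max_lt haT hT) (le_max_right _ _) fun t ht => ?_
      exact ha ⟨(le_max_left _ _).trans_lt ht.1, ht.2⟩
  · obtain ⟨ε, hε, hle⟩ := h.exists_le_lengthOf hφ hα hΓ₀ hcl hc
    exact Or.inr (stable ε hε 0 hT le_rfl fun t ht => hle t ⟨ht.1.le, ht.2⟩)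

/-- If the maximal time is finite then some segment collapses. -/
theorem exists_collapsed (hφ : IsAnisotropy φ) (hα : 0 < α) (hΓ₀ : Γ₀.Admissible φ) (hT : 0 < T)
    (h : IsSolution (Γ₀.velocity φ α) Γ₀.region Γ₀.offset (T : ℝ) y)
    (hmax : ∀ T' z, IsSolution (Γ₀.velocity φ α) Γ₀.region Γ₀.offset T' z → T' ≤ (T : ℝ))
    (hcl : ∀ i, ¬ (Γ₀.piece i).IsHalfLine) :
    ∃ i, Γ₀.transition i = 0 ∧
      Tendsto (fun t => Γ₀.lengthOf (y t) i) (𝓝[<] T) (𝓝 0) := by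
  by_contra hno
  have hst := fun i => (h.collapsed_or_stable hφ hα hΓ₀ hT hcl i).resolve_left
    fun hi => hno ⟨i, hi⟩
  choose x hx using fun i => (hst i).2
  have hlim : Tendsto y (𝓝[<] T) (𝓝 x) := tendsto_pi_nhds.2 hx
  refine h.not_tendsto_of_maximal Γ₀.isOpen_region (contDiffOn_velocity φ α Γ₀) hT hmax
    (x := x) (fun i => ?_) hlim
  obtain ⟨ε, hε, hle⟩ := (hst i).1
  exact hε.trans_le (ge_of_tendsto (((Γ₀.continuous_lengthOf i).tendsto x).comp hlim) hle)

/-- Not all segments collapse: if all of them have zero curvature then the flow is stationary. -/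
theorem exists_not_collapsed (hφ : IsAnisotropy φ) (hα : 0 < α) (hΓ₀ : Γ₀.Admissible φ)
    (hT : 0 < T) (h : IsSolution (Γ₀.velocity φ α) Γ₀.region Γ₀.offset (T : ℝ) y)
    (hcl : ∀ i, ¬ (Γ₀.piece i).IsHalfLine) :
    ∃ i, ¬ Tendsto (fun t => Γ₀.lengthOf (y t) i) (𝓝[<] T) (𝓝 0) := by
  by_contra! hall
  have hc : ∀ i, Γ₀.transition i = 0 := by
    intro i
    rcases h.collapsed_or_stable hφ hα hΓ₀ hT hcl i with h1 | ⟨⟨ε, hε, hle⟩, -⟩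
    · exact h1.1
    · exact absurd (ge_of_tendsto (hall i) hle) (not_le.2 hε)
  have hv : ∀ H, Γ₀.velocity φ α H = 0 := fun H => by
    funext i
    simp [velocity, force, hc]
  have hconst : ∀ t ∈ Ico 0 T, y t = Γ₀.offset := by
    intro t ht
    have hT' : (t : EReal) < (T : ℝ) := EReal.coe_lt_coe_iff.2 ht.2
    rw [constant_of_has_deriv_right_zero (h.continuousOn.mono (Icc_subset_of_lt hT'))
      (fun s hs => ?_) t ⟨ht.1, le_rfl⟩, h.initial]
    have := h.hasDerivWithinAt (contDiffOn_velocity φ α Γ₀).continuousOn Γ₀.isOpen_region hs.1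
      (Icc_subset_of_lt hT' (Ico_subset_Icc_self hs)).2
    rwa [hv] at this
  have hlim : Tendsto (fun _ : ℝ => Γ₀.lengthOf Γ₀.offset 0) (𝓝[<] T) (𝓝 0) := by
    refine (hall 0).congr' ?_
    filter_upwards [Ioo_mem_nhdsLT hT] with t ht
    rw [hconst t ⟨ht.1.le, ht.2⟩]
  have := tendsto_nhds_unique hlim tendsto_const_nhds
  have hpos := (Parallel.refl Γ₀).offset_mem_region (hΓ₀.transversal hφ) 0
  linarith

end IsSolution

end Crystalline

namespace Crystalline
open PolygonalCurve

/-! ### Convergence of the curves at the maximal time -/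

lemma kuratowski_eq_of_hausdorffClose {A : ℝ → Set Plane} {B : Set Plane} {l : Filter ℝ} [l.NeBot]
    (hB : IsClosed B) (h : ∀ ε > 0, ∀ᶠ t in l, HausdorffClose ε (A t) B) :
    kuratowskiLiminf A l = B ∧ kuratowskiLimsup A l = B := by
  have h1 : B ⊆ kuratowskiLiminf A l := by
    intro x hx ε hε
    filter_upwards [h (ε / 2) (by positivity)] with t ht
    obtain ⟨a, ha, hax⟩ := ht.2 x hx
    exact ⟨a, ha, by rw [Metric.mem_ball]; linarith⟩
  have h2 : kuratowskiLiminf A l ⊆ kuratowskiLimsup A l :=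
    fun x hx ε hε => (hx ε hε).frequently
  have h3 : kuratowskiLimsup A l ⊆ B := by
    intro x hx
    rw [← hB.closure_eq, Metric.mem_closure_iff]
    intro ε hε
    obtain ⟨t, ⟨a, ha, hax⟩, ht⟩ := ((hx (ε / 2) (by positivity)).and_eventually
      (h (ε / 2) (by positivity))).exists
    obtain ⟨b, hb, hab⟩ := ht.1 a ha
    rw [Metric.mem_ball, dist_comm] at hax
    exact ⟨b, hb, by linarith [dist_triangle x a b]⟩
  exact ⟨(h2.trans h3).antisymm h1, h3.antisymm (h1.trans h2)⟩

lemma HausdorffClose.refl {ε : ℝ} (hε : 0 ≤ ε) (A : Set Plane) : HausdorffClose ε A A :=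
  ⟨fun x hx => ⟨x, hx, by simpa using hε⟩, fun x hx => ⟨x, hx, by simpa using hε⟩⟩

variable {n : ℕ} [NeZero n] {φ : Plane → ℝ} {α : ℝ} {Γ₀ : PolygonalCurve n} {T : ℝ}
  {y : ℝ → Fin n → ℝ}

namespace PolygonalCurve

/-- Bounded curves are closed: they consist of segments. -/
lemma not_isHalfLine_of_isBounded (h : Bornology.IsBounded Γ₀.carrier) (i : Fin n) :
    ¬ (Γ₀.piece i).IsHalfLine := by
  intro hi
  have hn := Γ₀.nondegenerate i
  have hb : Bornology.IsBounded (Γ₀.piece i).carrier :=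
    h.subset (subset_iUnion (fun i => (Γ₀.piece i).carrier) i)
  cases hp : Γ₀.piece i with
  | segment p q => rw [hp] at hi; exact hi
  | incoming q τ =>
    rw [hp] at hn hb
    refine not_isBounded_ray (p := q) (τ := -τ) (by rw [norm_neg]; exact hn) ?_
    simpa [ray, Piece.carrier, sub_eq_add_neg] using hb
  | outgoing p τ =>
    rw [hp] at hn hb
    exact not_isBounded_ray (p := p) (τ := τ) hn hb

lemma carrier_curveOf (ht : Γ₀.Transversal) (hcl : ∀ i, ¬ (Γ₀.piece i).IsHalfLine)
    {H : Fin n → ℝ} (hH : H ∈ Γ₀.region) :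
    (Γ₀.curveOf H).carrier = ⋃ i, segment ℝ (Γ₀.vertex H i) (Γ₀.vertex H (i + 1)) := by
  refine iUnion_congr fun i => ?_
  rw [piece_curveOf ht hH, movedPiece]
  have := hcl i
  cases hp : Γ₀.piece i with
  | segment p q => rfl
  | incoming q τ => rw [hp] at this; exact absurd trivial this
  | outgoing q τ => rw [hp] at this; exact absurd trivial this

lemma continuous_vertex (Γ₀ : PolygonalCurve n) (i : Fin n) :
    Continuous fun H => Γ₀.vertex H i := by
  simp only [vertex, lineInter]
  fun_prop

lemma hausdorffClose_carrier_curveOf (ht : Γ₀.Transversal)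
    (hcl : ∀ i, ¬ (Γ₀.piece i).IsHalfLine) {H H' : Fin n → ℝ} (hH : H ∈ Γ₀.region)
    (hH' : H' ∈ Γ₀.region) {ε : ℝ} (h : ∀ i, dist (Γ₀.vertex H i) (Γ₀.vertex H' i) ≤ ε) :
    HausdorffClose ε (Γ₀.curveOf H).carrier (Γ₀.curveOf H').carrier := by
  rw [carrier_curveOf ht hcl hH, carrier_curveOf ht hcl hH']
  constructor
  · intro x hx
    obtain ⟨i, hi⟩ := mem_iUnion.1 hx
    obtain ⟨z, hz, hxz⟩ := exists_mem_segment_dist_le (h i) (h (i + 1)) hi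
    exact ⟨z, mem_iUnion.2 ⟨i, hz⟩, hxz⟩
  · intro x hx
    obtain ⟨i, hi⟩ := mem_iUnion.1 hx
    have h' := fun i => (dist_comm _ _).trans_le (h i)
    obtain ⟨z, hz, hxz⟩ := exists_mem_segment_dist_le (h' i) (h' (i + 1)) hi
    exact ⟨z, mem_iUnion.2 ⟨i, hz⟩, by rwa [dist_comm]⟩

lemma isCompact_carrier_curveOf (ht : Γ₀.Transversal) (hcl : ∀ i, ¬ (Γ₀.piece i).IsHalfLine)
    {H : Fin n → ℝ} (hH : H ∈ Γ₀.region) : IsCompact (Γ₀.curveOf H).carrier := by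
  rw [carrier_curveOf ht hcl hH]
  refine isCompact_iUnion fun i => ?_
  rw [segment_eq_image']
  exact isCompact_Icc.image (by fun_prop)

end PolygonalCurve

namespace IsSolution

lemma mem_region (h : IsSolution (Γ₀.velocity φ α) Γ₀.region Γ₀.offset (T : ℝ) y)
    {t : ℝ} (ht : t ∈ Ico 0 T) : y t ∈ Γ₀.region :=
  h.mem t ht.1 (EReal.coe_lt_coe_iff.2 ht.2)

/-- The moving closed curve is a chain of segments in the sense of `Chain`. -/
theorem chain (hφ : IsAnisotropy φ) (hα : 0 < α) (hΓ₀ : Γ₀.Admissible φ) (hT : 0 < T)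
    (h : IsSolution (Γ₀.velocity φ α) Γ₀.region Γ₀.offset (T : ℝ) y)
    (hcl : ∀ i, ¬ (Γ₀.piece i).IsHalfLine) :
    Chain φ (𝓝[<] T) n (fun j => (Γ₀.piece (Fin.ofNat n j)).normal)
      (fun j t => Γ₀.vertex (y t) (Fin.ofNat n j))
      (fun j t => Γ₀.lengthOf (y t) (Fin.ofNat n j)) := by
  have hper : ∀ j, Fin.ofNat n (j + n) = Fin.ofNat n j := fun j => by
    ext; simp [Fin.ofNat]
  have hsucc : ∀ j, Fin.ofNat n (j + 1) = Fin.ofNat n j + 1 := fun j => by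
    ext; simp [Fin.ofNat, Fin.val_add]
  have ht := hΓ₀.transversal hφ
  have hτ : ∀ i, -rot (Γ₀.piece i).normal = (Γ₀.piece i).tangent := fun i => by
    rw [Piece.normal]; apply plane_ext <;> simp
  refine ⟨fun j => by simp only [hper], fun j => by simp only [hper], fun j => by simp only [hper],
    fun j => ?_, fun j => ?_, fun j => ?_, fun j hj => ?_, fun j => ?_⟩
  · rw [hsucc]
    exact hΓ₀ _ (finish_ne_none (hcl _))
  · filter_upwards [Ioo_mem_nhdsLT hT] with t ht
    exact (h.lengthOf_pos ⟨ht.1.le, ht.2⟩ _).le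
  · refine tendsto_const_nhds.congr fun t => ?_
    rw [hsucc, vertex_succ_sub_vertex ht _ (hcl _), hτ, sub_self]
  · have hc : Γ₀.transition (Fin.ofNat n (j + 1)) = 0 := by
      rcases h.collapsed_or_stable hφ hα hΓ₀ hT hcl (Fin.ofNat n (j + 1)) with h1 | ⟨⟨ε, hε, hle⟩, -⟩
      · exact h1.1
      · exact absurd (ge_of_tendsto hj hle) (not_le.2 hε)
    have e := hΓ₀.normal_eq_of_transition_eq_zero hφ (hcl _) hc
    rwa [← hsucc (j + 1), hsucc j, add_sub_cancel_right] at e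
  · rcases h.collapsed_or_stable hφ hα hΓ₀ hT hcl (Fin.ofNat n j) with h1 | h1
    · exact Or.inl h1.2
    · refine Or.inr ⟨h1.1, ?_⟩
      obtain ⟨x, hx⟩ := h1.2
      exact ⟨x, hx.congr fun t => (inner_vertex ht (y t) (start_ne_none (hcl _))).symm⟩

/-- At the maximal time, the curves converge to an admissible closed curve. -/
theorem exists_limit_curve (hφ : IsAnisotropy φ) (hα : 0 < α) (hΓ₀ : Γ₀.Admissible φ) (hT : 0 < T)
    (h : IsSolution (Γ₀.velocity φ α) Γ₀.region Γ₀.offset (T : ℝ) y)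
    (hcl : ∀ i, ¬ (Γ₀.piece i).IsHalfLine) :
    ∃ (m : ℕ) (_ : NeZero m) (Γ : PolygonalCurve m), Γ.Admissible φ ∧ IsCompact Γ.carrier ∧
      ∀ ε > 0, ∀ᶠ t in 𝓝[<] T, HausdorffClose ε (Γ₀.curveOf (y t)).carrier Γ.carrier := by
  have hsucc : ∀ j, Fin.ofNat n (j + 1) = Fin.ofNat n j + 1 := fun j => by
    ext; simp [Fin.ofNat, Fin.val_add]
  have hval : ∀ i : Fin n, Fin.ofNat n i.val = i := fun i => by
    ext; simp [Fin.ofNat, Nat.mod_eq_of_lt i.isLt]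
  obtain ⟨i, hi⟩ := h.exists_not_collapsed hφ hα hΓ₀ hT hcl
  obtain ⟨m, hm, Γ, h1, h2, h3⟩ := Chain.exists_limit hφ n (NeZero.pos n) _ _ _
    (h.chain hφ hα hΓ₀ hT hcl) ⟨i.val, by simpa only [hval] using hi⟩
  refine ⟨m, hm, Γ, h1, h2, fun ε hε => ?_⟩
  filter_upwards [h3 ε hε, Ioo_mem_nhdsLT hT] with t ht ht'
  have e : (Γ₀.curveOf (y t)).carrier = chainCarrier fun j => Γ₀.vertex (y t) (Fin.ofNat n j) := by
    rw [carrier_curveOf (hΓ₀.transversal hφ) hcl (h.mem_region ⟨ht'.1.le, ht'.2⟩)]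
    apply Subset.antisymm
    · refine iUnion_subset fun i => ?_
      have := subset_iUnion (fun j => segment ℝ (Γ₀.vertex (y t) (Fin.ofNat n j))
        (Γ₀.vertex (y t) (Fin.ofNat n (j + 1)))) i.val
      simpa only [chainCarrier, hsucc, hval] using this
    · refine iUnion_subset fun j => ?_
      simp only [hsucc]
      exact subset_iUnion (fun i => segment ℝ (Γ₀.vertex (y t) i) (Γ₀.vertex (y t) (i + 1))) _
  rwa [e]

/-- Behaviour of the point sets up to the maximal time. -/
theorem exists_continuous_extension (hφ : IsAnisotropy φ) (hα : 0 < α) (hΓ₀ : Γ₀.Admissible φ)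
    (hT : 0 < T) (h : IsSolution (Γ₀.velocity φ α) Γ₀.region Γ₀.offset (T : ℝ) y)
    (hcl : ∀ i, ¬ (Γ₀.piece i).IsHalfLine) :
    ∃ (m : ℕ) (_ : NeZero m) (Γend : PolygonalCurve m), Γend.Admissible φ ∧
      KuratowskiContinuousOn
        (fun t => if t < T then (Γ₀.curveOf (y t)).carrier else Γend.carrier) (Icc 0 T) ∧
      Bornology.IsBounded
        (⋃ t ∈ Icc 0 T, if t < T then (Γ₀.curveOf (y t)).carrier else Γend.carrier) := by
  obtain ⟨m, hm, Γend, hadm, hcomp, hlim⟩ := h.exists_limit_curve hφ hα hΓ₀ hT hcl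
  have htr := hΓ₀.transversal hφ
  have hvc : ∀ i, ContinuousOn (fun t => Γ₀.vertex (y t) i) (Ico 0 T) := fun i =>
    (Γ₀.continuous_vertex i).comp_continuousOn h.continuousOn_Ico
  refine ⟨m, hm, Γend, hadm, fun t ht => ?_, ?_⟩
  · have hne : (𝓝[Icc 0 T] t).NeBot := mem_closure_iff_nhdsWithin_neBot.1 (subset_closure ht)
    refine kuratowski_eq_of_hausdorffClose ?_ fun ε hε => ?_
    · simp only
      split_ifs with htT
      · exact (isCompact_carrier_curveOf htr hcl (h.mem_region ⟨ht.1, htT⟩)).isClosed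
      · exact hcomp.isClosed
    · rcases ht.2.lt_or_eq with htT | rfl
      · have hIco : Ico 0 T ∈ 𝓝[Icc 0 T] t := by
          filter_upwards [mem_nhdsWithin_of_mem_nhds (Iio_mem_nhds htT), self_mem_nhdsWithin]
            with s hs hs'
          exact ⟨hs'.1, hs⟩
        have hclose : ∀ᶠ s in 𝓝[Icc 0 T] t, ∀ i,
            dist (Γ₀.vertex (y s) i) (Γ₀.vertex (y t) i) ≤ ε := by
          rw [eventually_all]
          intro i
          have hc : ContinuousWithinAt (fun t => Γ₀.vertex (y t) i) (Icc 0 T) t :=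
            (hvc i t ⟨ht.1, htT⟩).mono_of_mem_nhdsWithin hIco
          exact (tendsto_iff_dist_tendsto_zero.1 hc).eventually_le_const hε
        filter_upwards [hIco, hclose] with s hs hs'
        simp only [hs.2, htT, if_true]
        exact hausdorffClose_carrier_curveOf htr hcl (h.mem_region hs)
          (h.mem_region ⟨ht.1, htT⟩) hs'
      · have hle : 𝓝[Icc 0 t] t ≤ 𝓝[insert t (Iio t)] t := by
          rw [Iio_insert]
          exact nhdsWithin_mono _ Icc_subset_Iic_self
        refine Eventually.filter_mono hle ?_
        rw [nhdsWithin_insert, eventually_sup, eventually_pure]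
        refine ⟨by simpa using HausdorffClose.refl hε.le Γend.carrier, ?_⟩
        filter_upwards [hlim ε hε, self_mem_nhdsWithin] with s hs hs'
        rw [mem_Iio] at hs'
        simpa only [hs', if_true, lt_irrefl, if_false] using hs
  · obtain ⟨a, haT, ha⟩ := (mem_nhdsLT_iff_exists_Ioo_subset (a := T)).1 (hlim 1 one_pos)
    obtain ⟨R, hR⟩ := hcomp.isBounded.subset_closedBall 0
    have hb : ∀ i, ∃ R, ∀ t ∈ Icc 0 a, ‖Γ₀.vertex (y t) i‖ ≤ R := fun i =>
      isCompact_Icc.exists_bound_of_continuousOn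
        ((hvc i).mono fun t ht => ⟨ht.1, ht.2.trans_lt haT⟩)
    choose R' hR' using hb
    obtain ⟨M, hM⟩ := (finite_range R').bddAbove
    refine (Metric.isBounded_closedBall (x := (0 : Plane)) (r := max M (|R| + 1))).subset ?_
    refine iUnion₂_subset fun t ht x hx => ?_
    rw [mem_closedBall_zero_iff]
    have hRend : ∀ z ∈ Γend.carrier, ‖z‖ ≤ |R| := fun z hz =>
      (mem_closedBall_zero_iff.1 (hR hz)).trans (le_abs_self R)
    split_ifs at hx with htT
    · rcases le_or_gt t a with hta | hta
      · rw [carrier_curveOf htr hcl (h.mem_region ⟨ht.1, htT⟩)] at hx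
        obtain ⟨i, hi⟩ := mem_iUnion.1 hx
        have hv : ∀ i, Γ₀.vertex (y t) i ∈ Metric.closedBall (0 : Plane) M := fun i => by
          rw [mem_closedBall_zero_iff]
          exact (hR' i t ⟨ht.1, hta⟩).trans (hM ⟨i, rfl⟩)
        have := (convex_closedBall (0 : Plane) M).segment_subset (hv i) (hv (i + 1)) hi
        exact (mem_closedBall_zero_iff.1 this).trans (le_max_left _ _)
      · obtain ⟨z, hz, hxz⟩ := (ha ⟨hta, htT⟩ : HausdorffClose 1 _ _).1 x hx
        refine le_max_of_le_right ?_
        rw [dist_eq_norm] at hxz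
        have := norm_le_norm_sub_add x z
        linarith [hRend z hz]
    · exact le_max_of_le_right (by linarith [hRend x hx])

end IsSolution

lemma PolygonalCurve.length_curveOf (ht : Γ₀.Transversal) {H : Fin n → ℝ} (hH : H ∈ Γ₀.region)
    (hl : ∀ i, (Γ₀.piece i).IsHalfLine → H i = Γ₀.offset i) {i : Fin n}
    (hi : ¬ (Γ₀.piece i).IsHalfLine) :
    ((Γ₀.curveOf H).piece i).length = Γ₀.lengthOf H i := by
  rw [(parallel_curveOf ht hH hl).length_eq ht hi, offset_curveOf ht hH]

end Crystalline

end

open Crystalline in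
theorem theorem4p1 (φ : Plane → ℝ) (hφ : IsCrystalline φ) (α : ℝ) (hα : 0 < α)
    (n : ℕ) [NeZero n] (Γ₀ : PolygonalCurve n) (hΓ₀ : Γ₀.Admissible φ) :
    ∃ (Tmax : EReal) (Γ : ℝ → PolygonalCurve n),
      -- existence up to a maximal time, and uniqueness
      IsMaximalFlow φ α Γ₀ Tmax Γ ∧
      (∀ (T : EReal) (Δ : ℝ → PolygonalCurve n), IsFlow φ α Γ₀ T Δ →
        ∀ t : ℝ, 0 ≤ t → (t : EReal) < T → Δ t = Γ t) ∧
      -- semigroup property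
      (∀ s : ℝ, 0 ≤ s → (s : EReal) < Tmax →
        IsMaximalFlow φ α (Γ s) (Tmax - s) (fun t => Γ (s + t)) ∧
        ∀ (T : EReal) (Δ : ℝ → PolygonalCurve n), IsMaximalFlow φ α (Γ s) T Δ →
          T = Tmax - s ∧
          ∀ t : ℝ, 0 ≤ t → ((s + t : ℝ) : EReal) < Tmax → Γ (s + t) = Δ t) ∧
      -- behaviour at a finite maximal time
      (Bornology.IsBounded Γ₀.carrier → ∀ T : ℝ, Tmax = (T : EReal) →
        (∃ (m : ℕ) (_ : NeZero m) (Γend : PolygonalCurve m),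
          Γend.Admissible φ ∧
          KuratowskiContinuousOn
            (fun t => if t < T then (Γ t).carrier else Γend.carrier) (Set.Icc 0 T) ∧
          Bornology.IsBounded
            (⋃ t ∈ Set.Icc 0 T, if t < T then (Γ t).carrier else Γend.carrier)) ∧
        (∃ i, Γ₀.transition i = 0 ∧
          Filter.Tendsto (fun t => ((Γ t).piece i).length)
            (nhdsWithin T (Set.Iio T)) (nhds 0)) ∧
        (∀ i, Γ₀.curvature φ i ≠ 0 →
          ∃ ε > 0, ∀ t ∈ Set.Ico 0 T, ε ≤ ((Γ t).piece i).length)) := by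
  have ht := hΓ₀.transversal hφ.1
  obtain ⟨Tmax, y, hpos, hy, hymax, hmax⟩ := exists_isMaximalFlow hφ.1 ht α
  refine ⟨Tmax, fun t => Γ₀.curveOf (y t), hmax, fun T Δ hΔ t h0 hT => ?_, fun s hs hsT => ?_,
    fun hb T hT => ?_⟩
  · exact hΔ.eq hφ.1 ht hmax.1 h0 hT (hT.trans_le (hmax.2 T Δ hΔ))
  · have hts : (Γ₀.curveOf (y s)).Transversal :=
      ((hmax.1.parallel s hs hsT).admissible hΓ₀).transversal hφ.1
    have hr := hmax.restart hφ.1 ht hs hsT hts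
    refine ⟨hr, fun T Δ hΔ => ?_⟩
    have hTeq : T = Tmax - s := le_antisymm (hr.2 T Δ hΔ.1) (hΔ.2 _ _ hr.1)
    refine ⟨hTeq, fun t h0 hst => ?_⟩
    have hlt : (t : EReal) < Tmax - s := by
      rw [EReal.lt_sub_iff_add_lt (by simp) (by simp), add_comm, ← EReal.coe_add]
      exact hst
    exact hr.1.eq hφ.1 hts hΔ.1 h0 hlt (hTeq ▸ hlt)
  · subst hT
    have hT0 : 0 < T := EReal.coe_lt_coe_iff.1 hpos
    have hcl := Crystalline.PolygonalCurve.not_isHalfLine_of_isBounded hb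
    have hlen : ∀ i, ∀ t ∈ Set.Ico 0 T,
        ((Γ₀.curveOf (y t)).piece i).length = Γ₀.lengthOf (y t) i := fun i t h =>
      Crystalline.PolygonalCurve.length_curveOf ht (hy.mem_region h)
        (fun j hj => absurd hj (hcl j)) (hcl i)
    refine ⟨hy.exists_continuous_extension hφ.1 hα hΓ₀ hT0 hcl, ?_, fun i hi => ?_⟩
    · obtain ⟨i, hi, hlim⟩ := hy.exists_collapsed hφ.1 hα hΓ₀ hT0 hymax hcl
      refine ⟨i, hi, hlim.congr' ?_⟩
      filter_upwards [Ioo_mem_nhdsLT hT0] with t h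
      exact (hlen i t ⟨h.1.le, h.2⟩).symm
    · have hc : Γ₀.transition i ≠ 0 := fun h => hi (by simp [Crystalline.PolygonalCurve.curvature, h])
      obtain ⟨ε, hε, hle⟩ := hy.exists_le_lengthOf hφ.1 hα hΓ₀ hcl hc
      exact ⟨ε, hε, fun t h => by rw [hlen i t h]; exact hle t h⟩
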